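/- An instance of Min-$k$CSG consists of a set $S=\{p_1,\dots,p_n\}$ of $n\ge 1$ distinct points in the Euclidean plane and a map $\alpha:S\to 2^{\{1,\dots,k\}}$. For a primary color $c\in\{1,\dots,k\}$ let $S_c=\{p\in S: c\in\alpha(p)\}$. A colored spanning graph is a graph $G=(S,E)$ such that for every $c$ the subgraph of $G$ induced by $S_c$ is connected (no condition if $S_c=\emptyset$). Its cost is the sum of the Euclidean lengths of its edges. The problem Min-$k$CSG asks for the minimum cost of a colored spanning graph. The model of computation is the real RAM: memory cells hold nonnegative integers or real numbers, there is indirect addressing by integers, and each instruction (integer addition, truncated subtraction and comparison; real addition, subtraction, multiplication, division, square root and comparison; assignment of integer or rational constants; reading or writing an array entry) and each evaluation of a test takes one step. There is no rounding of reals to integers. The input consists of $n$, $k$, the coordinates of $p_1,\dots,p_n$ and the $n\times k$ table of the relation $c\in\alpha(p_i)$. Theorem. There is a real RAM program that, on every instance with $k\ge 1$ primary colors in which the points $p_1,\dots,p_n$ are collinear and given in the order in which they occur along their line, outputs the minimum cost of a colored spanning graph. For every constant $k\ge 1$ it runs in $O(n)$ time. More precisely, there is a constant $C$, independent of $k$,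 $n$ and the instance, such that it makes at most $2^{C k^2 2^k}\cdot n$ steps for all $k,n\ge 1$. -/

import Mathlib

/-! ### Colored spanning graphs -/

namespace MinCSG

/-- An input with `n` points in the Euclidean plane, listed as `p 0, …, p (n - 1)`, and a coloring
`α` that gives each point a subset of the `k` primary colors. -/
structure Input (k n : ℕ) where
  p : Fin n → EuclideanSpace ℝ (Fin 2)
  α : Fin n → Finset (Fin k)

variable {k n : ℕ}

/-- The points are distinct, lie on one line, and are listed in the order in which they occur
along this line. -/
structure Input.SortedCollinear (I : Input k n) : Prop where
  injective : Function.Injective I.p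
  collinear : Collinear ℝ (Set.range I.p)
  sorted : ∀ i j l : Fin n, i < j → j < l → Wbtw ℝ (I.p i) (I.p j) (I.p l)

/-- The set `S_c` of (the indices of) the points whose color contains the primary color `c`. -/
def Input.colorClass (I : Input k n) (c : Fin k) : Set (Fin n) := {i | c ∈ I.α i}

/-- `G` is a colored spanning graph: for each primary color `c`, the subgraph induced by `S_c`
is connected (any two of its vertices are joined by a path in it; an unused primary color, with
`S_c` empty, imposes no condition). -/
def Input.IsCSG (I : Input k n) (G : SimpleGraph (Fin n)) : Prop :=
  ∀ c : Fin k, (G.induce (I.colorClass c)).Preconnected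

/-- The Euclidean length of an edge. -/
noncomputable def Input.length (I : Input k n) (e : Sym2 (Fin n)) : ℝ :=
  Sym2.lift ⟨fun i j => dist (I.p i) (I.p j), fun _ _ => dist_comm _ _⟩ e

open Classical in
/-- The cost of a graph: the sum of the lengths of its edges. -/
noncomputable def Input.cost (I : Input k n) (G : SimpleGraph (Fin n)) : ℝ :=
  ∑ e ∈ G.edgeFinset, I.length e

/-- `w` is the minimum cost of a colored spanning graph. -/
def Input.IsMinCost (I : Input k n) (w : ℝ) : Prop :=
  IsLeast {x : ℝ | ∃ G : SimpleGraph (Fin n), I.IsCSG G ∧ I.cost G = x} w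

end MinCSG

/-! ### The real RAM

Programs are while programs over integer and real variables and integer and real arrays. A
variable, and the name of an array, are fixed in the program text; the position inside an array is
computed at run time (indirect addressing). Each elementary instruction and each evaluation of a
test takes one step. Integers can only be added, subtracted (truncated at zero) and compared; reals
can be added, subtracted, multiplied, divided and compared, and there is a square root. There is no
conversion (such as rounding) between reals and integers. -/

namespace RealRAM

/-- The contents of the memory. -/
structure State where
  /-- integer variables -/
  ivar : ℕ → ℕ
  /-- real variables -/
  rvar : ℕ → ℝ
  /-- integer arrays: `iarr a m` is the entry of array `a` at position `m` -/
  iarr : ℕ → ℕ → ℕ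
  /-- real arrays: `rarr a m` is the entry of array `a` at position `m` -/
  rarr : ℕ → ℕ → ℝ

namespace State

/-- Assign a value to an integer variable. -/
def setI (s : State) (x v : ℕ) : State := { s with ivar := Function.update s.ivar x v }

/-- Assign a value to a real variable. -/
def setR (s : State) (x : ℕ) (v : ℝ) : State := { s with rvar := Function.update s.rvar x v }

/-- Assign a value to an entry of an integer array. -/
def setIArr (s : State) (a m v : ℕ) : State :=
  { s with iarr := Function.update s.iarr a (Function.update (s.iarr a) m v) }

/-- Assign a value to an entry of a real array. -/
def setRArr (s : State) (a m : ℕ) (v : ℝ) : State :=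
  { s with rarr := Function.update s.rarr a (Function.update (s.rarr a) m v) }

end State

/-- The elementary instructions. -/
inductive Instr where
  | iconst (x c : ℕ)
  | iadd (x y z : ℕ)
  | isub (x y z : ℕ)
  | iload (x a y : ℕ)
  | istore (a y x : ℕ)
  | rconst (x : ℕ) (q : ℚ)
  | radd (x y z : ℕ)
  | rsub (x y z : ℕ)
  | rmul (x y z : ℕ)
  | rdiv (x y z : ℕ)
  | rsqrt (x y : ℕ)
  | rload (x a y : ℕ)
  | rstore (a y x : ℕ)

/-- The effect of an elementary instruction. In `iload x a y` and `rload x a y` the variable `x`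
receives the entry of array `a` at the position stored in the integer variable `y`; in
`istore a y x` and `rstore a y x` this entry receives the value of `x`. -/
noncomputable def Instr.run (s : State) : Instr → State
  | .iconst x c => s.setI x c
  | .iadd x y z => s.setI x (s.ivar y + s.ivar z)
  | .isub x y z => s.setI x (s.ivar y - s.ivar z)
  | .iload x a y => s.setI x (s.iarr a (s.ivar y))
  | .istore a y x => s.setIArr a (s.ivar y) (s.ivar x)
  | .rconst x q => s.setR x (q : ℝ)
  | .radd x y z => s.setR x (s.rvar y + s.rvar z)
  | .rsub x y z => s.setR x (s.rvar y - s.rvar z)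
  | .rmul x y z => s.setR x (s.rvar y * s.rvar z)
  | .rdiv x y z => s.setR x (s.rvar y / s.rvar z)
  | .rsqrt x y => s.setR x (Real.sqrt (s.rvar y))
  | .rload x a y => s.setR x (s.rarr a (s.ivar y))
  | .rstore a y x => s.setRArr a (s.ivar y) (s.rvar x)

/-- The tests: comparisons of two integer variables or of two real variables. -/
inductive Test where
  | ilt (x y : ℕ)
  | ile (x y : ℕ)
  | ieq (x y : ℕ)
  | ine (x y : ℕ)
  | rlt (x y : ℕ)
  | rle (x y : ℕ)

/-- The test `b` succeeds in the state `s`. -/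
def Test.Holds (s : State) : Test → Prop
  | .ilt x y => s.ivar x < s.ivar y
  | .ile x y => s.ivar x ≤ s.ivar y
  | .ieq x y => s.ivar x = s.ivar y
  | .ine x y => s.ivar x ≠ s.ivar y
  | .rlt x y => s.rvar x < s.rvar y
  | .rle x y => s.rvar x ≤ s.rvar y

/-- Programs. -/
inductive Program where
  | skip
  | instr (a : Instr)
  | seq (P Q : Program)
  | cond (b : Test) (P Q : Program)
  | loop (b : Test) (P : Program)

/-- `Exec P s s' t`: the program `P`, started in the state `s`, halts in the state `s'` after
exactly `t` steps. -/
inductive Exec : Program → State → State → ℕ → Prop where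
  | skip (s : State) : Exec .skip s s 0
  | instr (a : Instr) (s : State) : Exec (.instr a) s (a.run s) 1
  | seq {P Q : Program} {s s₁ s₂ : State} {t₁ t₂ : ℕ} :
      Exec P s s₁ t₁ → Exec Q s₁ s₂ t₂ → Exec (.seq P Q) s s₂ (t₁ + t₂)
  | cond_true {b : Test} {P Q : Program} {s s' : State} {t : ℕ} :
      b.Holds s → Exec P s s' t → Exec (.cond b P Q) s s' (t + 1)
  | cond_false {b : Test} {P Q : Program} {s s' : State} {t : ℕ} :
      ¬ b.Holds s → Exec Q s s' t → Exec (.cond b P Q) s s' (t + 1)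
  | loop_true {b : Test} {P : Program} {s s₁ s₂ : State} {t₁ t₂ : ℕ} :
      b.Holds s → Exec P s s₁ t₁ → Exec (.loop b P) s₁ s₂ t₂ →
        Exec (.loop b P) s s₂ (t₁ + t₂ + 1)
  | loop_false {b : Test} {P : Program} {s : State} :
      ¬ b.Holds s → Exec (.loop b P) s s 1

end RealRAM

/-! ### Solving the problem on a real RAM -/

namespace MinCSG

open Classical in
/-- The initial memory: integer variables `0` and `1` hold `n` and `k`, integer array `0` holds the
`n × k` membership table of the coloring row by row, real arrays `0` and `1` hold the first and
second coordinates of the points, and everything else is zero. -/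
noncomputable def Input.initialState {k n : ℕ} (I : Input k n) : RealRAM.State where
  ivar x := if x = 0 then n else if x = 1 then k else 0
  rvar _ := 0
  iarr a m := if a = 0 ∧ ∃ (i : Fin n) (c : Fin k), m = k * i + c ∧ c ∈ I.α i then 1 else 0
  rarr a m :=
    if h : m < n then
      if a = 0 then I.p ⟨m, h⟩ 0 else if a = 1 then I.p ⟨m, h⟩ 1 else 0
    else 0

/-- On every input with `k` primary colors and `n ≥ 1` collinear points (in sorted order), the
program `P` halts within `T n` steps with the minimum cost of a colored spanning graph in real
variable `0`. -/
def SolvesCollinear (P : RealRAM.Program) (k : ℕ) (T : ℕ → ℕ) : Prop :=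
  ∀ n : ℕ, 1 ≤ n → ∀ I : Input k n, I.SortedCollinear →
    ∃ (s : RealRAM.State) (t : ℕ),
      RealRAM.Exec P I.initialState s t ∧ t ≤ T n ∧ I.IsMinCost (s.rvar 0)

end MinCSG

/-! ### Costs and normal forms of colored spanning graphs -/

namespace MinCSG

section Graphs

variable {n : ℕ}

/-! On a line, cutting an edge $uv$ at a vertex $w$ between its ends does not change the cost, since
$|uv| = |uw| + |wv|$. If $w$ has the same full color (set of primary colors) as the left end $u$,
then the path $u, w, v$ lies in every primary color that $uv$ lies in, so the graph stays spanning.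
Every colored spanning graph can thus be made `LeftNormal` at no extra cost; the sum of squared
index lengths guarantees that this ends (`exists_leftNormal`). In a left-normal graph each edge that
reaches a vertex from the left starts at the last earlier vertex of some full color, so there are at
most $2^k$ possible starting points.

This permits a sweep from left to right whose memory for partial solutions does not grow with $n$.
For each primary color $c$ it suffices to know which of the last vertices, one for each full color
seen so far, lie in the same component of color $c$. A label of $k$ bits for each pair of a primary
and a full color records this, so there are $N = 2^{k^2 2^k}$ states, and the program stores a least
cost for each state reached. For a new vertex $v$ it tries all sets of full colors whose last
vertices are joined to $v$, and all pairs of an old and a new state. `Check` admits a transition if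
the new state claims no connection that is absent, and if the vertex displaced by $v$ as the last of
its color leaves every one of its components with another representative or attached to $v$.

Soundness and completeness use different invariants. `Realized` says that a stored cost is at least
the cost of an actual graph in which the claimed connections hold; further connections do no harm.
`Tracks` follows the exact connections of one fixed left-normal spanning graph. `Realized.succ` and
`Tracks.succ` propagate them, `Invariant.succ` combines them with the memory contents, and
`Invariant.isMinCost` reads off the minimum at the end.

For the running time, the program is written in a small structured language with a verified
compiler. All loops except the one over the points have bounds at most $N$, so each piece of the
program takes at most $N^d$ steps, where $d$ depends only on its text (`simulates_comp`). Together
this gives $N^{d+2} n = 2^{(d+2) k^2 2^k} n$ steps. The integer instructions offer neither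
multiplication nor access to bits, so these are replaced by repeated addition and precomputed
tables. -/

/-- The edges of `G` whose two ends have the color `c`, where the colors of the vertex `u` are the
binary digits of `τ u`. -/
def colorGraph (τ : Fin n → ℕ) (G : SimpleGraph (Fin n)) (c : ℕ) : SimpleGraph (Fin n) where
  Adj u v := G.Adj u v ∧ (τ u).testBit c = true ∧ (τ v).testBit c = true
  symm := ⟨fun _ _ h => ⟨h.1.symm, h.2.2, h.2.1⟩⟩
  loopless := ⟨fun _ h => h.1.ne rfl⟩

/-- Each color class is connected in `G`. -/
def Spanning (k : ℕ) (τ : Fin n → ℕ) (G : SimpleGraph (Fin n)) : Prop :=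
  ∀ c < k, ∀ u v, (τ u).testBit c = true → (τ v).testBit c = true →
    (colorGraph τ G c).Reachable u v

/-- The edges of `G` between the first `i` vertices. -/
def below (G : SimpleGraph (Fin n)) (i : ℕ) : SimpleGraph (Fin n) where
  Adj u v := G.Adj u v ∧ u.val < i ∧ v.val < i
  symm := ⟨fun _ _ h => ⟨h.1.symm, h.2.2, h.2.1⟩⟩
  loopless := ⟨fun _ h => h.1.ne rfl⟩

open Classical in
/-- The edges of `G`, written as increasing pairs. -/
noncomputable def edgePairs (G : SimpleGraph (Fin n)) : Finset (Fin n × Fin n) :=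
  Finset.univ.filter fun e => e.1 < e.2 ∧ G.Adj e.1 e.2

theorem mem_edgePairs {G : SimpleGraph (Fin n)} {u v : Fin n} :
    (u, v) ∈ edgePairs G ↔ u < v ∧ G.Adj u v := by
  simp [edgePairs]

/-- The sum of the weights of the edges of `G`. -/
noncomputable def totalCost (d : Fin n → Fin n → ℝ) (G : SimpleGraph (Fin n)) : ℝ :=
  ∑ e ∈ edgePairs G, d e.1 e.2

theorem colorGraph_mono (τ : Fin n → ℕ) {G H : SimpleGraph (Fin n)} (h : G ≤ H) (c : ℕ) :
    colorGraph τ G c ≤ colorGraph τ H c := fun _ _ h' => ⟨h h'.1, h'.2⟩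

/-- Each unordered edge has exactly one increasing representative. -/
theorem totalCost_eq_cost {k : ℕ} (I : Input k n) (G : SimpleGraph (Fin n)) :
    totalCost (fun u v => dist (I.p u) (I.p v)) G = I.cost G := by
  classical
  unfold totalCost Input.cost
  refine Finset.sum_bij (fun e _ => s(e.1, e.2)) ?_ ?_ ?_ ?_
  · rintro ⟨u, v⟩ h
    simpa using (mem_edgePairs.1 h).2
  · rintro ⟨u, v⟩ h ⟨u', v'⟩ h' e
    have h1 := (mem_edgePairs.1 h).1
    have h2 := (mem_edgePairs.1 h').1
    rcases Sym2.eq_iff.1 e with ⟨a, b⟩ | ⟨a, b⟩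
    · simp only at a b
      rw [a, b]
    · simp only at a b
      subst a b
      exact absurd h1 (not_lt.2 h2.le)
  · intro e
    induction e using Sym2.ind with
    | _ u v =>
      intro h
      have h : G.Adj u v := by simpa using h
      rcases lt_or_gt_of_ne h.ne with h1 | h1
      · exact ⟨(u, v), mem_edgePairs.2 ⟨h1, h⟩, rfl⟩
      · exact ⟨(v, u), mem_edgePairs.2 ⟨h1, h.symm⟩, Sym2.eq_swap⟩
  · rintro ⟨u, v⟩ _
    rfl

/-- The arrival of a vertex adds a star directed to the left. This is used both for the graph that
is being built and for the restrictions of a given graph. -/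
theorem totalCost_star (d : Fin n → Fin n → ℝ) {G H : SimpleGraph (Fin n)} {v : Fin n}
    {N : Fin n → Prop} [DecidablePred N] (hH : ∀ x y, x < y → (H.Adj x y ↔ G.Adj x y ∨ y = v ∧ N x))
    (hN : ∀ x, N x → x < v) (hG : ∀ x, ¬ G.Adj x v) :
    totalCost d H = totalCost d G + ∑ u with N u, d u v := by
  classical
  have hd : Disjoint (edgePairs G) ((Finset.univ.filter N).image fun u => (u, v)) := by
    rw [Finset.disjoint_left]
    rintro ⟨x, y⟩ h1 h2
    simp only [Finset.mem_image, Finset.mem_filter, Prod.mk.injEq] at h2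
    obtain ⟨_, _, rfl, rfl⟩ := h2
    exact hG _ (mem_edgePairs.1 h1).2
  have he : edgePairs H = edgePairs G ∪ (Finset.univ.filter N).image fun u => (u, v) := by
    ext ⟨x, y⟩
    simp only [mem_edgePairs, Finset.mem_union, Finset.mem_image, Finset.mem_filter,
      Finset.mem_univ, true_and, Prod.mk.injEq]
    constructor
    · rintro ⟨h1, h2⟩
      rcases (hH x y h1).1 h2 with h3 | ⟨rfl, h3⟩
      · exact Or.inl ⟨h1, h3⟩
      · exact Or.inr ⟨x, h3, rfl, rfl⟩
    · rintro (⟨h1, h2⟩ | ⟨x, h1, rfl, rfl⟩)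
      · exact ⟨h1, (hH x y h1).2 (Or.inl h2)⟩
      · exact ⟨hN x h1, (hH _ _ (hN x h1)).2 (Or.inr ⟨rfl, h1⟩)⟩
  unfold totalCost
  rw [he, Finset.sum_union hd, Finset.sum_image]
  intro a _ b _ h
  exact (Prod.mk.inj h).1

/-! ### Left-normal graphs -/

/-- No edge passes over a vertex of the same color as its left end. -/
def LeftNormal (τ : Fin n → ℕ) (G : SimpleGraph (Fin n)) : Prop :=
  ∀ u w v, u < w → w < v → G.Adj u v → τ w ≠ τ u

/-- The graph `G` with the edge `uv` replaced by the edges `uw` and `wv`. -/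
def subdivideAt (G : SimpleGraph (Fin n)) (u w v : Fin n) : SimpleGraph (Fin n) :=
  G.deleteEdges {s(u, v)} ⊔ (SimpleGraph.edge u w ⊔ SimpleGraph.edge w v)

/-- Equality can fail because $uw$ or $wv$ may already be an edge; with nonnegative weights such a
coincidence only lowers the cost. -/
theorem totalCost_subdivideAt_le (d : Fin n → Fin n → ℝ) (hd : ∀ u v, 0 ≤ d u v)
    {G : SimpleGraph (Fin n)} {u w v : Fin n} (huw : u < w) (hwv : w < v) (h : G.Adj u v) :
    totalCost d (subdivideAt G u w v) + d u v ≤ totalCost d G + (d u w + d w v) := by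
  classical
  have hsub : edgePairs (subdivideAt G u w v) ⊆
      (edgePairs G).erase (u, v) ∪ {(u, w), (w, v)} := by
    rintro ⟨x, y⟩ hxy
    obtain ⟨h1, h2⟩ := mem_edgePairs.1 hxy
    simp only [subdivideAt, SimpleGraph.sup_adj, SimpleGraph.deleteEdges_adj,
      SimpleGraph.edge_adj, Set.mem_singleton_iff, Sym2.eq_iff] at h2
    simp only [Finset.mem_union, Finset.mem_erase, mem_edgePairs, Finset.mem_insert,
      Finset.mem_singleton, Prod.mk.injEq]
    rcases h2 with h2 | ⟨⟨rfl, rfl⟩ | ⟨rfl, rfl⟩, _⟩ | ⟨⟨rfl, rfl⟩ | ⟨rfl, rfl⟩, _⟩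
    · exact Or.inl ⟨fun h3 => h2.2 (Or.inl (Prod.mk.inj h3)), h1, h2.1⟩
    · simp
    · exact absurd h1 (not_lt.2 huw.le)
    · simp
    · exact absurd h1 (not_lt.2 hwv.le)
  have h1 : totalCost d (subdivideAt G u w v) ≤
      ∑ e ∈ (edgePairs G).erase (u, v), d e.1 e.2 + (d u w + d w v) := by
    refine (Finset.sum_le_sum_of_subset_of_nonneg hsub fun _ _ _ => hd _ _).trans ?_
    have h2 := Finset.sum_union_inter (s₁ := (edgePairs G).erase (u, v))
      (s₂ := {(u, w), (w, v)}) (f := fun e : Fin n × Fin n => d e.1 e.2)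
    have h3 : 0 ≤ ∑ e ∈ (edgePairs G).erase (u, v) ∩ {(u, w), (w, v)}, d e.1 e.2 :=
      Finset.sum_nonneg fun _ _ => hd _ _
    have h4 : (u, w) ≠ (w, v) := fun h => huw.ne (Prod.mk.inj h).1
    rw [Finset.sum_pair h4] at h2
    simp only at h2
    linarith
  have h5 := Finset.sum_erase_add (edgePairs G) (fun e : Fin n × Fin n => d e.1 e.2)
    (mem_edgePairs.2 ⟨huw.trans hwv, h⟩)
  have h6 : totalCost d G = ∑ e ∈ edgePairs G, d e.1 e.2 := rfl
  simp only at h5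
  linarith

theorem reachable_mono_of_adj {V : Type*} {G H : SimpleGraph V}
    (h : ∀ x y, G.Adj x y → H.Reachable x y) {u v : V} (huv : G.Reachable u v) :
    H.Reachable u v := by
  rw [SimpleGraph.reachable_iff_reflTransGen] at huv
  induction huv with
  | refl => exact .refl _
  | tail _ h2 ih => exact ih.trans (h _ _ h2)

/-- Since `w` has all primary colors of `u`, the detour $u, w, v$ replaces $uv$ in each color that
both `u` and `v` have. -/
theorem Spanning.subdivideAt {k : ℕ} {τ : Fin n → ℕ} {G : SimpleGraph (Fin n)}
    (hG : Spanning k τ G) {u w v : Fin n} (huw : u < w) (hwv : w < v) (hτ : τ w = τ u) :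
    Spanning k τ (subdivideAt G u w v) := by
  intro c hc x y hx hy
  refine reachable_mono_of_adj ?_ (hG c hc x y hx hy)
  intro x y ⟨h1, h2, h3⟩
  have key : (τ u).testBit c = true → (τ v).testBit c = true →
      (colorGraph τ (MinCSG.subdivideAt G u w v) c).Reachable u v := by
    intro h4 h5
    have a1 : (colorGraph τ (MinCSG.subdivideAt G u w v) c).Adj u w := by
      refine ⟨?_, h4, hτ ▸ h4⟩
      simp [MinCSG.subdivideAt, SimpleGraph.edge_adj, huw.ne]
    have a2 : (colorGraph τ (MinCSG.subdivideAt G u w v) c).Adj w v := by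
      refine ⟨?_, hτ ▸ h4, h5⟩
      simp [MinCSG.subdivideAt, SimpleGraph.edge_adj, hwv.ne]
    exact a1.reachable.trans a2.reachable
  by_cases he : s(x, y) = s(u, v)
  · rcases Sym2.eq_iff.1 he with ⟨rfl, rfl⟩ | ⟨rfl, rfl⟩
    · exact key h2 h3
    · exact (key h3 h2).symm
  · refine SimpleGraph.Adj.reachable ⟨?_, h2, h3⟩
    simp only [MinCSG.subdivideAt, SimpleGraph.sup_adj, SimpleGraph.deleteEdges_adj,
      Set.mem_singleton_iff]
    exact Or.inl ⟨h1, he⟩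

/-- Subdivision preserves the cost bound, so minimality of the cost alone would not exclude a bad
edge. A second potential, minimized among the finitely many spanning graphs that are not more
expensive, does. -/
theorem exists_leftNormal {k : ℕ} {τ : Fin n → ℕ} {d : Fin n → Fin n → ℝ}
    (hd : ∀ u v, 0 ≤ d u v) (hadd : ∀ u w v, u < w → w < v → d u w + d w v = d u v)
    {G : SimpleGraph (Fin n)} (hG : Spanning k τ G) :
    ∃ H, Spanning k τ H ∧ LeftNormal τ H ∧ totalCost d H ≤ totalCost d G := by
  -- A subdivision strictly lowers this potential: $(v-u)^2 - (w-u)^2 - (v-w)^2 = 2(w-u)(v-w) > 0$.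
  let e : Fin n → Fin n → ℝ := fun u v => ((v : ℝ) - u) ^ 2
  obtain ⟨H, ⟨h1, h2⟩, h3⟩ := Set.exists_min_image
    {H : SimpleGraph (Fin n) | Spanning k τ H ∧ totalCost d H ≤ totalCost d G} (totalCost e)
    (Set.toFinite _) ⟨G, hG, le_rfl⟩
  refine ⟨H, h1, ?_, h2⟩
  intro u w v huw hwv huv hτ
  have h4 := totalCost_subdivideAt_le d hd huw hwv huv
  have h5 := totalCost_subdivideAt_le e (fun _ _ => sq_nonneg _) huw hwv huv
  have h6 := h3 _ ⟨h1.subdivideAt huw hwv hτ, by linarith [hadd u w v huw hwv]⟩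
  have h7 : (u : ℝ) < w := by exact_mod_cast huw
  have h8 : (w : ℝ) < v := by exact_mod_cast hwv
  simp only [e] at h5 h6
  nlinarith [mul_pos (sub_pos.2 h7) (sub_pos.2 h8)]

/-! ### The transitions of the dynamic program -/

/-- `last A` is the last of the first `i` vertices with color `A`, if there is one, and `seen A`
says that there is one. -/
structure Stage (τ : Fin n → ℕ) (i : ℕ) (seen : ℕ → Prop) (last : ℕ → Fin n) : Prop where
  last_lt : ∀ A, seen A → (last A).val < i
  color_last : ∀ A, seen A → τ (last A) = A
  seen_color : ∀ u : Fin n, u.val < i → seen (τ u)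
  le_last : ∀ u : Fin n, u.val < i → u ≤ last (τ u)

/-- The last vertex of color `A` is connected in color `c` to a vertex whose color lies in `Q`. -/
def Touched (M : ℕ) (seen Q : ℕ → Prop) (E : ℕ → ℕ → ℕ → Prop) (c A : ℕ) : Prop :=
  ∃ A' < M, Q A' ∧ seen A' ∧ A'.testBit c = true ∧ E c A' A

/-- A new vertex of color `B`, joined to the last vertices with colors in `Q`, can change the
connections `E` to connections that include `E'`, and no component is lost. -/
def Check (k M : ℕ) (seen : ℕ → Prop) (B : ℕ) (Q : ℕ → Prop) (E E' : ℕ → ℕ → ℕ → Prop) : Prop :=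
  (seen B → ∀ c < k, B.testBit c = true → Touched M seen Q E c B ∨
    ∃ A < M, A ≠ B ∧ seen A ∧ A.testBit c = true ∧ E c A B) ∧
  ∀ c < k, ∀ A < M, A.testBit c = true → (seen A ∨ A = B) →
    ∀ A' < M, A'.testBit c = true → (seen A' ∨ A' = B) → E' c A A' →
      (B.testBit c = true ∧ (A = B ∨ Touched M seen Q E c A) ∧
        (A' = B ∨ Touched M seen Q E c A')) ∨ (A ≠ B ∧ A' ≠ B ∧ E c A A')

theorem Stage.succ {τ : Fin n → ℕ} {i : ℕ} {seen : ℕ → Prop} {last : ℕ → Fin n}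
    (h : Stage τ i seen last) {v : Fin n} (hv : v.val = i) :
    Stage τ (i + 1) (fun A => seen A ∨ A = τ v) (Function.update last (τ v) v) := by
  have lt : ∀ u : Fin n, u.val < i + 1 → u ≠ v → u.val < i := by
    intro u h1 h2
    have : u.val ≠ v.val := fun h => h2 (Fin.ext h)
    omega
  constructor
  · intro A hA
    by_cases e : A = τ v
    · subst e; simp [hv]
    · rw [Function.update_of_ne e]
      have := h.last_lt A (hA.resolve_right e)
      omega
  · intro A hA
    by_cases e : A = τ v
    · subst e; simp
    · rw [Function.update_of_ne e]
      exact h.color_last A (hA.resolve_right e)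
  · intro u hu
    by_cases e : u = v
    · exact Or.inr (by rw [e])
    · exact Or.inl (h.seen_color u (lt u hu e))
  · intro u hu
    by_cases e : τ u = τ v
    · rw [e, Function.update_self, Fin.le_def]
      omega
    · rw [Function.update_of_ne e]
      exact h.le_last u (lt u hu fun h => e (by rw [h]))

-- The color of `last A` is `A`, so `last` is injective on the seen colors and a sum over colors
-- becomes a sum over vertices.
open Classical in
theorem Stage.sum_last {τ : Fin n → ℕ} {i M : ℕ} {seen : ℕ → Prop} {last : ℕ → Fin n}
    (h : Stage τ i seen last) (Q : ℕ → Prop) (f : Fin n → ℝ) :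
    ∑ A ∈ Finset.range M, (if Q A ∧ seen A then f (last A) else 0) =
      ∑ u with ∃ A < M, Q A ∧ seen A ∧ u = last A, f u := by
  rw [← Finset.sum_filter]
  have : (Finset.univ.filter fun u => ∃ A < M, Q A ∧ seen A ∧ u = last A) =
      ((Finset.range M).filter fun A => Q A ∧ seen A).image last := by
    ext u
    simp only [Finset.mem_filter, Finset.mem_univ, true_and, Finset.mem_image, Finset.mem_range]
    constructor
    · rintro ⟨A, h1, h2, h3, h4⟩
      exact ⟨A, ⟨h1, h2, h3⟩, h4.symm⟩
    · rintro ⟨A, ⟨h1, h2, h3⟩, h4⟩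
      exact ⟨A, h1, h2, h3, h4.symm⟩
  rw [this, Finset.sum_image]
  intro A hA A' hA' e
  simp only [Finset.coe_filter, Set.mem_ofPred_eq] at hA hA'
  rw [← h.color_last A hA.2.2, ← h.color_last A' hA'.2.2, e]

/-! ### Soundness of the transitions -/

/-- Some graph of cost at most `w` on the first `i` vertices has the connections `E`, and each of
its components in each color contains the last vertex of some color. -/
def Realized (k : ℕ) (τ : Fin n → ℕ) (d : Fin n → Fin n → ℝ) (i : ℕ) (seen : ℕ → Prop)
    (last : ℕ → Fin n) (E : ℕ → ℕ → ℕ → Prop) (w : ℝ) : Prop :=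
  ∃ G : SimpleGraph (Fin n), (∀ u v, G.Adj u v → u.val < i) ∧ totalCost d G ≤ w ∧
    (∀ c < k, ∀ A, seen A → A.testBit c = true → ∀ A', seen A' → A'.testBit c = true → E c A A' →
      (colorGraph τ G c).Reachable (last A) (last A')) ∧
    ∀ u : Fin n, u.val < i → ∀ c < k, (τ u).testBit c = true →
      ∃ A, seen A ∧ A.testBit c = true ∧ (colorGraph τ G c).Reachable u (last A)

-- Add to the realizing graph the edges from `v` to the chosen last vertices. Old connections
-- persist, touched components are merged through `v`, and the clauses of `Check` are what the two
-- conditions on the enlarged graph require.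
open Classical in
theorem Realized.succ {k M : ℕ} {τ : Fin n → ℕ} (hτ : ∀ u, τ u < M) {d : Fin n → Fin n → ℝ} {i : ℕ}
    {seen : ℕ → Prop} {last : ℕ → Fin n} (hs : Stage τ i seen last) {v : Fin n} (hv : v.val = i)
    {E E' : ℕ → ℕ → ℕ → Prop} (hE : ∀ c A A', E c A A' → E c A' A) {Q : ℕ → Prop} {w : ℝ}
    (h : Realized k τ d i seen last E w) (hc : Check k M seen (τ v) Q E E') :
    Realized k τ d (i + 1) (fun A => seen A ∨ A = τ v) (Function.update last (τ v) v) E'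
      (w + ∑ A ∈ Finset.range M, if Q A ∧ seen A then d (last A) v else 0) := by
  obtain ⟨G, hG, hw, h1, h2⟩ := h
  obtain ⟨ha, hb⟩ := hc
  let N : Fin n → Prop := fun u => ∃ A < M, Q A ∧ seen A ∧ u = last A
  have hN : ∀ x, N x → x < v := by
    rintro x ⟨A, _, _, hA, rfl⟩
    rw [Fin.lt_def, hv]
    exact hs.last_lt A hA
  have hGv : ∀ x y, G.Adj x y → x ≠ v := by
    rintro x y h rfl
    exact absurd (hG _ _ h) (by omega)
  let H : SimpleGraph (Fin n) :=
    { Adj := fun x y => G.Adj x y ∨ (y = v ∧ N x) ∨ (x = v ∧ N y)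
      symm := ⟨fun x y h => by
        rcases h with h | h | h
        · exact Or.inl h.symm
        · exact Or.inr (Or.inr h)
        · exact Or.inr (Or.inl h)⟩
      loopless := ⟨fun x h => by
        rcases h with h | ⟨rfl, h⟩ | ⟨rfl, h⟩
        · exact h.ne rfl
        · exact (hN _ h).ne rfl
        · exact (hN _ h).ne rfl⟩ }
  have hGH : G ≤ H := fun _ _ h => Or.inl h
  have mono : ∀ {c x y}, (colorGraph τ G c).Reachable x y → (colorGraph τ H c).Reachable x y :=
    fun h => h.mono (colorGraph_mono τ hGH _)
  have hne : ∀ A, seen A → A ≠ τ v → Function.update last (τ v) v A = last A :=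
    fun A _ e => Function.update_of_ne e _ _
  have touch : ∀ c < k, (τ v).testBit c = true → ∀ A, seen A → A.testBit c = true →
      Touched M seen Q E c A → (colorGraph τ H c).Reachable (last A) v := by
    rintro c hc hvc A hA hAc ⟨A', hA'M, hQ, hA', hA'c, he⟩
    refine (mono (h1 c hc A' hA' hA'c A hA hAc he)).symm.trans ?_
    refine SimpleGraph.Adj.reachable ⟨Or.inr (Or.inl ⟨rfl, A', hA'M, hQ, hA', rfl⟩), ?_, hvc⟩
    rwa [hs.color_last A' hA']
  refine ⟨H, ?_, ?_, ?_, ?_⟩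
  · rintro x y (h | ⟨rfl, h⟩ | ⟨rfl, h⟩)
    · have := hG _ _ h
      omega
    · have := Fin.lt_def.1 (hN _ h)
      omega
    · omega
  · rw [hs.sum_last Q fun u => d u v]
    have := totalCost_star d (G := G) (H := H) (v := v) (N := N) ?_ hN
      (fun x h => hGv _ _ h.symm rfl)
    · rw [this]
      exact add_le_add_left hw _
    · intro x y hxy
      constructor
      · rintro (h | h | ⟨rfl, h⟩)
        · exact Or.inl h
        · exact Or.inr h
        · exact absurd (hN _ h) (not_lt.2 hxy.le)
      · rintro (h | h)
        · exact Or.inl h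
        · exact Or.inr (Or.inl h)
  · intro c hc A hA hAc A' hA' hA'c he
    have lt : ∀ A, seen A ∨ A = τ v → A < M := by
      rintro A (h | rfl)
      · rw [← hs.color_last A h]
        exact hτ _
      · exact hτ v
    rcases hb c hc A (lt A hA) hAc hA A' (lt A' hA') hA'c hA' he with ⟨h3, h4, h5⟩ | ⟨h3, h4, h5⟩
    · have main : ∀ A, (seen A ∨ A = τ v) → A.testBit c = true →
          (A = τ v ∨ Touched M seen Q E c A) →
          (colorGraph τ H c).Reachable (Function.update last (τ v) v A) v := by
        intro A hA hAc h
        by_cases e : A = τ v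
        · subst e
          simp
        · rw [hne A (hA.resolve_right e) e]
          exact touch c hc h3 A (hA.resolve_right e) hAc (h.resolve_left e)
      exact (main A hA hAc h4).trans (main A' hA' hA'c h5).symm
    · have hA := hA.resolve_right h3
      have hA' := hA'.resolve_right h4
      rw [hne A hA h3, hne A' hA' h4]
      exact mono (h1 c hc A hA hAc A' hA' hA'c h5)
  · intro u hu c hc huc
    by_cases e : u = v
    · subst e
      exact ⟨τ u, Or.inr rfl, huc, by simp⟩
    have hu' : u.val < i := by
      have : u.val ≠ v.val := fun h => e (Fin.ext h)
      omega
    obtain ⟨A, hA, hAc, hr⟩ := h2 u hu' c hc huc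
    -- If the representative of `u` has the color of `v`, it is displaced as a last vertex. The
    -- first clause of `Check` then connects it to `v` or to another last vertex, which takes over.
    by_cases eA : A = τ v
    · subst eA
      rcases ha hA c hc hAc with h3 | ⟨A', _, h3, h4, h5, h6⟩
      · refine ⟨τ v, Or.inr rfl, hAc, ?_⟩
        rw [Function.update_self]
        exact (mono hr).trans (touch c hc hAc _ hA hAc h3)
      · refine ⟨A', Or.inl h4, h5, ?_⟩
        rw [hne A' h4 h3]
        exact mono (hr.trans (h1 c hc _ hA hAc A' h4 h5 (hE _ _ _ h6)))
    · refine ⟨A, Or.inl hA, hAc, ?_⟩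
      rw [hne A hA eA]
      exact mono hr

/-- Each vertex is connected to a last vertex, and the last vertices are connected to each other by
`hE`. -/
theorem Realized.exists_spanning {k : ℕ} {τ : Fin n → ℕ} {d : Fin n → Fin n → ℝ}
    {seen : ℕ → Prop} {last : ℕ → Fin n} {E : ℕ → ℕ → ℕ → Prop} {w : ℝ}
    (h : Realized k τ d n seen last E w)
    (hE : ∀ c < k, ∀ A, seen A → A.testBit c = true → ∀ A', seen A' → A'.testBit c = true →
      E c A A') :
    ∃ G, Spanning k τ G ∧ totalCost d G ≤ w := by
  obtain ⟨G, -, hw, h1, h2⟩ := h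
  refine ⟨G, ?_, hw⟩
  intro c hc u v hu hv
  obtain ⟨A, hA, hAc, hr⟩ := h2 u u.2 c hc hu
  obtain ⟨A', hA', hA'c, hr'⟩ := h2 v v.2 c hc hv
  exact (hr.trans (h1 c hc A hA hAc A' hA' hA'c (hE c hc A hA hAc A' hA' hA'c))).trans hr'.symm

/-! ### Completeness of the transitions -/

/-- The connections `E` are those of the subgraph of `G` on the first `i` vertices. -/
def Tracks (k : ℕ) (τ : Fin n → ℕ) (G : SimpleGraph (Fin n)) (i : ℕ) (seen : ℕ → Prop)
    (last : ℕ → Fin n) (E : ℕ → ℕ → ℕ → Prop) : Prop :=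
  ∀ c < k, ∀ A, seen A → A.testBit c = true → ∀ A', seen A' → A'.testBit c = true →
    (E c A A' ↔ (colorGraph τ (below G i) c).Reachable (last A) (last A'))

theorem below_le_succ (G : SimpleGraph (Fin n)) (i : ℕ) : below G i ≤ below G (i + 1) :=
  fun _ _ h => ⟨h.1, h.2.1.trans (Nat.lt_succ_self i), h.2.2.trans (Nat.lt_succ_self i)⟩

/-- Follow the path until it first meets `v`: either it never does and uses only old edges, or its
last vertex before `v` is an old neighbor of `v`. -/
theorem reachable_below_succ {τ : Fin n → ℕ} {G : SimpleGraph (Fin n)} {i c : ℕ} {v : Fin n}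
    (hv : v.val = i) {x y : Fin n} (hx : x ≠ v)
    (h : (colorGraph τ (below G (i + 1)) c).Reachable x y) :
    (y ≠ v ∧ (colorGraph τ (below G i) c).Reachable x y) ∨
      ∃ u, (colorGraph τ (below G i) c).Reachable x u ∧ G.Adj u v ∧ u.val < i ∧
        (τ u).testBit c = true ∧ (τ v).testBit c = true := by
  rw [SimpleGraph.reachable_iff_reflTransGen] at h
  have lt : ∀ u : Fin n, u.val < i + 1 → u ≠ v → u.val < i := by
    intro u h1 h2
    have : u.val ≠ v.val := fun h => h2 (Fin.ext h)
    omega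
  induction h with
  | refl => exact Or.inl ⟨hx, .refl _⟩
  | @tail y z _ h2 ih =>
    rcases ih with ⟨h3, h4⟩ | h
    · by_cases e : z = v
      · subst e
        exact Or.inr ⟨y, h4, h2.1.1, lt y h2.1.2.1 h3, h2.2.1, h2.2.2⟩
      · refine Or.inl ⟨e, h4.trans (SimpleGraph.Adj.reachable ?_)⟩
        exact ⟨⟨h2.1.1, lt y h2.1.2.1 h3, lt z h2.1.2.2 e⟩, h2.2⟩
    · exact Or.inr h

/-- The restrictions of a left-normal spanning graph pass `Check`. Left-normality makes all left
neighbors of `v` last vertices of their colors, so the set of colors joined to `v` describes all the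
new edges. Spanning ensures that no component is abandoned. -/
theorem Tracks.succ {k M : ℕ} {τ : Fin n → ℕ} (hτ : ∀ u, τ u < M) {G : SimpleGraph (Fin n)}
    (hspan : Spanning k τ G) (hnorm : LeftNormal τ G) {i : ℕ}
    {seen : ℕ → Prop} {last : ℕ → Fin n} (hs : Stage τ i seen last) {v : Fin n} (hv : v.val = i)
    {E E' : ℕ → ℕ → ℕ → Prop} (h : Tracks k τ G i seen last E)
    (h' : Tracks k τ G (i + 1) (fun A => seen A ∨ A = τ v) (Function.update last (τ v) v) E') :
    Check k M seen (τ v) (fun A => G.Adj (last A) v) E E' := by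
  have hne : ∀ A, A ≠ τ v → Function.update last (τ v) v A = last A :=
    fun A e => Function.update_of_ne e _ _
  have nev : ∀ A, seen A → last A ≠ v := by
    intro A hA e
    have := hs.last_lt A hA
    rw [e] at this
    omega
  -- An edge from the processed vertices to the others starts at a last vertex: otherwise it would
  -- pass over the last vertex of the color of its left end.
  have nbr : ∀ u : Fin n, u.val < i → ∀ z : Fin n, i ≤ z.val → G.Adj u z → last (τ u) = u := by
    intro u hu z hz huz
    have h1 := hs.le_last u hu
    rcases h1.lt_or_eq with h2 | h2
    · have h3 := hs.seen_color u hu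
      refine absurd (hs.color_last _ h3) (hnorm u _ z h2 ?_ huz)
      rw [Fin.lt_def]
      exact (hs.last_lt _ h3).trans_le hz
    · exact h2.symm
  have touch : ∀ c < k, ∀ A, seen A → A.testBit c = true → ∀ u,
      (colorGraph τ (below G i) c).Reachable (last A) u → G.Adj u v → u.val < i →
      (τ u).testBit c = true → Touched M seen (fun A => G.Adj (last A) v) E c A := by
    intro c hc A hA hAc u hr huv hu huc
    have h1 := nbr u hu v hv.ge huv
    refine ⟨τ u, hτ u, ?_, hs.seen_color u hu, huc, ?_⟩
    · show G.Adj (last (τ u)) v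
      rwa [h1]
    · rw [h c hc _ (hs.seen_color u hu) huc _ hA hAc, h1]
      exact hr.symm
  constructor
  · intro hB c hc hBc
    have hr := hspan c hc (last (τ v)) v (by rwa [hs.color_last _ hB]) hBc
    -- Follow a path from the previous vertex of this color to the new one until it leaves.
    have key : ∀ y, (colorGraph τ G c).Reachable (last (τ v)) y →
        (y.val < i ∧ (colorGraph τ (below G i) c).Reachable (last (τ v)) y) ∨
        ∃ u z, u.val < i ∧ i ≤ z.val ∧ G.Adj u z ∧ (τ u).testBit c = true ∧
          (colorGraph τ (below G i) c).Reachable (last (τ v)) u := by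
      intro y hy
      rw [SimpleGraph.reachable_iff_reflTransGen] at hy
      induction hy with
      | refl => exact Or.inl ⟨hs.last_lt _ hB, .refl _⟩
      | @tail y z _ h2 ih =>
        rcases ih with ⟨h3, h4⟩ | h
        · by_cases hz : z.val < i
          · exact Or.inl ⟨hz, h4.trans (SimpleGraph.Adj.reachable ⟨⟨h2.1, h3, hz⟩, h2.2⟩)⟩
          · exact Or.inr ⟨y, z, h3, not_lt.1 hz, h2.1, h2.2.1, h4⟩
        · exact Or.inr h
    rcases key v hr with ⟨h1, _⟩ | ⟨u, z, hu, hz, huz, huc, hru⟩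
    · omega
    -- The path leaves the processed vertices along `u`, `z`. If `u` has a color other than that of
    -- `v`, then `u` survives as a representative. If it has the same color, left-normality forbids
    -- passing over `v`, so `z = v` and the component is touched.
    · by_cases e : τ u = τ v
      · refine Or.inl ?_
        rcases hz.lt_or_eq with hz | hz
        · refine absurd e.symm (hnorm u v z ?_ ?_ huz)
          · rw [Fin.lt_def]; omega
          · rw [Fin.lt_def]; omega
        · have : z = v := Fin.ext (hz.symm.trans hv.symm)
          subst this
          exact touch c hc _ hB hBc u hru huz hu huc
      · refine Or.inr ⟨τ u, hτ u, e, hs.seen_color u hu, huc, ?_⟩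
        rw [h c hc _ (hs.seen_color u hu) huc _ hB hBc, nbr u hu z hz huz]
        exact hru.symm
  · intro c hc A _ hAc hA A' _ hA'c hA' he
    have hr := (h' c hc A hA hAc A' hA' hA'c).1 he
    by_cases e : A = τ v
    · subst e
      refine Or.inl ⟨hAc, Or.inl rfl, ?_⟩
      by_cases e' : A' = τ v
      · exact Or.inl e'
      · rw [Function.update_self, hne _ e'] at hr
        have hA' := hA'.resolve_right e'
        rcases reachable_below_succ hv (nev _ hA') hr.symm with h1 | ⟨u, h1, h2, h3, h4, _⟩
        · exact absurd rfl h1.1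
        · exact Or.inr (touch c hc A' hA' hA'c u h1 h2 h3 h4)
    · have hA := hA.resolve_right e
      rw [hne _ e] at hr
      rcases reachable_below_succ hv (nev _ hA) hr with ⟨h1, h2⟩ | ⟨u, h1, h2, h3, h4, h5⟩
      · by_cases e' : A' = τ v
        · subst e'
          simp at h1
        · rw [hne _ e'] at h2
          exact Or.inr ⟨e, e', (h c hc A hA hAc A' (hA'.resolve_right e') hA'c).2 h2⟩
      · refine Or.inl ⟨h5, Or.inr (touch c hc A hA hAc u h1 h2 h3 h4), ?_⟩
        by_cases e' : A' = τ v
        · exact Or.inl e'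
        · rw [hne _ e'] at hr
          have hA' := hA'.resolve_right e'
          refine Or.inr ?_
          -- The component of `A` touches `v`. If the path from `A'` avoids `v`, then `A'` lies in
          -- this component; otherwise it reaches a neighbor of `v` itself.
          rcases reachable_below_succ hv (nev _ hA') hr.symm with ⟨_, h7⟩ | ⟨u, h1, h2, h3, h4, _⟩
          · exact touch c hc A' hA' hA'c u (h7.trans h1) h2 h3 h4
          · exact touch c hc A' hA' hA'c u h1 h2 h3 h4

-- By left-normality the edges from the left into `v` are exactly those from last vertices, so the
-- sum over full colors accounts for each of them once.
open Classical in
theorem totalCost_below_succ {τ : Fin n → ℕ} {M : ℕ} (hτ : ∀ u, τ u < M) (d : Fin n → Fin n → ℝ)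
    {G : SimpleGraph (Fin n)} (hnorm : LeftNormal τ G) {i : ℕ} {seen : ℕ → Prop}
    {last : ℕ → Fin n} (hs : Stage τ i seen last) {v : Fin n} (hv : v.val = i) :
    totalCost d (below G (i + 1)) = totalCost d (below G i) +
      ∑ A ∈ Finset.range M, if G.Adj (last A) v ∧ seen A then d (last A) v else 0 := by
  rw [hs.sum_last (fun A => G.Adj (last A) v) fun u => d u v]
  refine totalCost_star d ?_ ?_ ?_
  · intro x y hxy
    have hxy' := Fin.lt_def.1 hxy
    constructor
    · rintro ⟨h1, h2, h3⟩
      by_cases e : y = v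
      · subst e
        have hx : x.val < i := by omega
        have hl : last (τ x) = x := by
          rcases (hs.le_last x hx).lt_or_eq with h2 | h2
          · have h3 := hs.seen_color x hx
            refine absurd (hs.color_last _ h3) (hnorm x _ y h2 ?_ h1)
            rw [Fin.lt_def, hv]
            exact hs.last_lt _ h3
          · exact h2.symm
        exact Or.inr ⟨rfl, τ x, hτ x, by rwa [hl], hs.seen_color x hx, hl.symm⟩
      · have : y.val ≠ v.val := fun h => e (Fin.ext h)
        exact Or.inl ⟨h1, by omega, by omega⟩
    · rintro (h | ⟨rfl, A, _, h1, h2, rfl⟩)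
      · exact below_le_succ G i h
      · exact ⟨h1, by omega, by omega⟩
  · rintro x ⟨A, _, _, hA, rfl⟩
    rw [Fin.lt_def, hv]
    exact hs.last_lt A hA
  · intro x h
    have := h.2.2
    omega

theorem below_self (G : SimpleGraph (Fin n)) : below G n = G := by
  ext u v
  simp [below]

theorem totalCost_below_zero (d : Fin n → Fin n → ℝ) (G : SimpleGraph (Fin n)) :
    totalCost d (below G 0) = 0 := by
  have : edgePairs (below G 0) = ∅ := by
    ext ⟨u, v⟩
    simp [mem_edgePairs, below]
  simp [totalCost, this]

/-- Edges of `colorGraph` stay inside the color class, so a walk that starts in the class is a walk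
in the induced subgraph. -/
theorem isCSG_iff {k : ℕ} (I : Input k n) {τ : Fin n → ℕ}
    (hτ : ∀ i (c : Fin k), (τ i).testBit c = true ↔ c ∈ I.α i) (G : SimpleGraph (Fin n)) :
    I.IsCSG G ↔ Spanning k τ G := by
  constructor
  · intro h c hc u v hu hv
    have h1 := h ⟨c, hc⟩ ⟨u, (hτ u ⟨c, hc⟩).1 hu⟩ ⟨v, (hτ v ⟨c, hc⟩).1 hv⟩
    let f : G.induce (I.colorClass ⟨c, hc⟩) →g colorGraph τ G c :=
      { toFun := fun x => x.1
        map_rel' := fun {a b} hab =>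
          ⟨hab, (hτ a.1 ⟨c, hc⟩).2 a.2, (hτ b.1 ⟨c, hc⟩).2 b.2⟩ }
    exact h1.map f
  · rintro h c ⟨u, hu⟩ ⟨v, hv⟩
    have h1 := h c c.2 u v ((hτ u c).2 hu) ((hτ v c).2 hv)
    rw [SimpleGraph.reachable_iff_reflTransGen] at h1
    have key : ∀ y, Relation.ReflTransGen (colorGraph τ G c).Adj u y →
        ∀ hy : y ∈ I.colorClass c, (G.induce (I.colorClass c)).Reachable ⟨u, hu⟩ ⟨y, hy⟩ := by
      intro y hy
      induction hy with
      | refl => exact fun _ => .refl _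
      | @tail y z _ h2 ih =>
        intro hz
        have hyc : y ∈ I.colorClass c := (hτ y c).1 h2.2.1
        have h3 : (G.induce (I.colorClass c)).Adj ⟨y, hyc⟩ ⟨z, hz⟩ := h2.1
        exact (ih hyc).trans h3.reachable
    exact key v h1 hv

end Graphs

end MinCSG

/-! ### A structured language that compiles to real RAM programs -/

namespace RealRAM

/-! ### States that agree outside the scratch variables -/

/-- The two states have the same arrays and real variables, and agree on the integer variables
in `K`. -/
structure Agree (K : ℕ → Prop) (s s' : State) : Prop where
  ivar : ∀ x, K x → s'.ivar x = s.ivar x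
  rvar : s'.rvar = s.rvar
  iarr : s'.iarr = s.iarr
  rarr : s'.rarr = s.rarr

theorem Agree.refl (K : ℕ → Prop) (s : State) : Agree K s s := ⟨fun _ _ => rfl, rfl, rfl, rfl⟩

theorem Agree.trans {K : ℕ → Prop} {s s' s'' : State} (h : Agree K s s') (h' : Agree K s' s'') :
    Agree K s s'' :=
  ⟨fun x hx => (h'.ivar x hx).trans (h.ivar x hx), h'.rvar.trans h.rvar, h'.iarr.trans h.iarr,
    h'.rarr.trans h.rarr⟩

theorem Agree.mono {K K' : ℕ → Prop} {s s' : State} (h : Agree K s s') (hK : ∀ x, K' x → K x) :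
    Agree K' s s' :=
  ⟨fun x hx => h.ivar x (hK x hx), h.rvar, h.iarr, h.rarr⟩

theorem Agree.setI_right {K : ℕ → Prop} {s s' : State} (h : Agree K s s') {x : ℕ} (hx : ¬ K x)
    (v : ℕ) : Agree K s (s'.setI x v) :=
  ⟨fun y hy => by
    have e : y ≠ x := by
      rintro rfl
      exact hx hy
    simpa [State.setI, e] using h.ivar y hy, h.rvar, h.iarr, h.rarr⟩

theorem Agree.setI {K K' : ℕ → Prop} {s s' : State} (h : Agree K s s') (x v : ℕ)
    (hK : ∀ y, K' y → y ≠ x → K y) : Agree K' (s.setI x v) (s'.setI x v) :=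
  ⟨fun y hy => by
    simp only [State.setI]
    by_cases e : y = x
    · subst e; simp
    · rw [Function.update_of_ne e, Function.update_of_ne e]
      exact h.ivar y (hK y hy e), h.rvar, h.iarr, h.rarr⟩

@[simp] theorem State.setI_ivar_self (s : State) (x v : ℕ) : (s.setI x v).ivar x = v := by
  simp [State.setI]

theorem State.setI_ivar_ne (s : State) {x y : ℕ} (v : ℕ) (h : y ≠ x) :
    (s.setI x v).ivar y = s.ivar y := by
  simp [State.setI, h]

@[simp] theorem State.setI_ivar (s : State) (x y v : ℕ) :
    (s.setI x v).ivar y = if y = x then v else s.ivar y := by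
  simp [State.setI, Function.update_apply]

/-! ### Counting loops and bounds by powers -/

/-- A counting loop. -/
theorem exec_count {x y : ℕ} {P : Program} {m B : ℕ} (Inv : ℕ → State → Prop)
    (hx : ∀ j s, Inv j s → s.ivar x = j ∧ s.ivar y = m)
    (h : ∀ j < m, ∀ s, Inv j s → ∃ s' t, Exec P s s' t ∧ t ≤ B ∧ Inv (j + 1) s')
    (s : State) (hs : Inv 0 s) :
    ∃ s' t, Exec (.loop (.ilt x y) P) s s' t ∧ t ≤ m * (B + 1) + 1 ∧ Inv m s' := by
  have key : ∀ r j s, j + r = m → Inv j s →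
      ∃ s' t, Exec (.loop (.ilt x y) P) s s' t ∧ t ≤ r * (B + 1) + 1 ∧ Inv m s' := by
    intro r
    induction r with
    | zero =>
      intro j s hj hs
      obtain rfl : j = m := by omega
      refine ⟨s, 1, Exec.loop_false ?_, by omega, hs⟩
      simp [Test.Holds, (hx _ _ hs).1, (hx _ _ hs).2]
    | succ r ih =>
      intro j s hj hs
      obtain ⟨s1, t1, h1, h2, h3⟩ := h j (by omega) s hs
      obtain ⟨s2, t2, h4, h5, h6⟩ := ih (j + 1) s1 (by omega) h3
      refine ⟨s2, _, Exec.loop_true ?_ h1 h4, ?_, h6⟩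
      · simp only [Test.Holds, (hx _ _ hs).1, (hx _ _ hs).2]
        omega
      · rw [Nat.succ_mul]
        omega
  exact key m 0 s (by omega) hs

/-- The room for sequencing and branching: two pieces and a constant overhead cost two extra in the
exponent. -/
theorem pow_add_pow_le {V : ℕ} (hV : 4 ≤ V) (a b : ℕ) :
    V ^ a + V ^ b + 8 ≤ V ^ (max a b + 2) := by
  have h1 : V ^ a ≤ V ^ max a b := Nat.pow_le_pow_right (by omega) (le_max_left _ _)
  have h2 : V ^ b ≤ V ^ max a b := Nat.pow_le_pow_right (by omega) (le_max_right _ _)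
  have h3 : 0 < V ^ max a b := by positivity
  have h4 : 16 ≤ V ^ 2 := by nlinarith
  rw [pow_add]
  nlinarith

/-- The room for a loop with at most `V` iterations: three extra in the exponent. -/
theorem mul_pow_le {V : ℕ} (hV : 4 ≤ V) (a : ℕ) : V * (V ^ a + 8) + 4 ≤ V ^ (a + 3) := by
  have h3 : 0 < V ^ a := by positivity
  have h4 : 16 ≤ V ^ 2 := by nlinarith
  have h5 : V ^ (a + 3) = (V * V ^ a) * V ^ 2 := by ring
  have h6 : V ≤ V * V ^ a := Nat.le_mul_of_pos_right _ h3
  rw [h5]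
  nlinarith

/-! ### Compilation of integer expressions -/

/-- Integer expressions. -/
inductive IExpr where
  | var (x : ℕ)
  | const (c : ℕ)
  | add (e₁ e₂ : IExpr)
  | sub (e₁ e₂ : IExpr)
  | arr (a : ℕ) (e : IExpr)

namespace IExpr

/-- The value of an expression. -/
def eval (s : State) : IExpr → ℕ
  | var x => s.ivar x
  | const c => c
  | add e₁ e₂ => eval s e₁ + eval s e₂
  | sub e₁ e₂ => eval s e₁ - eval s e₂
  | arr a e => s.iarr a (eval s e)

/-- The variables are smaller than `d`. -/
def wf (d : ℕ) : IExpr → Bool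
  | var x => x < d
  | const _ => true
  | add e₁ e₂ => wf d e₁ && wf d e₂
  | sub e₁ e₂ => wf d e₁ && wf d e₂
  | arr _ e => wf d e

/-- The number of steps of the evaluation. -/
def time : IExpr → ℕ
  | var _ => 2
  | const _ => 1
  | add e₁ e₂ => time e₁ + time e₂ + 1
  | sub e₁ e₂ => time e₁ + time e₂ + 1
  | arr _ e => time e + 1

/-- A program that puts the value of the expression into the variable `r`. -/
def comp (r : ℕ) : IExpr → Program
  | var x => .seq (.instr (.iconst r 0)) (.instr (.iadd r r x))
  | const c => .instr (.iconst r c)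
  | add e₁ e₂ => .seq (.seq (comp r e₁) (comp (r + 1) e₂)) (.instr (.iadd r r (r + 1)))
  | sub e₁ e₂ => .seq (.seq (comp r e₁) (comp (r + 1) e₂)) (.instr (.isub r r (r + 1)))
  | arr a e => .seq (comp r e) (.instr (.iload r a r))

theorem eval_congr {d : ℕ} {s s' : State} (h : Agree (· < d) s s') :
    ∀ e : IExpr, e.wf d = true → e.eval s' = e.eval s
  | var x, he => h.ivar x (by simpa [wf] using he)
  | const _, _ => rfl
  | add e₁ e₂, he => by
    simp only [wf, Bool.and_eq_true] at he
    simp [eval, eval_congr h e₁ he.1, eval_congr h e₂ he.2]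
  | sub e₁ e₂, he => by
    simp only [wf, Bool.and_eq_true] at he
    simp [eval, eval_congr h e₁ he.1, eval_congr h e₂ he.2]
  | arr a e, he => by
    simp [eval, eval_congr h e he, h.iarr]

/-- The variables from `r` on serve as an evaluation stack: the second operand is computed at `r +
1`, which leaves the first one at `r` intact. -/
theorem exec_comp {d : ℕ} : ∀ (e : IExpr) (r : ℕ) (s : State), e.wf d = true → d ≤ r →
    ∃ s', Exec (e.comp r) s s' e.time ∧ s'.ivar r = e.eval s ∧ Agree (· < r) s s'
  | var x, r, s, he, hr => by
    have hx : x ≠ r := by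
      simp only [wf, decide_eq_true_eq] at he
      omega
    refine ⟨_, Exec.seq (Exec.instr _ _) (Exec.instr _ _), ?_, ?_⟩
    · simp [Instr.run, eval, hx]
    · exact ((Agree.refl _ s).setI_right (by omega) _).setI_right (by omega) _
  | const c, r, s, _, _ =>
    ⟨_, Exec.instr _ _, by simp [Instr.run, eval],
      (Agree.refl _ s).setI_right (by omega) _⟩
  | add e₁ e₂, r, s, he, hr => by
    simp only [wf, Bool.and_eq_true] at he
    obtain ⟨s1, h1, h2, h3⟩ := exec_comp e₁ r s he.1 hr
    obtain ⟨s2, h4, h5, h6⟩ := exec_comp e₂ (r + 1) s1 he.2 (by omega)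
    refine ⟨_, (h1.seq h4).seq (Exec.instr _ _), ?_, ?_⟩
    · simp only [Instr.run, State.setI_ivar_self, eval]
      rw [h5, h6.ivar r (by omega), h2, eval_congr (h3.mono fun x hx => by omega) e₂ he.2]
    · exact (h3.trans (h6.mono fun x hx => by omega)).setI_right (by omega) _
  | sub e₁ e₂, r, s, he, hr => by
    simp only [wf, Bool.and_eq_true] at he
    obtain ⟨s1, h1, h2, h3⟩ := exec_comp e₁ r s he.1 hr
    obtain ⟨s2, h4, h5, h6⟩ := exec_comp e₂ (r + 1) s1 he.2 (by omega)
    refine ⟨_, (h1.seq h4).seq (Exec.instr _ _), ?_, ?_⟩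
    · simp only [Instr.run, State.setI_ivar_self, eval]
      rw [h5, h6.ivar r (by omega), h2, eval_congr (h3.mono fun x hx => by omega) e₂ he.2]
    · exact (h3.trans (h6.mono fun x hx => by omega)).setI_right (by omega) _
  | arr a e, r, s, he, hr => by
    obtain ⟨s1, h1, h2, h3⟩ := exec_comp e r s he hr
    refine ⟨_, h1.seq (Exec.instr _ _), ?_, ?_⟩
    · simp [Instr.run, eval, h2, h3.iarr]
    · exact h3.setI_right (by omega) _

end IExpr

/-! ### Compilation of conditions -/

/-- Conditions, with bounded quantifiers. In `ex x y b`, the variable `x` runs through the numbers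
smaller than the variable `y`. -/
inductive BExpr where
  | lt (e₁ e₂ : IExpr)
  | eq (e₁ e₂ : IExpr)
  | rlt (x y : ℕ)
  | not (b : BExpr)
  | and (b₁ b₂ : BExpr)
  | ex (x y : ℕ) (b : BExpr)

namespace BExpr

/-- The meaning of a condition. -/
def Holds : BExpr → State → Prop
  | lt e₁ e₂, s => e₁.eval s < e₂.eval s
  | eq e₁ e₂, s => e₁.eval s = e₂.eval s
  | rlt x y, s => s.rvar x < s.rvar y
  | not b, s => ¬ Holds b s
  | and b₁ b₂, s => Holds b₁ s ∧ Holds b₂ s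
  | ex x y b, s => ∃ v < s.ivar y, Holds b (s.setI x v)

/-- The free variables are smaller than `d`, and the bound variables start at `d`. -/
def wf : ℕ → BExpr → Bool
  | d, lt e₁ e₂ => e₁.wf d && e₂.wf d
  | d, eq e₁ e₂ => e₁.wf d && e₂.wf d
  | _, rlt _ _ => true
  | d, not b => wf d b
  | d, and b₁ b₂ => wf d b₁ && wf d b₂
  | d, ex x y b => x == d && x < 50 && y < 30 && wf (x + 1) b

/-- The variables that bound the quantifiers. -/
def bounds : BExpr → List ℕ
  | lt _ _ => []
  | eq _ _ => []
  | rlt _ _ => []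
  | not b => bounds b
  | and b₁ b₂ => bounds b₁ ++ bounds b₂
  | ex _ y b => y :: bounds b

/-- The exponent in the bound for the running time. -/
def deg : BExpr → ℕ
  | lt e₁ e₂ => e₁.time + e₂.time + 2
  | eq e₁ e₂ => e₁.time + e₂.time + 2
  | rlt _ _ => 2
  | not b => deg b + 2
  | and b₁ b₂ => max (deg b₁) (deg b₂) + 2
  | ex _ _ b => deg b + 3

/-- A program that puts `1` or `0` into the variable `r`, depending on whether the condition
holds. -/
def comp : ℕ → BExpr → Program
  | r, lt e₁ e₂ => .seq (.seq (e₁.comp r) (e₂.comp (r + 1)))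
      (.cond (.ilt r (r + 1)) (.instr (.iconst r 1)) (.instr (.iconst r 0)))
  | r, eq e₁ e₂ => .seq (.seq (e₁.comp r) (e₂.comp (r + 1)))
      (.cond (.ieq r (r + 1)) (.instr (.iconst r 1)) (.instr (.iconst r 0)))
  | r, rlt x y => .cond (.rlt x y) (.instr (.iconst r 1)) (.instr (.iconst r 0))
  | r, not b => .seq (comp r b)
      (.seq (.instr (.iconst (r + 1) 1)) (.instr (.isub r (r + 1) r)))
  | r, and b₁ b₂ => .seq (.seq (comp r b₁) (comp (r + 1) b₂))
      (.cond (.ilt (r + 1) r) (.instr (.iconst r 0)) .skip)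
  | r, ex x y b => .seq (.seq (.instr (.iconst r 0)) (.instr (.iconst x 0)))
      (.loop (.ilt x y) (.seq (.seq (comp (r + 1) b)
        (.cond (.ilt r (r + 1)) (.instr (.iconst r 1)) .skip))
        (.seq (.instr (.iconst (r + 1) 1)) (.instr (.iadd x x (r + 1))))))

/-- With `30 ≤ d` the bound of each quantifier is among the variables on which the states agree, and
a bound variable is set to the same value on both sides. -/
theorem holds_congr : ∀ (b : BExpr) {d : ℕ} {s s' : State}, 30 ≤ d → Agree (· < d) s s' →
    b.wf d = true → (b.Holds s' ↔ b.Holds s)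
  | lt e₁ e₂, d, s, s', _, h, hb => by
    simp only [wf, Bool.and_eq_true] at hb
    simp [Holds, IExpr.eval_congr h _ hb.1, IExpr.eval_congr h _ hb.2]
  | eq e₁ e₂, d, s, s', _, h, hb => by
    simp only [wf, Bool.and_eq_true] at hb
    simp [Holds, IExpr.eval_congr h _ hb.1, IExpr.eval_congr h _ hb.2]
  | rlt x y, d, s, s', _, h, _ => by simp [Holds, h.rvar]
  | not b, d, s, s', hd, h, hb => by simp [Holds, holds_congr b hd h hb]
  | and b₁ b₂, d, s, s', hd, h, hb => by
    simp only [wf, Bool.and_eq_true] at hb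
    simp [Holds, holds_congr b₁ hd h hb.1, holds_congr b₂ hd h hb.2]
  | ex x y b, d, s, s', hd, h, hb => by
    simp only [wf, Bool.and_eq_true, decide_eq_true_eq, beq_iff_eq] at hb
    obtain ⟨⟨⟨rfl, h1⟩, h2⟩, h3⟩ := hb
    simp only [Holds]
    rw [h.ivar y (by omega)]
    refine exists_congr fun v => and_congr_right fun _ => holds_congr b (by omega) ?_ h3
    exact h.setI x v fun y hy hne => by omega

theorem le_pow_self {V : ℕ} (hV : 4 ≤ V) (a : ℕ) : a ≤ V ^ a :=
  (Nat.lt_pow_self (by omega)).le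

-- Evaluation may overwrite the quantified variables from `d` to `49` and the scratch variables from
-- `r` on, and nothing else. A quantifier is a loop whose bound is at most `V`, hence the power of
-- `V`.
open Classical in
theorem exec_comp {V : ℕ} (hV : 4 ≤ V) : ∀ (b : BExpr) (d r : ℕ) (s : State), b.wf d = true →
    30 ≤ d → d ≤ 50 → 50 ≤ r → (∀ z ∈ b.bounds, s.ivar z ≤ V) →
    ∃ s' t, Exec (b.comp r) s s' t ∧ t ≤ V ^ b.deg ∧
      s'.ivar r = (if b.Holds s then 1 else 0) ∧
      Agree (fun y => y < d ∨ (50 ≤ y ∧ y < r)) s s'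
  | lt e₁ e₂, d, r, s, hb, hd, hd', hr, _ => by
    simp only [wf, Bool.and_eq_true] at hb
    obtain ⟨s1, h1, h2, h3⟩ := e₁.exec_comp r s hb.1 (by omega)
    obtain ⟨s2, h4, h5, h6⟩ := e₂.exec_comp (r + 1) s1 hb.2 (by omega)
    have h7 : s2.ivar r = e₁.eval s := by rw [h6.ivar r (by omega), h2]
    have h8 : s2.ivar (r + 1) = e₂.eval s := by
      rw [h5, IExpr.eval_congr (h3.mono fun x hx => by omega) e₂ hb.2]
    have h9 : Agree (fun y => y < d ∨ (50 ≤ y ∧ y < r)) s s2 :=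
      (h3.mono fun x hx => by omega).trans (h6.mono fun x hx => by omega)
    have h10 : ¬ (r < d ∨ (50 ≤ r ∧ r < r)) := by omega
    have h11 := le_pow_self hV (e₁.time + e₂.time + 2)
    by_cases c : e₁.eval s < e₂.eval s
    · refine ⟨_, _, (h1.seq h4).seq (Exec.cond_true ?_ (Exec.instr _ _)), h11, ?_, ?_⟩
      · simpa [Test.Holds, h7, h8] using c
      · simp [Instr.run, Holds, c]
      · exact h9.setI_right h10 _
    · refine ⟨_, _, (h1.seq h4).seq (Exec.cond_false ?_ (Exec.instr _ _)), h11, ?_, ?_⟩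
      · simpa [Test.Holds, h7, h8] using c
      · simp [Instr.run, Holds, c]
      · exact h9.setI_right h10 _
  | eq e₁ e₂, d, r, s, hb, hd, hd', hr, _ => by
    simp only [wf, Bool.and_eq_true] at hb
    obtain ⟨s1, h1, h2, h3⟩ := e₁.exec_comp r s hb.1 (by omega)
    obtain ⟨s2, h4, h5, h6⟩ := e₂.exec_comp (r + 1) s1 hb.2 (by omega)
    have h7 : s2.ivar r = e₁.eval s := by rw [h6.ivar r (by omega), h2]
    have h8 : s2.ivar (r + 1) = e₂.eval s := by
      rw [h5, IExpr.eval_congr (h3.mono fun x hx => by omega) e₂ hb.2]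
    have h9 : Agree (fun y => y < d ∨ (50 ≤ y ∧ y < r)) s s2 :=
      (h3.mono fun x hx => by omega).trans (h6.mono fun x hx => by omega)
    have h10 : ¬ (r < d ∨ (50 ≤ r ∧ r < r)) := by omega
    have h11 := le_pow_self hV (e₁.time + e₂.time + 2)
    by_cases c : e₁.eval s = e₂.eval s
    · refine ⟨_, _, (h1.seq h4).seq (Exec.cond_true ?_ (Exec.instr _ _)), h11, ?_, ?_⟩
      · simpa [Test.Holds, h7, h8] using c
      · simp [Instr.run, Holds, c]
      · exact h9.setI_right h10 _
    · refine ⟨_, _, (h1.seq h4).seq (Exec.cond_false ?_ (Exec.instr _ _)), h11, ?_, ?_⟩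
      · simpa [Test.Holds, h7, h8] using c
      · simp [Instr.run, Holds, c]
      · exact h9.setI_right h10 _
  | rlt x y, d, r, s, _, hd, hd', hr, _ => by
    have h10 : ¬ (r < d ∨ (50 ≤ r ∧ r < r)) := by omega
    have h11 : 1 + 1 ≤ V ^ 2 := by nlinarith
    by_cases c : s.rvar x < s.rvar y
    · refine ⟨_, _, Exec.cond_true c (Exec.instr _ _), h11, ?_, ?_⟩
      · simp [Instr.run, Holds, c]
      · exact (Agree.refl _ s).setI_right h10 _
    · refine ⟨_, _, Exec.cond_false c (Exec.instr _ _), h11, ?_, ?_⟩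
      · simp [Instr.run, Holds, c]
      · exact (Agree.refl _ s).setI_right h10 _
  | not b, d, r, s, hb, hd, hd', hr, hz => by
    obtain ⟨s1, t1, h1, h2, h3, h4⟩ := exec_comp hV b d r s hb hd hd' hr hz
    refine ⟨_, _, h1.seq ((Exec.instr _ _).seq (Exec.instr _ _)), ?_, ?_, ?_⟩
    · have := pow_add_pow_le hV b.deg b.deg
      rw [max_self] at this
      simp only [deg]
      omega
    · simp only [Instr.run, State.setI_ivar, h3, Holds]
      by_cases c : b.Holds s <;> simp [c]
    · exact (h4.setI_right (by omega) _).setI_right (by omega) _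
  | and b₁ b₂, d, r, s, hb, hd, hd', hr, hz => by
    simp only [wf, Bool.and_eq_true] at hb
    simp only [bounds, List.mem_append] at hz
    obtain ⟨s1, t1, h1, h2, h3, h4⟩ := exec_comp hV b₁ d r s hb.1 hd hd' hr
      fun z hz' => hz z (Or.inl hz')
    have hz1 : ∀ z ∈ b₂.bounds, s1.ivar z ≤ V := by
      intro z hz'
      rw [h4.ivar z (Or.inl ?_)]
      · exact hz z (Or.inr hz')
      · exact (bounds_lt b₂ hb.2 z hz').trans_le hd
    obtain ⟨s2, t2, h5, h6, h7, h8⟩ := exec_comp hV b₂ d (r + 1) s1 hb.2 hd hd' (by omega) hz1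
    have h9 := pow_add_pow_le hV b₁.deg b₂.deg
    have h10 : Agree (fun y => y < d ∨ (50 ≤ y ∧ y < r)) s s2 :=
      h4.trans (h8.mono fun x hx => by omega)
    have h11 : s2.ivar r = if b₁.Holds s then 1 else 0 := by rw [h8.ivar r (by omega), h3]
    rw [holds_congr b₂ hd (h4.mono fun x hx => Or.inl hx) hb.2] at h7
    by_cases c1 : b₁.Holds s <;> by_cases c2 : b₂.Holds s <;>
      simp only [c1, c2, if_true, if_false] at h7 h11
    · refine ⟨_, _, (h1.seq h5).seq (Exec.cond_false ?_ (Exec.skip _)), ?_, ?_, h10⟩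
      · simp [Test.Holds, h7, h11]
      · simp only [deg]; omega
      · simp [Holds, c1, c2, h11]
    · refine ⟨_, _, (h1.seq h5).seq (Exec.cond_true ?_ (Exec.instr _ _)), ?_, ?_,
        h10.setI_right (by omega) _⟩
      · simp [Test.Holds, h7, h11]
      · simp only [deg]; omega
      · simp [Holds, c2, Instr.run]
    · refine ⟨_, _, (h1.seq h5).seq (Exec.cond_false ?_ (Exec.skip _)), ?_, ?_, h10⟩
      · simp [Test.Holds, h7, h11]
      · simp only [deg]; omega
      · simp [Holds, c1, h11]
    · refine ⟨_, _, (h1.seq h5).seq (Exec.cond_false ?_ (Exec.skip _)), ?_, ?_, h10⟩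
      · simp [Test.Holds, h7, h11]
      · simp only [deg]; omega
      · simp [Holds, c1, h11]
  | ex x y b, d, r, s, hb, hd, hd', hr, hz => by
    simp only [wf, Bool.and_eq_true, decide_eq_true_eq, beq_iff_eq] at hb
    obtain ⟨⟨⟨rfl, hx⟩, hy⟩, hb⟩ := hb
    simp only [bounds, List.mem_cons] at hz
    let Inv : ℕ → State → Prop := fun j τ => τ.ivar x = j ∧
      τ.ivar r = (if ∃ v < j, b.Holds (s.setI x v) then 1 else 0) ∧
      Agree (fun y => y < x ∨ (50 ≤ y ∧ y < r)) s τ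
    have hinv : ∀ j τ, Inv j τ → τ.ivar x = j ∧ τ.ivar y = s.ivar y := by
      intro j τ h
      exact ⟨h.1, h.2.2.ivar y (by omega)⟩
    have hbody : ∀ j < s.ivar y, ∀ τ, Inv j τ → ∃ s' t, Exec (.seq (.seq (comp (r + 1) b)
        (.cond (.ilt r (r + 1)) (.instr (.iconst r 1)) .skip))
        (.seq (.instr (.iconst (r + 1) 1)) (.instr (.iadd x x (r + 1))))) τ s' t ∧
        t ≤ V ^ b.deg + 4 ∧ Inv (j + 1) s' := by
      rintro j hj τ ⟨h1, h2, h3⟩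
      obtain ⟨s1, t1, h4, h5, h6, h7⟩ := exec_comp hV b (x + 1) (r + 1) τ hb (by omega) (by omega)
        (by omega) (fun z hz' => by
          have := bounds_lt b hb z hz'
          rw [h3.ivar z (by omega)]
          exact hz z (Or.inr hz'))
      -- The scratch variables of `τ` are irrelevant, and its loop counter already holds `j`.
      have h8 : b.Holds τ ↔ b.Holds (s.setI x j) := by
        refine holds_congr b (d := x + 1) (by omega) ?_ hb
        refine ⟨fun z hz => ?_, h3.rvar, h3.iarr, h3.rarr⟩
        by_cases e : z = x
        · subst e; simp [h1]
        · rw [State.setI_ivar_ne _ _ e]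
          exact h3.ivar z (by omega)
      have h9 : (∃ v < j + 1, b.Holds (s.setI x v)) ↔
          (∃ v < j, b.Holds (s.setI x v)) ∨ b.Holds (s.setI x j) := by
        constructor
        · rintro ⟨v, hv, h⟩
          rcases Nat.lt_succ_iff_lt_or_eq.1 hv with h' | rfl
          · exact Or.inl ⟨v, h', h⟩
          · exact Or.inr h
        · rintro (⟨v, hv, h⟩ | h)
          · exact ⟨v, by omega, h⟩
          · exact ⟨j, by omega, h⟩
      have h10 : s1.ivar r = if ∃ v < j, b.Holds (s.setI x v) then 1 else 0 := by
        rw [h7.ivar r (by omega), h2]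
      have h11 : s1.ivar x = j := by rw [h7.ivar x (by omega), h1]
      have h12 : Agree (fun y => y < x ∨ (50 ≤ y ∧ y < r)) s s1 :=
        h3.trans (h7.mono fun z hz => by omega)
      rw [h8] at h6
      have hrx : r ≠ x := by omega
      have hrx' : x ≠ r + 1 := by omega
      -- Variable `r` accumulates the disjunction and `r + 1` holds the truth value of the body. The
      -- test succeeds exactly when the accumulator is `0` and the new value is `1`.
      by_cases c : Test.Holds s1 (.ilt r (r + 1))
      · refine ⟨_, _, (h4.seq (Exec.cond_true c (Exec.instr _ _))).seq
          ((Exec.instr _ _).seq (Exec.instr _ _)), by omega, ?_, ?_, ?_⟩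
        · simp [Instr.run, h11, hrx', hrx.symm]
        · have : b.Holds (s.setI x j) := by
            by_contra h
            change s1.ivar r < s1.ivar (r + 1) at c
            simp [h] at h6
            omega
          rw [if_pos (h9.2 (Or.inr this))]
          simp [Instr.run, hrx]
        · exact ((h12.setI_right (by omega) _).setI_right (by omega) _).setI_right (by omega) _
      · refine ⟨_, _, (h4.seq (Exec.cond_false c (Exec.skip _))).seq
          ((Exec.instr _ _).seq (Exec.instr _ _)), by omega, ?_, ?_, ?_⟩
        · simp [Instr.run, h11, hrx']
        · have : s1.ivar r = if ∃ v < j + 1, b.Holds (s.setI x v) then 1 else 0 := by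
            change ¬ s1.ivar r < s1.ivar (r + 1) at c
            rw [h10, h6] at c
            rw [h10]
            by_cases c1 : ∃ v < j, b.Holds (s.setI x v)
            · rw [if_pos c1, if_pos (h9.2 (Or.inl c1))]
            · have c2 : ¬ b.Holds (s.setI x j) := by
                intro c2
                rw [if_neg c1, if_pos c2] at c
                omega
              rw [if_neg c1, if_neg fun h => (h9.1 h).elim c1 c2]
          simp [Instr.run, hrx, this]
        · exact (h12.setI_right (by omega) _).setI_right (by omega) _
    have hinit : Inv 0 ((s.setI r 0).setI x 0) := by
      refine ⟨by simp, ?_, ?_⟩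
      · have : r ≠ x := by omega
        simp [this]
      · exact ((Agree.refl _ s).setI_right (by omega) _).setI_right (by omega) _
    obtain ⟨s', t, h1, h2, h3, h4, h5⟩ := exec_count (x := x) (y := y) (m := s.ivar y)
      (B := V ^ b.deg + 4)
      (P := .seq (.seq (comp (r + 1) b)
        (.cond (.ilt r (r + 1)) (.instr (.iconst r 1)) .skip))
        (.seq (.instr (.iconst (r + 1) 1)) (.instr (.iadd x x (r + 1))))) Inv hinv hbody
      ((s.setI r 0).setI x 0) hinit
    refine ⟨s', _, ((Exec.instr _ _).seq (Exec.instr _ _)).seq h1, ?_,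
      h4.trans (if_congr Iff.rfl rfl rfl), h5⟩
    have h6 := mul_pow_le hV b.deg
    have h7 : s.ivar y * (V ^ b.deg + 4 + 1) ≤ V * (V ^ b.deg + 8) :=
      Nat.mul_le_mul (hz y (Or.inl rfl)) (by omega)
    simp only [deg]
    omega
where
  bounds_lt : ∀ (b : BExpr) {d : ℕ}, b.wf d = true → ∀ z ∈ b.bounds, z < 30
  | lt _ _, _, _, z, hz => by simp [bounds] at hz
  | eq _ _, _, _, z, hz => by simp [bounds] at hz
  | rlt _ _, _, _, z, hz => by simp [bounds] at hz
  | not b, _, h, z, hz => bounds_lt b h z hz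
  | and b₁ b₂, _, h, z, hz => by
    simp only [wf, Bool.and_eq_true] at h
    simp only [bounds, List.mem_append] at hz
    exact hz.elim (bounds_lt b₁ h.1 z) (bounds_lt b₂ h.2 z)
  | ex x y b, _, h, z, hz => by
    simp only [wf, Bool.and_eq_true, decide_eq_true_eq, beq_iff_eq] at h
    simp only [bounds, List.mem_cons] at hz
    rcases hz with rfl | hz
    · exact h.1.2
    · exact bounds_lt b h.2 z hz

end BExpr
-- Commands and their compilation
/-- The instruction uses only real variables. -/
def Instr.isReal : Instr → Bool
  | .rconst _ _ => true
  | .radd _ _ _ => true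
  | .rsub _ _ _ => true
  | .rmul _ _ _ => true
  | .rdiv _ _ _ => true
  | .rsqrt _ _ => true
  | _ => false

/-- The real variable `x` is not assigned. -/
def Instr.keepsR (x : ℕ) : Instr → Bool
  | .rconst y _ => x != y
  | .radd y _ _ => x != y
  | .rsub y _ _ => x != y
  | .rmul y _ _ => x != y
  | .rdiv y _ _ => x != y
  | .rsqrt y _ => x != y
  | .rload y _ _ => x != y
  | _ => true

theorem Agree.setR {K : ℕ → Prop} {s s' : State} (h : Agree K s s') (x : ℕ) (v : ℝ) :
    Agree K (s.setR x v) (s'.setR x v) :=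
  ⟨h.ivar, by simp [State.setR, h.rvar], h.iarr, h.rarr⟩

theorem Agree.setIArr {K : ℕ → Prop} {s s' : State} (h : Agree K s s') (a m v : ℕ) :
    Agree K (s.setIArr a m v) (s'.setIArr a m v) :=
  ⟨h.ivar, h.rvar, by simp [State.setIArr, h.iarr], h.rarr⟩

theorem Agree.setRArr {K : ℕ → Prop} {s s' : State} (h : Agree K s s') (a m : ℕ) (v : ℝ) :
    Agree K (s.setRArr a m v) (s'.setRArr a m v) :=
  ⟨h.ivar, h.rvar, h.iarr, by simp [State.setRArr, h.rarr]⟩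

/-- Commands. In `for x y c`, the variable `x` runs through the numbers smaller than the
variable `y`. -/
inductive Cmd where
  | seq (c₁ c₂ : Cmd)
  | skip
  | assign (x : ℕ) (e : IExpr)
  | store (a : ℕ) (e₁ e₂ : IExpr)
  | real (i : Instr)
  | rload (x a : ℕ) (e : IExpr)
  | rstore (a : ℕ) (e : IExpr) (x : ℕ)
  | ite (b : BExpr) (c₁ c₂ : Cmd)
  | for (x y : ℕ) (c : Cmd)

/-- `repeatUpto f m s` applies `f 0`, …, `f (m - 1)` to `s`. -/
def repeatUpto (f : ℕ → State → State) : ℕ → State → State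
  | 0, s => s
  | j + 1, s => f j (repeatUpto f j s)

theorem repeatUpto_induction {f : ℕ → State → State} {s : State} (Inv : ℕ → State → Prop) {m : ℕ}
    (h0 : Inv 0 s) (h : ∀ j < m, ∀ τ, Inv j τ → Inv (j + 1) (f j τ)) :
    Inv m (repeatUpto f m s) := by
  induction m with
  | zero => exact h0
  | succ m ih => exact h m (by omega) _ (ih fun j hj => h j (by omega))

namespace Cmd

open Classical in
/-- The effect of a command. -/
noncomputable def run : Cmd → State → State
  | seq c₁ c₂, s => run c₂ (run c₁ s)
  | skip, s => s
  | assign x e, s => s.setI x (e.eval s)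
  | store a e₁ e₂, s => s.setIArr a (e₁.eval s) (e₂.eval s)
  | real i, s => i.run s
  | rload x a e, s => s.setR x (s.rarr a (e.eval s))
  | rstore a e x, s => s.setRArr a (e.eval s) (s.rvar x)
  | ite b c₁ c₂, s => if b.Holds s then run c₁ s else run c₂ s
  | .for x y c, s =>
    (repeatUpto (fun j t => run c (t.setI x j)) (s.ivar y) s).setI x (s.ivar y)

/-- The integer variable `x` is not assigned. -/
def keepsI (x : ℕ) : Cmd → Bool
  | seq c₁ c₂ => keepsI x c₁ && keepsI x c₂
  | assign y _ => x != y
  | real i => i.isReal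
  | ite _ c₁ c₂ => keepsI x c₁ && keepsI x c₂
  | .for y _ c => x != y && keepsI x c
  | _ => true

/-- The real variable `x` is not assigned. -/
def keepsR (x : ℕ) : Cmd → Bool
  | seq c₁ c₂ => keepsR x c₁ && keepsR x c₂
  | real i => i.isReal && i.keepsR x
  | rload y _ _ => x != y
  | ite _ c₁ c₂ => keepsR x c₁ && keepsR x c₂
  | .for _ _ c => keepsR x c
  | _ => true

/-- The integer array `a` is not changed. -/
def keepsIArr (a : ℕ) : Cmd → Bool
  | seq c₁ c₂ => keepsIArr a c₁ && keepsIArr a c₂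
  | store y _ _ => a != y
  | real i => i.isReal
  | ite _ c₁ c₂ => keepsIArr a c₁ && keepsIArr a c₂
  | .for _ _ c => keepsIArr a c
  | _ => true

/-- The real array `a` is not changed. -/
def keepsRArr (a : ℕ) : Cmd → Bool
  | seq c₁ c₂ => keepsRArr a c₁ && keepsRArr a c₂
  | real i => i.isReal
  | rstore y _ _ => a != y
  | ite _ c₁ c₂ => keepsRArr a c₁ && keepsRArr a c₂
  | .for _ _ c => keepsRArr a c
  | _ => true

/-- The command uses variables as it should. -/
def wf : Cmd → Bool
  | seq c₁ c₂ => wf c₁ && wf c₂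
  | skip => true
  | assign x e => x < 30 && e.wf 30
  | store _ e₁ e₂ => e₁.wf 30 && e₂.wf 30
  | real i => i.isReal
  | rload _ _ e => e.wf 30
  | rstore _ e _ => e.wf 30
  | ite b c₁ c₂ => b.wf 30 && wf c₁ && wf c₂
  | .for x y c => x < 30 && y < 30 && x != y && keepsI x c && keepsI y c && wf c

/-- The variables that bound the loops. -/
def bounds : Cmd → List ℕ
  | seq c₁ c₂ => bounds c₁ ++ bounds c₂
  | ite b c₁ c₂ => b.bounds ++ (bounds c₁ ++ bounds c₂)
  | .for _ y c => y :: bounds c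
  | _ => []

/-- The variables that bound the loops are not assigned. -/
def stable (c : Cmd) : Bool := c.bounds.all fun z => c.keepsI z

/-- The exponent in the bound for the running time. -/
def deg : Cmd → ℕ
  | seq c₁ c₂ => max (deg c₁) (deg c₂) + 2
  | skip => 1
  | assign _ e => e.time + 2
  | store _ e₁ e₂ => e₁.time + e₂.time + 2
  | real _ => 1
  | rload _ _ e => e.time + 2
  | rstore _ e _ => e.time + 2
  | ite b c₁ c₂ => max b.deg (max (deg c₁) (deg c₂)) + 2
  | .for _ _ c => deg c + 3

/-- The compiler. The variables from `50` on are temporary. -/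
def comp : Cmd → Program
  | seq c₁ c₂ => .seq (comp c₁) (comp c₂)
  | skip => .skip
  | assign x e => .seq (e.comp 50) (.seq (.instr (.iconst x 0)) (.instr (.iadd x x 50)))
  | store a e₁ e₂ => .seq (.seq (e₁.comp 50) (e₂.comp 51)) (.instr (.istore a 50 51))
  | real i => .instr i
  | rload x a e => .seq (e.comp 50) (.instr (.rload x a 50))
  | rstore a e x => .seq (e.comp 50) (.instr (.rstore a 50 x))
  | ite b c₁ c₂ => .seq (.seq (b.comp 50) (.instr (.iconst 51 0)))
      (.cond (.ilt 51 50) (comp c₁) (comp c₂))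
  | .for x y c => .seq (.instr (.iconst x 0)) (.loop (.ilt x y)
      (.seq (comp c) (.seq (.instr (.iconst 50 1)) (.instr (.iadd x x 50)))))

/-- A frame rule whose premise is a Boolean computed from the program text. For a concrete command
the premise is therefore proved by `rfl`; the next three rules are of the same kind. -/
theorem run_ivar {x : ℕ} : ∀ (c : Cmd) (s : State), c.keepsI x = true →
    (c.run s).ivar x = s.ivar x
  | seq c₁ c₂, s, h => by
    simp only [keepsI, Bool.and_eq_true] at h
    rw [run, run_ivar c₂ _ h.2, run_ivar c₁ _ h.1]
  | skip, s, _ => rfl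
  | assign y e, s, h => by
    simp only [keepsI, bne_iff_ne] at h
    simp [run, h]
  | store _ _ _, s, _ => rfl
  | real i, s, h => by
    cases i <;> simp [keepsI, Instr.isReal] at h <;> rfl
  | rload _ _ _, s, _ => rfl
  | rstore _ _ _, s, _ => rfl
  | ite b c₁ c₂, s, h => by
    simp only [keepsI, Bool.and_eq_true] at h
    simp only [run]
    split_ifs
    · exact run_ivar c₁ s h.1
    · exact run_ivar c₂ s h.2
  | .for y z c, s, h => by
    simp only [keepsI, Bool.and_eq_true, bne_iff_ne] at h
    simp only [run, State.setI_ivar, if_neg h.1]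
    refine repeatUpto_induction (fun _ t => t.ivar x = s.ivar x) rfl fun j _ t ht => ?_
    rw [run_ivar c _ h.2, State.setI_ivar_ne _ _ h.1, ht]

theorem run_rvar {x : ℕ} : ∀ (c : Cmd) (s : State), c.keepsR x = true →
    (c.run s).rvar x = s.rvar x
  | seq c₁ c₂, s, h => by
    simp only [keepsR, Bool.and_eq_true] at h
    rw [run, run_rvar c₂ _ h.2, run_rvar c₁ _ h.1]
  | skip, s, _ => rfl
  | assign y e, s, _ => rfl
  | store _ _ _, s, _ => rfl
  | real i, s, h => by
    cases i <;> simp [keepsR, Instr.isReal, Instr.keepsR] at h <;>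
      simp [run, Instr.run, State.setR, h]
  | rload y _ _, s, h => by
    simp only [keepsR, bne_iff_ne] at h
    simp [run, State.setR, h]
  | rstore _ _ _, s, _ => rfl
  | ite b c₁ c₂, s, h => by
    simp only [keepsR, Bool.and_eq_true] at h
    simp only [run]
    split_ifs
    · exact run_rvar c₁ s h.1
    · exact run_rvar c₂ s h.2
  | .for y z c, s, h => by
    simp only [run]
    refine repeatUpto_induction (fun _ t => t.rvar x = s.rvar x) rfl fun j _ t ht => ?_
    rw [run_rvar c _ h, ← ht]
    rfl

theorem run_iarr {a : ℕ} : ∀ (c : Cmd) (s : State), c.keepsIArr a = true →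
    (c.run s).iarr a = s.iarr a
  | seq c₁ c₂, s, h => by
    simp only [keepsIArr, Bool.and_eq_true] at h
    rw [run, run_iarr c₂ _ h.2, run_iarr c₁ _ h.1]
  | skip, s, _ => rfl
  | assign y e, s, _ => rfl
  | store b _ _, s, h => by
    simp only [keepsIArr, bne_iff_ne] at h
    simp [run, State.setIArr, h]
  | real i, s, h => by
    cases i <;> simp [keepsIArr, Instr.isReal] at h <;> rfl
  | rload _ _ _, s, _ => rfl
  | rstore _ _ _, s, _ => rfl
  | ite b c₁ c₂, s, h => by
    simp only [keepsIArr, Bool.and_eq_true] at h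
    simp only [run]
    split_ifs
    · exact run_iarr c₁ s h.1
    · exact run_iarr c₂ s h.2
  | .for y z c, s, h => by
    simp only [run]
    refine repeatUpto_induction (fun _ t => t.iarr a = s.iarr a) rfl fun j _ t ht => ?_
    rw [run_iarr c _ h, ← ht]
    rfl

theorem run_rarr {a : ℕ} : ∀ (c : Cmd) (s : State), c.keepsRArr a = true →
    (c.run s).rarr a = s.rarr a
  | seq c₁ c₂, s, h => by
    simp only [keepsRArr, Bool.and_eq_true] at h
    rw [run, run_rarr c₂ _ h.2, run_rarr c₁ _ h.1]
  | skip, s, _ => rfl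
  | assign y e, s, _ => rfl
  | store _ _ _, s, _ => rfl
  | real i, s, h => by
    cases i <;> simp [keepsRArr, Instr.isReal] at h <;> rfl
  | rload _ _ _, s, _ => rfl
  | rstore b _ _, s, h => by
    simp only [keepsRArr, bne_iff_ne] at h
    simp [run, State.setRArr, h]
  | ite b c₁ c₂, s, h => by
    simp only [keepsRArr, Bool.and_eq_true] at h
    simp only [run]
    split_ifs
    · exact run_rarr c₁ s h.1
    · exact run_rarr c₂ s h.2
  | .for y z c, s, h => by
    simp only [run]
    refine repeatUpto_induction (fun _ t => t.rarr a = s.rarr a) rfl fun j _ t ht => ?_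
    rw [run_rarr c _ h, ← ht]
    rfl

/-- Reasoning about a loop with an invariant. -/
theorem run_for {x y : ℕ} {c : Cmd} {s : State} (Inv : ℕ → State → Prop)
    (hx : ∀ j t, Inv j t → Inv j (t.setI x (s.ivar y))) (h0 : Inv 0 s)
    (h : ∀ j < s.ivar y, ∀ t, Inv j t → Inv (j + 1) (c.run (t.setI x j))) :
    Inv (s.ivar y) ((Cmd.for x y c).run s) :=
  hx _ _ (repeatUpto_induction Inv h0 h)

/-! ### Correctness and running time of the compiler -/

/-- The program `P` simulates the transition from `s` to `s'` within `T` steps. -/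
def Simulates (P : Program) (s s' : State) (T : ℕ) : Prop :=
  ∀ τ, Agree (· < 30) s τ → ∃ τ' t, Exec P τ τ' t ∧ t ≤ T ∧ Agree (· < 30) s' τ'

theorem Simulates.seq {P Q : Program} {s s' s'' : State} {T T' : ℕ} (h : Simulates P s s' T)
    (h' : Simulates Q s' s'' T') : Simulates (.seq P Q) s s'' (T + T') := by
  intro τ hτ
  obtain ⟨τ1, t1, h1, h2, h3⟩ := h τ hτ
  obtain ⟨τ2, t2, h4, h5, h6⟩ := h' τ1 h3
  exact ⟨τ2, _, h1.seq h4, by omega, h6⟩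

/-- An iteration costs the body, two instructions that increase the counter, and one test; the
remaining `2` steps are the initialization and the failing test. The bound `s.ivar y` is arbitrary,
so this also covers the loop over the points. -/
theorem simulates_for {x y : ℕ} {c : Cmd} (hx : x < 30) (hy : y < 30) (hxy : x ≠ y)
    (hcx : c.keepsI x = true) (hcy : c.keepsI y = true) (s : State) {T : ℕ}
    (h : ∀ j < s.ivar y, ∀ t, t = repeatUpto (fun j t => run c (t.setI x j)) j s →
      Simulates c.comp (t.setI x j) (c.run (t.setI x j)) T) :
    Simulates (Cmd.for x y c).comp s ((Cmd.for x y c).run s) (s.ivar y * (T + 3) + 2) := by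
  intro τ hτ
  -- The semantics sets the counter at the start of an iteration, while the compiled code increases
  -- it at the end. Hence the machine state after `j` iterations is compared with `it j` with the
  -- counter set to `j`.
  let it := fun j => repeatUpto (fun j t => run c (t.setI x j)) j s
  have hity : ∀ j, (it j).ivar y = s.ivar y := by
    intro j
    refine repeatUpto_induction (fun _ t => t.ivar y = s.ivar y) rfl fun j _ t ht => ?_
    rw [run_ivar c _ hcy, State.setI_ivar_ne _ _ hxy.symm, ht]
  have hinv : ∀ j t, Agree (· < 30) ((it j).setI x j) t → t.ivar x = j ∧ t.ivar y = s.ivar y := by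
    intro j t h
    refine ⟨?_, ?_⟩
    · rw [h.ivar x hx, State.setI_ivar_self]
    · rw [h.ivar y hy, State.setI_ivar_ne _ _ hxy.symm, hity]
  have hbody : ∀ j < s.ivar y, ∀ t, Agree (· < 30) ((it j).setI x j) t →
      ∃ t' T', Exec (.seq (comp c) (.seq (.instr (.iconst 50 1)) (.instr (.iadd x x 50)))) t t' T' ∧
        T' ≤ T + 2 ∧ Agree (· < 30) ((it (j + 1)).setI x (j + 1)) t' := by
    intro j hj t ht
    obtain ⟨t1, T1, h1, h2, h3⟩ := h j hj _ rfl t ht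
    refine ⟨_, _, h1.seq ((Exec.instr _ _).seq (Exec.instr _ _)), by omega, ?_⟩
    have h4 : t1.ivar x = j := by
      rw [h3.ivar x hx, run_ivar c _ hcx, State.setI_ivar_self]
    have h5 : x ≠ 50 := by omega
    simp only [Instr.run, State.setI_ivar, if_neg h5, if_true, h4]
    exact (h3.setI_right (K := (· < 30)) (by omega) 1).setI x (j + 1) fun y h _ => h
  obtain ⟨τ', t, h1, h2, h3⟩ := exec_count (fun j t => Agree (· < 30) ((it j).setI x j) t) hinv
    hbody (τ.setI x 0) (hτ.setI x 0 fun y h _ => h)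
  refine ⟨τ', _, (Exec.instr _ _).seq h1, ?_, h3⟩
  have : s.ivar y * (T + 3) = s.ivar y * (T + 2 + 1) := rfl
  omega

/-- Induction on the command. No loop bound is ever assigned, so all of them remain at most `V`, and
each construction raises the exponent by a constant. -/
theorem simulates_comp {V : ℕ} (hV : 4 ≤ V) : ∀ (c : Cmd) (s : State), c.wf = true →
    (∀ z ∈ c.bounds, c.keepsI z = true ∧ s.ivar z ≤ V) →
    Simulates c.comp s (c.run s) (V ^ c.deg)
  | seq c₁ c₂, s, hc, hz => by
    simp only [wf, Bool.and_eq_true] at hc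
    simp only [bounds, List.mem_append, keepsI, Bool.and_eq_true] at hz
    intro τ hτ
    obtain ⟨τ', t, h1, h2, h3⟩ := (simulates_comp hV c₁ s hc.1 fun z h =>
      ⟨(hz z (Or.inl h)).1.1, (hz z (Or.inl h)).2⟩).seq (simulates_comp hV c₂ (c₁.run s) hc.2
      fun z h => ⟨(hz z (Or.inr h)).1.2, by
        rw [run_ivar _ _ (hz z (Or.inr h)).1.1]; exact (hz z (Or.inr h)).2⟩) τ hτ
    have := pow_add_pow_le hV c₁.deg c₂.deg
    exact ⟨τ', t, h1, by simp only [deg]; omega, h3⟩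
  | skip, s, _, _ => fun τ hτ => ⟨τ, 0, Exec.skip _, by omega, hτ⟩
  | assign x e, s, hc, _ => by
    simp only [wf, Bool.and_eq_true, decide_eq_true_eq] at hc
    intro τ hτ
    obtain ⟨τ', h1, h2, h3⟩ := e.exec_comp 50 τ hc.2 (by omega)
    refine ⟨_, _, h1.seq ((Exec.instr _ _).seq (Exec.instr _ _)),
      BExpr.le_pow_self hV (e.time + 2), ?_⟩
    have h4 : (50 : ℕ) ≠ x := by omega
    simp only [Instr.run, State.setI_ivar, if_neg h4, if_true, h2, run, zero_add,
      IExpr.eval_congr hτ e hc.2]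
    have h5 : Agree (fun y => y < 30 ∧ y ≠ x) s τ' :=
      (hτ.mono fun y h => h.1).trans (h3.mono fun y h => by omega)
    exact (h5.setI_right (by omega) 0).setI x _ fun y h h' => ⟨h, h'⟩
  | store a e₁ e₂, s, hc, _ => by
    simp only [wf, Bool.and_eq_true] at hc
    intro τ hτ
    obtain ⟨τ1, h1, h2, h3⟩ := e₁.exec_comp 50 τ hc.1 (by omega)
    obtain ⟨τ2, h4, h5, h6⟩ := e₂.exec_comp 51 τ1 hc.2 (by omega)
    have h7 : Agree (· < 30) τ τ1 := h3.mono fun y h => by omega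
    refine ⟨_, _, (h1.seq h4).seq (Exec.instr _ _),
      (BExpr.le_pow_self hV (e₁.time + e₂.time + 2)).trans' (by omega), ?_⟩
    simp only [Instr.run, run]
    rw [h5, h6.ivar 50 (by omega), h2, IExpr.eval_congr h7 e₂ hc.2, IExpr.eval_congr hτ e₂ hc.2,
      IExpr.eval_congr hτ e₁ hc.1]
    exact ((hτ.trans h7).trans (h6.mono fun y h => by omega)).setIArr _ _ _
  | real i, s, hc, _ => by
    intro τ hτ
    refine ⟨_, _, Exec.instr _ _, by simp only [deg, pow_one]; omega, ?_⟩
    cases i <;> simp [wf, Instr.isReal] at hc <;> simp only [Instr.run, run, hτ.rvar] <;>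
      exact hτ.setR _ _
  | rload x a e, s, hc, _ => by
    intro τ hτ
    obtain ⟨τ1, h1, h2, h3⟩ := e.exec_comp 50 τ hc (by omega)
    refine ⟨_, _, h1.seq (Exec.instr _ _),
      (BExpr.le_pow_self hV (e.time + 2)).trans' (by omega), ?_⟩
    simp only [Instr.run, run]
    rw [h2, IExpr.eval_congr hτ e hc, h3.rarr, hτ.rarr]
    exact (hτ.trans (h3.mono fun y h => by omega)).setR _ _
  | rstore a e x, s, hc, _ => by
    intro τ hτ
    obtain ⟨τ1, h1, h2, h3⟩ := e.exec_comp 50 τ hc (by omega)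
    refine ⟨_, _, h1.seq (Exec.instr _ _),
      (BExpr.le_pow_self hV (e.time + 2)).trans' (by omega), ?_⟩
    simp only [Instr.run, run]
    rw [h2, IExpr.eval_congr hτ e hc, h3.rvar, hτ.rvar]
    exact (hτ.trans (h3.mono fun y h => by omega)).setRArr _ _ _
  | ite b c₁ c₂, s, hc, hz => by
    simp only [wf, Bool.and_eq_true] at hc
    simp only [bounds, List.mem_append, keepsI, Bool.and_eq_true] at hz
    intro τ hτ
    obtain ⟨τ1, t1, h1, h2, h3, h4⟩ := b.exec_comp hV 30 50 τ hc.1.1 (by omega) (by omega)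
      (by omega) fun z h => by
        rw [hτ.ivar z (BExpr.exec_comp.bounds_lt b hc.1.1 z h)]
        exact (hz z (Or.inl h)).2
    have h5 : Agree (· < 30) s (τ1.setI 51 0) :=
      (hτ.trans (h4.mono fun y h => Or.inl h)).setI_right (by omega) 0
    have h6 := pow_add_pow_le hV b.deg (max c₁.deg c₂.deg)
    have h7 : V ^ c₁.deg ≤ V ^ max c₁.deg c₂.deg :=
      Nat.pow_le_pow_right (by omega) (le_max_left _ _)
    have h8 : V ^ c₂.deg ≤ V ^ max c₁.deg c₂.deg :=
      Nat.pow_le_pow_right (by omega) (le_max_right _ _)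
    rw [b.holds_congr le_rfl hτ hc.1.1] at h3
    by_cases c : b.Holds s
    · obtain ⟨τ2, t2, h9, h10, h11⟩ := simulates_comp hV c₁ s hc.1.2 (fun z h =>
        ⟨(hz z (Or.inr (Or.inl h))).1.1, (hz z (Or.inr (Or.inl h))).2⟩) _ h5
      refine ⟨τ2, _, (h1.seq (Exec.instr _ _)).seq (Exec.cond_true ?_ h9), ?_, ?_⟩
      · simp [Test.Holds, Instr.run, h3, c]
      · simp only [deg]; omega
      · simpa [run, c] using h11
    · obtain ⟨τ2, t2, h9, h10, h11⟩ := simulates_comp hV c₂ s hc.2 (fun z h =>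
        ⟨(hz z (Or.inr (Or.inr h))).1.2, (hz z (Or.inr (Or.inr h))).2⟩) _ h5
      refine ⟨τ2, _, (h1.seq (Exec.instr _ _)).seq (Exec.cond_false ?_ h9), ?_, ?_⟩
      · simp [Test.Holds, Instr.run, h3, c]
      · simp only [deg]; omega
      · simpa [run, c] using h11
  | .for x y c, s, hc, hz => by
    simp only [wf, Bool.and_eq_true, decide_eq_true_eq, bne_iff_ne] at hc
    obtain ⟨⟨⟨⟨⟨hx, hy⟩, hxy⟩, hcx⟩, hcy⟩, hc⟩ := hc
    simp only [bounds, List.mem_cons, keepsI, Bool.and_eq_true, bne_iff_ne] at hz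
    intro τ hτ
    obtain ⟨τ', t, h1, h2, h3⟩ := simulates_for hx hy hxy hcx hcy s (T := V ^ c.deg)
      (fun j hj t ht => simulates_comp hV c _ hc fun z h => by
        obtain ⟨⟨h1, h2⟩, h3⟩ := hz z (Or.inr h)
        refine ⟨h2, ?_⟩
        rw [State.setI_ivar_ne _ _ h1, ht]
        refine repeatUpto_induction (fun _ t => t.ivar z ≤ V) h3 fun j _ t ht => ?_
        rw [run_ivar c _ h2, State.setI_ivar_ne _ _ h1]
        exact ht) τ hτ
    refine ⟨τ', t, h1, h2.trans ?_, h3⟩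
    have h4 := mul_pow_le hV c.deg
    have h5 : s.ivar y * (V ^ c.deg + 3) ≤ V * (V ^ c.deg + 8) :=
      Nat.mul_le_mul (hz y (Or.inl rfl)).2 (by omega)
    simp only [deg]
    omega

theorem simulates {V : ℕ} (hV : 4 ≤ V) (c : Cmd) (s : State) (hc : c.wf = true)
    (hs : c.stable = true) (hz : ∀ z ∈ c.bounds, s.ivar z ≤ V) :
    Simulates c.comp s (c.run s) (V ^ c.deg) :=
  simulates_comp hV c s hc fun z h => ⟨List.all_eq_true.1 hs z h, hz z h⟩

end Cmd

end RealRAM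

/-! ### The program -/

namespace RealRAM

@[simp] theorem State.setI_rvar (s : State) (x v : ℕ) : (s.setI x v).rvar = s.rvar := rfl
@[simp] theorem State.setI_iarr (s : State) (x v : ℕ) : (s.setI x v).iarr = s.iarr := rfl
@[simp] theorem State.setI_rarr (s : State) (x v : ℕ) : (s.setI x v).rarr = s.rarr := rfl
@[simp] theorem State.setR_ivar (s : State) (x : ℕ) (v : ℝ) : (s.setR x v).ivar = s.ivar := rfl
@[simp] theorem State.setR_iarr (s : State) (x : ℕ) (v : ℝ) : (s.setR x v).iarr = s.iarr := rfl
@[simp] theorem State.setR_rarr (s : State) (x : ℕ) (v : ℝ) : (s.setR x v).rarr = s.rarr := rfl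
@[simp] theorem State.setR_rvar (s : State) (x y : ℕ) (v : ℝ) :
    (s.setR x v).rvar y = if y = x then v else s.rvar y := by
  simp [State.setR, Function.update_apply]
@[simp] theorem State.setIArr_ivar (s : State) (a m v : ℕ) :
    (s.setIArr a m v).ivar = s.ivar := rfl
@[simp] theorem State.setIArr_rvar (s : State) (a m v : ℕ) :
    (s.setIArr a m v).rvar = s.rvar := rfl
@[simp] theorem State.setIArr_rarr (s : State) (a m v : ℕ) :
    (s.setIArr a m v).rarr = s.rarr := rfl
@[simp] theorem State.setIArr_iarr (s : State) (a m v b x : ℕ) :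
    (s.setIArr a m v).iarr b x = if b = a then (if x = m then v else s.iarr a x)
      else s.iarr b x := by
  by_cases h : b = a
  · subst h; simp [State.setIArr, Function.update_apply]
  · simp [State.setIArr, h]
@[simp] theorem State.setRArr_ivar (s : State) (a m : ℕ) (v : ℝ) :
    (s.setRArr a m v).ivar = s.ivar := rfl
@[simp] theorem State.setRArr_rvar (s : State) (a m : ℕ) (v : ℝ) :
    (s.setRArr a m v).rvar = s.rvar := rfl
@[simp] theorem State.setRArr_iarr (s : State) (a m : ℕ) (v : ℝ) :
    (s.setRArr a m v).iarr = s.iarr := rfl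
@[simp] theorem State.setRArr_rarr (s : State) (a m : ℕ) (v : ℝ) (b x : ℕ) :
    (s.setRArr a m v).rarr b x = if b = a then (if x = m then v else s.rarr a x)
      else s.rarr b x := by
  by_cases h : b = a
  · subst h; simp [State.setRArr, Function.update_apply]
  · simp [State.setRArr, h]

/-! ### Derived conditions and arithmetic by repeated addition -/

namespace BExpr

/-- Disjunction. -/
def or (b₁ b₂ : BExpr) : BExpr := not (and (not b₁) (not b₂))

/-- Implication. -/
def imp (b₁ b₂ : BExpr) : BExpr := not (and b₁ (not b₂))

/-- Bounded universal quantification. -/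
def all (x y : ℕ) (b : BExpr) : BExpr := not (ex x y (not b))

theorem holds_or (b₁ b₂ : BExpr) (s : State) :
    (or b₁ b₂).Holds s ↔ b₁.Holds s ∨ b₂.Holds s := by
  simp only [or, Holds]; tauto

theorem holds_imp (b₁ b₂ : BExpr) (s : State) :
    (imp b₁ b₂).Holds s ↔ (b₁.Holds s → b₂.Holds s) := by
  simp only [imp, Holds]; tauto

theorem holds_all (x y : ℕ) (b : BExpr) (s : State) :
    (all x y b).Holds s ↔ ∀ v < s.ivar y, b.Holds (s.setI x v) := by
  simp only [all, Holds]; push Not; rfl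

end BExpr

namespace Cmd

/-- A sequence of commands. -/
def block : List Cmd → Cmd
  | [] => skip
  | [c] => c
  | c :: l => seq c (block l)

/-- Put the multiples of the variable `y` into the array `a`, at the positions smaller than the
variable `b`. -/
def multiples (a y b : ℕ) : Cmd :=
  block [assign 11 (.const 0),
    .for 27 b (block [store a (.var 27) (.var 11), assign 11 (.add (.var 11) (.var y))])]

/-- Add the variable `y` to the variable `x`, as many times as the variable `b` says. -/
def addTimes (x y b : ℕ) : Cmd := .for 27 b (assign x (.add (.var x) (.var y)))

/-- Put the power of two with exponent the variable `b` into the variable `x`. -/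
def powTwo (x b : ℕ) : Cmd :=
  block [assign x (.const 1), .for 27 b (assign x (.add (.var x) (.var x)))]

/-- Variable `11` carries the current multiple and `27` counts; the inequalities keep them apart
from the inputs. -/
theorem run_multiples {a y b : ℕ} (s : State) (hy : y ≠ 11) (hy' : y ≠ 27) (hb : b ≠ 11) :
    ∀ j < s.ivar b, ((multiples a y b).run s).iarr a j = j * s.ivar y := by
  have := run_for (x := 27) (y := b) (s := s.setI 11 0)
    (c := block [store a (.var 27) (.var 11), assign 11 (.add (.var 11) (.var y))])
    (fun j t => (∀ j' < j, t.iarr a j' = j' * s.ivar y) ∧ t.ivar 11 = j * s.ivar y ∧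
      t.ivar y = s.ivar y) ?_ ?_ ?_
  · simpa [multiples, block, run, IExpr.eval, hb] using this.1
  · rintro j t ⟨h1, h2, h3⟩
    exact ⟨h1, by simpa using h2, by simpa [hy'] using h3⟩
  · simp [hy]
  · rintro j - t ⟨h1, h2, h3⟩
    refine ⟨?_, ?_, ?_⟩
    · intro j' hj'
      by_cases e : j' = j
      · subst e
        simp [block, run, IExpr.eval, h2]
      · simp [block, run, IExpr.eval, e, h1 j' (by omega)]
    · simp [block, run, IExpr.eval, h2, h3, hy']
      ring
    · simp [block, run, hy, hy', h3]

theorem run_addTimes {x y b : ℕ} (s : State) (hx : x ≠ 27) (hy : y ≠ 27) (hxy : y ≠ x) :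
    ((addTimes x y b).run s).ivar x = s.ivar x + s.ivar b * s.ivar y := by
  refine (run_for (x := 27) (y := b) (s := s) (fun j t => t.ivar x = s.ivar x + j * s.ivar y ∧
    t.ivar y = s.ivar y) ?_ ?_ ?_).1
  · rintro j t ⟨h1, h2⟩
    simp [hx, hy, h1, h2]
  · simp
  · rintro j - t ⟨h1, h2⟩
    simp [run, IExpr.eval, hx, hy, hxy, h1, h2]
    ring

theorem run_powTwo {x b : ℕ} (s : State) (hx : x ≠ 27) (hb : b ≠ x) :
    ((powTwo x b).run s).ivar x = 2 ^ s.ivar b := by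
  have := run_for (x := 27) (y := b) (s := s.setI x 1) (c := assign x (.add (.var x) (.var x)))
    (fun j t => t.ivar x = 2 ^ j) ?_ ?_ ?_
  · simpa [powTwo, block, run, IExpr.eval, hb] using this
  · intro j t h
    simpa [hx] using h
  · simp
  · rintro j - t h
    simp [run, IExpr.eval, hx, h]
    ring

end Cmd

end RealRAM

namespace MinCSG

open RealRAM RealRAM.Cmd

/-! ### Encoding of the states and precomputed tables -/

/-- The number of bits of the states of the dynamic program. -/
def numBits (k : ℕ) : ℕ := k ^ 2 * 2 ^ k

/-- The number of states of the dynamic program. -/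
def numStates (k : ℕ) : ℕ := 2 ^ numBits k

/-- In the state `s`, the colors `A` and `A'` have the same label in the primary color `c`. -/
def SameLabel (k s c A A' : ℕ) : Prop :=
  ∀ b < k, s.testBit (c * (2 ^ k * k) + A * k + b) = s.testBit (c * (2 ^ k * k) + A' * k + b)

/-! The integer variables `0`, …, `7` hold `n`, `k`, `2 ^ k`, `k ^ 2`, the number `L` of bits, the
number `N` of states, `k * N` and `2 ^ k * k * N`; variable `8` is `k` times the number of points
that have been read, and variable `9` is the color of the last one. The integer array `3` holds the
bits of all states, and the arrays `4`, `5`, `6` the offsets with which it is indexed. Arrays `7`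
and `8` tell which states have been reached before and after the current point, and array `9` which
colors have been seen. The real arrays `2` and `3` hold the coordinates of the last points of the
colors, arrays `4` and `5` the costs of the states, and array `6` the distances of the current
point from the last points of the colors. -/

/-- The tables from which the bits of states and colors are read. -/
structure Tables (k : ℕ) (s : State) : Prop where
  ivar_one : s.ivar 1 = k
  ivar_two : s.ivar 2 = 2 ^ k
  ivar_five : s.ivar 5 = numStates k
  bit_offset : ∀ j < numBits k, s.iarr 4 j = j * numStates k
  primary_offset : ∀ c < k, s.iarr 5 c = c * (2 ^ k * (k * numStates k))
  color_offset : ∀ A < 2 ^ k, s.iarr 6 A = A * (k * numStates k)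
  bits : ∀ j < numBits k, ∀ x < numStates k,
    s.iarr 3 (j * numStates k + x) = (x.testBit j).toNat

theorem Tables.of_eq {k : ℕ} {s s' : State} (h : Tables k s) (h1 : s'.ivar 1 = s.ivar 1)
    (h2 : s'.ivar 2 = s.ivar 2) (h5 : s'.ivar 5 = s.ivar 5) (a3 : s'.iarr 3 = s.iarr 3)
    (a4 : s'.iarr 4 = s.iarr 4) (a5 : s'.iarr 5 = s.iarr 5) (a6 : s'.iarr 6 = s.iarr 6) :
    Tables k s' := by
  obtain ⟨b1, b2, b3, b4, b5, b6, b7⟩ := h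
  exact ⟨h1.trans b1, h2.trans b2, h5.trans b3, by rwa [a4], by rwa [a5], by rwa [a6], by rwa [a3]⟩

theorem Tables.setI {k : ℕ} {s : State} (h : Tables k s) {x : ℕ} (hx : 10 ≤ x) (v : ℕ) :
    Tables k (s.setI x v) :=
  h.of_eq (State.setI_ivar_ne _ _ (by omega)) (State.setI_ivar_ne _ _ (by omega))
    (State.setI_ivar_ne _ _ (by omega)) rfl rfl rfl rfl

/-- The tables of the halves and the parities of the numbers. -/
def halves : Cmd :=
  block [store 1 (.const 0) (.const 0), store 2 (.const 0) (.const 0),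
    .for 26 5 (block [
      store 1 (.add (.var 26) (.const 1)) (.add (.arr 1 (.var 26)) (.arr 2 (.var 26))),
      store 2 (.add (.var 26) (.const 1)) (.sub (.const 1) (.arr 2 (.var 26)))])]

/-- The recurrences $\lfloor (x+1)/2 \rfloor = \lfloor x/2 \rfloor + (x \bmod 2)$ and $(x+1) \bmod 2
= 1 - (x \bmod 2)$ need only addition and subtraction. -/
theorem run_halves (s : State) : ∀ x < s.ivar 5,
    (halves.run s).iarr 1 x = x / 2 ∧ (halves.run s).iarr 2 x = x % 2 := by
  have := run_for (x := 26) (y := 5) (s := (s.setIArr 1 0 0).setIArr 2 0 0)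
    (c := block [
      store 1 (.add (.var 26) (.const 1)) (.add (.arr 1 (.var 26)) (.arr 2 (.var 26))),
      store 2 (.add (.var 26) (.const 1)) (.sub (.const 1) (.arr 2 (.var 26)))])
    (fun j t => ∀ x ≤ j, t.iarr 1 x = x / 2 ∧ t.iarr 2 x = x % 2) ?_ ?_ ?_
  · intro x hx
    exact this x hx.le
  · intro j t h
    exact h
  · intro x hx
    obtain rfl : x = 0 := by omega
    simp
  · intro j _ t h x hx
    have hj := h j le_rfl
    by_cases e : x = j + 1
    · subst e
      simp [block, run, IExpr.eval, hj.1, hj.2]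
      omega
    · simpa [block, run, IExpr.eval, e] using h x (by omega)

/-- The row of the table of bits for the bit with the index in variable `27`. -/
def bitRow : Cmd :=
  .for 26 5 (.ite (.eq (.var 27) (.const 0))
    (store 3 (.add (.arr 4 (.var 27)) (.var 26)) (.arr 2 (.var 26)))
    (store 3 (.add (.arr 4 (.var 27)) (.var 26))
      (.arr 3 (.add (.arr 4 (.sub (.var 27) (.const 1))) (.arr 1 (.var 26))))))

/-- Bit $j+1$ of $x$ is bit $j$ of $\lfloor x/2 \rfloor$, so each row of the table is copied from
the row before it through the table of halves. -/
theorem run_bitTable (s : State) {L N : ℕ} (hL : s.ivar 4 = L) (hN : s.ivar 5 = N)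
    (h1 : ∀ x < N, s.iarr 1 x = x / 2 ∧ s.iarr 2 x = x % 2)
    (h4 : ∀ j < L, s.iarr 4 j = j * N) :
    ∀ j < L, ∀ x < N,
      ((Cmd.for 27 4 bitRow).run s).iarr 3 (j * N + x) = (x.testBit j).toNat := by
  have := run_for (x := 27) (y := 4) (s := s) (c := bitRow)
    (fun j t => (∀ j' < j, ∀ x < N, t.iarr 3 (j' * N + x) = (x.testBit j').toNat) ∧
      t.ivar 5 = N ∧ t.iarr 1 = s.iarr 1 ∧ t.iarr 2 = s.iarr 2 ∧ t.iarr 4 = s.iarr 4) ?_ ?_ ?_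
  · rw [hL] at this
    exact this.1
  · rintro j t ⟨b1, b2, b3⟩
    exact ⟨b1, by simpa using b2, b3⟩
  · exact ⟨fun _ h => absurd h (by omega), hN, rfl, rfl, rfl⟩
  · rintro j hj t ⟨b1, b2, b3, b4, b5⟩
    rw [hL] at hj
    refine ⟨?_, ?_, ?_, ?_, ?_⟩
    rotate_left
    · rw [run_ivar _ _ rfl]; simpa using b2
    · rw [run_iarr _ _ rfl]; exact b3
    · rw [run_iarr _ _ rfl]; exact b4
    · rw [run_iarr _ _ rfl]; exact b5
    have := run_for (x := 26) (y := 5) (s := t.setI 27 j)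
      (c := .ite (.eq (.var 27) (.const 0))
        (store 3 (.add (.arr 4 (.var 27)) (.var 26)) (.arr 2 (.var 26)))
        (store 3 (.add (.arr 4 (.var 27)) (.var 26))
          (.arr 3 (.add (.arr 4 (.sub (.var 27) (.const 1))) (.arr 1 (.var 26))))))
      (fun m t' => (∀ j' < j, ∀ x < N, t'.iarr 3 (j' * N + x) = (x.testBit j').toNat) ∧
        (∀ x < m, t'.iarr 3 (j * N + x) = (x.testBit j).toNat) ∧ t'.ivar 27 = j ∧
        t'.iarr 1 = s.iarr 1 ∧ t'.iarr 2 = s.iarr 2 ∧ t'.iarr 4 = s.iarr 4) ?_ ?_ ?_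
    · intro j' hj' x hx
      have e5 : (t.setI 27 j).ivar 5 = N := by simpa using b2
      rw [e5] at this
      by_cases e : j' = j
      · subst e
        exact this.2.1 x hx
      · exact this.1 j' (by omega) x hx
    · rintro m t' ⟨d1, d2, d3, d4⟩
      exact ⟨d1, d2, by simpa using d3, d4⟩
    · exact ⟨b1, fun _ h => absurd h (by omega), by simp, b3, b4, b5⟩
    · rintro m hm t' ⟨d1, d2, d3, d4, d5, d6⟩
      have hm' : m < N := by simpa [b2] using hm
      have hpar : (m.testBit 0).toNat = m % 2 := by rw [Nat.toNat_testBit]; simp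
      have key : (Cmd.run (.ite (.eq (.var 27) (.const 0))
          (store 3 (.add (.arr 4 (.var 27)) (.var 26)) (.arr 2 (.var 26)))
          (store 3 (.add (.arr 4 (.var 27)) (.var 26))
            (.arr 3 (.add (.arr 4 (.sub (.var 27) (.const 1))) (.arr 1 (.var 26))))))
          (t'.setI 26 m)) = (t'.setI 26 m).setIArr 3 (j * N + m) (m.testBit j).toNat := by
        -- Row `0` consists of the parities; later rows read the preceding one at position `m / 2`,
        -- which is again smaller than `N`.
        rcases j with _ | j
        · rw [hpar]
          simp [run, BExpr.Holds, IExpr.eval, d3, d5, d6, h4 0 hj, h1 m hm']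
        · have h5 := d1 j (by omega) (m / 2) (by omega)
          simp [run, BExpr.Holds, IExpr.eval, d3, d4, d6, h4 (j + 1) hj, h1 m hm',
            h4 j (by omega),
            h5, Nat.testBit_succ]
      rw [key]
      refine ⟨?_, ?_, by simpa using d3, ?_, ?_, ?_⟩
      · intro j' hj' x hx
        -- Rows have length `N`, so writing to row `j` does not disturb the earlier ones.
        have : j' * N + x ≠ j * N + m := by
          have : (j' + 1) * N ≤ j * N := Nat.mul_le_mul_right _ hj'
          rw [Nat.succ_mul] at this
          omega
        simpa [this] using d1 j' hj' x hx
      · intro x hx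
        by_cases e : x = m
        · subst e; simp
        · simpa [e] using d2 x (by omega)
      · rw [← d4]; ext; simp
      · rw [← d5]; ext; simp
      · rw [← d6]; ext; simp

/-- The computation of the number of bits. -/
def setupSizes : Cmd := block [addTimes 3 1 1, addTimes 4 3 2]

/-- The computation of the tables. -/
def setupTables : Cmd :=
  block [addTimes 6 5 1, addTimes 7 6 2, multiples 4 5 4, multiples 5 7 1, multiples 6 6 2,
    halves, .for 27 4 bitRow, store 7 (.const 0) (.const 1)]

/-- Each table is correct when it is written, and the frame rules carry it through the commands that
follow. The last store marks state `0` as the only starting state. -/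
theorem run_setupTables {k : ℕ} (s : State) (h1 : s.ivar 1 = k) (h2 : s.ivar 2 = 2 ^ k)
    (h4 : s.ivar 4 = numBits k) (h5 : s.ivar 5 = numStates k) (h6 : s.ivar 6 = 0)
    (h7 : s.ivar 7 = 0) :
    Tables k (setupTables.run s) ∧
      ∀ x, (setupTables.run s).iarr 7 x = if x = 0 then 1 else s.iarr 7 x := by
  let s1 := (addTimes 6 5 1).run s
  let s2 := (addTimes 7 6 2).run s1
  let s3 := (multiples 4 5 4).run s2
  let s4 := (multiples 5 7 1).run s3
  let s5 := (multiples 6 6 2).run s4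
  let s6 := halves.run s5
  let s7 := (Cmd.for 27 4 bitRow).run s6
  have e : setupTables.run s = s7.setIArr 7 0 1 := rfl
  have a1 : ∀ x ∈ [1, 2, 4, 5], s2.ivar x = s.ivar x := by
    intro x hx
    fin_cases hx <;> exact (run_ivar _ _ rfl).trans (run_ivar _ _ rfl)
  have a2 : s1.ivar 6 = k * numStates k := by
    have := run_addTimes (x := 6) (y := 5) (b := 1) s (by decide) (by decide) (by decide)
    rw [h6, h1, h5, zero_add] at this
    exact this
  have a3 : s2.ivar 7 = 2 ^ k * (k * numStates k) := by
    have := run_addTimes (x := 7) (y := 6) (b := 2) s1 (by decide) (by decide) (by decide)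
    rw [show s1.ivar 7 = s.ivar 7 from run_ivar _ _ rfl,
      show s1.ivar 2 = s.ivar 2 from run_ivar _ _ rfl, h7, h2, a2, zero_add] at this
    exact this
  have a4 : ∀ x ∈ [1, 2, 4, 5, 6, 7], s5.ivar x = s2.ivar x := by
    intro x hx
    fin_cases hx <;> exact ((run_ivar _ _ rfl).trans (run_ivar _ _ rfl)).trans (run_ivar _ _ rfl)
  have a5 : s2.ivar 6 = k * numStates k := (run_ivar _ _ rfl).trans a2
  have b4 : ∀ j < numBits k, s3.iarr 4 j = j * numStates k := by
    have := run_multiples (a := 4) (y := 5) (b := 4) s2 (by decide) (by decide) (by decide)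
    rw [a1 4 (by simp), h4, a1 5 (by simp), h5] at this
    exact this
  have b5 : ∀ c < k, s4.iarr 5 c = c * (2 ^ k * (k * numStates k)) := by
    have := run_multiples (a := 5) (y := 7) (b := 1) s3 (by decide) (by decide) (by decide)
    rw [run_ivar (x := 1) _ _ rfl, run_ivar (x := 7) _ _ rfl, a3, a1 1 (by simp), h1] at this
    exact this
  have b6 : ∀ A < 2 ^ k, s5.iarr 6 A = A * (k * numStates k) := by
    have := run_multiples (a := 6) (y := 6) (b := 2) s4 (by decide) (by decide) (by decide)
    rw [run_ivar (x := 6) _ _ rfl, run_ivar (x := 6) _ _ rfl, a5, run_ivar (x := 2) _ _ rfl,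
      run_ivar (x := 2) _ _ rfl, a1 2 (by simp), h2] at this
    exact this
  have c1 : ∀ x < numStates k, s6.iarr 1 x = x / 2 ∧ s6.iarr 2 x = x % 2 := by
    have := run_halves s5
    rw [a4 5 (by simp), a1 5 (by simp), h5] at this
    exact this
  have c2 : s6.iarr 4 = s3.iarr 4 :=
    ((run_iarr _ _ rfl).trans (run_iarr _ _ rfl)).trans (run_iarr _ _ rfl)
  have c3 : ∀ x ∈ [1, 2, 4, 5], s6.ivar x = s.ivar x := by
    intro x hx
    refine (run_ivar _ _ ?_).trans ((a4 x ?_).trans (a1 x hx)) <;>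
      fin_cases hx <;> first | rfl | simp
  have c4 := run_bitTable s6 ((c3 4 (by simp)).trans h4) ((c3 5 (by simp)).trans h5) c1
    (by rw [c2]; exact b4)
  have c5 : ∀ x ∈ [1, 2, 5], s7.ivar x = s.ivar x := by
    intro x hx
    refine (run_ivar _ _ ?_).trans (c3 x ?_) <;> fin_cases hx <;> first | rfl | simp
  have f4 : s7.iarr 4 = s3.iarr 4 := (run_iarr _ _ rfl).trans c2
  have f5 : s7.iarr 5 = s4.iarr 5 :=
    ((run_iarr _ _ rfl).trans (run_iarr _ _ rfl)).trans (run_iarr _ _ rfl)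
  have f6 : s7.iarr 6 = s5.iarr 6 := (run_iarr _ _ rfl).trans (run_iarr _ _ rfl)
  have f7 : s7.iarr 7 = s.iarr 7 := by
    refine (run_iarr _ _ rfl).trans ((run_iarr _ _ rfl).trans ((run_iarr _ _ rfl).trans
      ((run_iarr _ _ rfl).trans ((run_iarr _ _ rfl).trans ((run_iarr _ _ rfl).trans
      (run_iarr _ _ rfl))))))
  rw [e]
  refine ⟨⟨(c5 1 (by simp)).trans h1, (c5 2 (by simp)).trans h2, (c5 5 (by simp)).trans h5,
    ?_, ?_, ?_, ?_⟩, ?_⟩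
  · simpa [f4] using b4
  · simpa [f5] using b5
  · simpa [f6] using b6
  · simpa using c4
  · intro x
    simp [f7]

/-- The state after the tables have been computed. -/
noncomputable def setupState (s : State) : State :=
  setupTables.run ((powTwo 5 4).run (setupSizes.run ((powTwo 2 1).run s)))

theorem setup_sizes {k : ℕ} (s : State) (h1 : s.ivar 1 = k) (h3 : s.ivar 3 = 0)
    (h4 : s.ivar 4 = 0) :
    (setupSizes.run ((powTwo 2 1).run s)).ivar 4 = numBits k := by
  let s1 := (powTwo 2 1).run s
  let s2 := (addTimes 3 1 1).run s1
  have e1 : s1.ivar 2 = 2 ^ k := by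
    have := run_powTwo (x := 2) (b := 1) s (by decide) (by decide)
    rwa [h1] at this
  have e2 : s2.ivar 3 = k * k := by
    have := run_addTimes (x := 3) (y := 1) (b := 1) s1 (by decide) (by decide) (by decide)
    rw [show s1.ivar 3 = s.ivar 3 from run_ivar _ _ rfl,
      show s1.ivar 1 = s.ivar 1 from run_ivar _ _ rfl, h1, h3, zero_add] at this
    exact this
  have := run_addTimes (x := 4) (y := 3) (b := 2) s2 (by decide) (by decide) (by decide)
  rw [e2, show s2.ivar 4 = s1.ivar 4 from run_ivar _ _ rfl,
    show s1.ivar 4 = s.ivar 4 from run_ivar _ _ rfl,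
    show s2.ivar 2 = s1.ivar 2 from run_ivar _ _ rfl, h4, e1, zero_add] at this
  exact this.trans (by rw [numBits]; ring)

theorem setupState_spec {k : ℕ} (s : State) (h1 : s.ivar 1 = k) (h3 : s.ivar 3 = 0)
    (h4 : s.ivar 4 = 0) (h6 : s.ivar 6 = 0) (h7 : s.ivar 7 = 0) :
    Tables k (setupState s) ∧
      ∀ x, (setupState s).iarr 7 x = if x = 0 then 1 else s.iarr 7 x := by
  have e4 := setup_sizes s h1 h3 h4
  have e1 : ((powTwo 2 1).run s).ivar 2 = 2 ^ k := by
    have := run_powTwo (x := 2) (b := 1) s (by decide) (by decide)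
    rwa [h1] at this
  rw [setupState]
  obtain ⟨s1, hs1⟩ : ∃ t, t = (powTwo 2 1).run s := ⟨_, rfl⟩
  rw [← hs1] at e1 e4 ⊢
  obtain ⟨s2, hs2⟩ : ∃ t, t = setupSizes.run s1 := ⟨_, rfl⟩
  rw [← hs2] at e4 ⊢
  obtain ⟨s3, hs3⟩ : ∃ t, t = (powTwo 5 4).run s2 := ⟨_, rfl⟩
  rw [← hs3]
  have e5 : s3.ivar 5 = numStates k := by
    have := run_powTwo (x := 5) (b := 4) s2 (by decide) (by decide)
    rwa [e4, ← hs3] at this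
  have keep : ∀ x ∈ [1, 6, 7], s3.ivar x = s.ivar x := by
    intro x hx
    rw [hs3, run_ivar, hs2, run_ivar, hs1, run_ivar] <;> fin_cases hx <;> rfl
  have e7 : s3.iarr 7 = s.iarr 7 := by
    rw [hs3, run_iarr _ _ rfl, hs2, run_iarr _ _ rfl, hs1, run_iarr _ _ rfl]
  have e2 : s3.ivar 2 = s1.ivar 2 := by rw [hs3, run_ivar _ _ rfl, hs2, run_ivar _ _ rfl]
  have e4' : s3.ivar 4 = s2.ivar 4 := by rw [hs3, run_ivar _ _ rfl]
  rw [← e7]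
  exact run_setupTables s3 ((keep 1 (by simp)).trans h1) (e2.trans e1)
    (e4'.trans e4) e5 ((keep 6 (by simp)).trans h6) ((keep 7 (by simp)).trans h7)

/-! ### Numbers with given binary digits -/

/-- The number with the binary digits `g 0`, …, `g (m - 1)`. -/
def bitSum (g : ℕ → Bool) : ℕ → ℕ
  | 0 => 0
  | j + 1 => (if g j then 2 ^ j else 0) + bitSum g j

theorem bitSum_lt (g : ℕ → Bool) (m : ℕ) : bitSum g m < 2 ^ m := by
  induction m with
  | zero => simp [bitSum]
  | succ m ih =>
    rw [bitSum, pow_succ]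
    split_ifs <;> omega

theorem testBit_bitSum (g : ℕ → Bool) {m j : ℕ} (h : j < m) : (bitSum g m).testBit j = g j := by
  induction m with
  | zero => omega
  | succ m ih =>
    have h1 := bitSum_lt g m
    rw [bitSum]
    by_cases e : j = m
    · subst e
      cases h2 : g j
      · simpa using Nat.testBit_lt_two_pow h1
      · simp [Nat.testBit_two_pow_add_eq, Nat.testBit_lt_two_pow h1]
    · have h3 : j < m := by omega
      cases h2 : g m
      · simpa using ih h3
      · simpa [Nat.testBit_two_pow_add_gt h3] using ih h3

theorem eq_of_testBit_eq_of_lt {k x y : ℕ} (hx : x < 2 ^ k) (hy : y < 2 ^ k)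
    (h : ∀ b < k, x.testBit b = y.testBit b) : x = y := by
  refine Nat.eq_of_testBit_eq fun b => ?_
  by_cases hb : b < k
  · exact h b hb
  · have : 2 ^ k ≤ 2 ^ b := Nat.pow_le_pow_right (by omega) (by omega)
    rw [Nat.testBit_lt_two_pow (hx.trans_le this), Nat.testBit_lt_two_pow (hy.trans_le this)]

theorem labelIndex_lt {k c A b : ℕ} (hc : c < k) (hA : A < 2 ^ k) (hb : b < k) :
    c * (2 ^ k * k) + A * k + b < numBits k := by
  have h1 : (A + 1) * k ≤ 2 ^ k * k := Nat.mul_le_mul_right _ hA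
  have h2 : (c + 1) * (2 ^ k * k) ≤ k * (2 ^ k * k) := Nat.mul_le_mul_right _ hc
  have h3 : numBits k = k * (2 ^ k * k) := by rw [numBits]; ring
  rw [Nat.succ_mul] at h1 h2
  omega

/-- Every choice of connections is described by a state. -/
theorem exists_state (k : ℕ) (r : ℕ → Setoid ℕ) :
    ∃ t < numStates k, ∀ c < k, ∀ A < 2 ^ k, ∀ A' < 2 ^ k,
      (SameLabel k t c A A' ↔ (r c).r A A') := by
  classical
  -- The label of a color is the chosen representative of its class. It is itself a color below
  -- $2^k$, which is why $k$ bits are enough.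
  have rep : ∀ c, ∃ f : ℕ → ℕ, ∀ A < 2 ^ k, f A < 2 ^ k ∧
      ∀ A' < 2 ^ k, (f A = f A' ↔ (r c).r A A') := by
    intro c
    let S : Setoid (Fin (2 ^ k)) := (r c).comap Fin.val
    refine ⟨fun A => if h : A < 2 ^ k then (Quotient.out (Quotient.mk S ⟨A, h⟩)).val else 0, ?_⟩
    intro A hA
    refine ⟨by simp [hA], fun A' hA' => ?_⟩
    simp only [hA, hA', dif_pos, Fin.val_inj, Quotient.out_inj]
    exact Quotient.eq (r := S)
  choose f hf using rep
  -- Quotients and remainders recover `c`, `A` and `b` from the index `c * (2 ^ k * k) + A * k + b`.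
  let g : ℕ → Bool := fun j => (f (j / (2 ^ k * k)) (j / k % 2 ^ k)).testBit (j % k)
  refine ⟨bitSum g (numBits k), bitSum_lt _ _, ?_⟩
  intro c hc A hA A' hA'
  have hg : ∀ A < 2 ^ k, ∀ b < k, (bitSum g (numBits k)).testBit
      (c * (2 ^ k * k) + A * k + b) = (f c A).testBit b := by
    intro A hA b hb
    rw [testBit_bitSum g (labelIndex_lt hc hA hb)]
    have h1 : (c * (2 ^ k * k) + A * k + b) / k = c * 2 ^ k + A := by
      rw [show c * (2 ^ k * k) + A * k + b = b + k * (c * 2 ^ k + A) by ring,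
        Nat.add_mul_div_left _ _ (by omega), Nat.div_eq_of_lt hb, zero_add]
    have h2 : (c * (2 ^ k * k) + A * k + b) % k = b := by
      rw [show c * (2 ^ k * k) + A * k + b = b + k * (c * 2 ^ k + A) by ring,
        Nat.add_mul_mod_self_left, Nat.mod_eq_of_lt hb]
    have h3 : (c * (2 ^ k * k) + A * k + b) / (2 ^ k * k) = c := by
      rw [mul_comm (2 ^ k) k, ← Nat.div_div_eq_div_mul, mul_comm k (2 ^ k), h1, mul_comm c,
        add_comm, Nat.add_mul_div_left _ _ (by positivity), Nat.div_eq_of_lt hA, zero_add]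
    have h4 : (c * 2 ^ k + A) % 2 ^ k = A := by
      rw [mul_comm c, add_comm, Nat.add_mul_mod_self_left, Nat.mod_eq_of_lt hA]
    simp only [g, h1, h2, h3, h4]
  rw [← (hf c A hA).2 A' hA']
  constructor
  · intro h
    refine eq_of_testBit_eq_of_lt (hf c A hA).1 (hf c A' hA').1 fun b hb => ?_
    rw [← hg A hA b hb, ← hg A' hA' b hb]
    exact h b hb
  · intro h b hb
    rw [hg A hA b hb, hg A' hA' b hb, h]

theorem SameLabel.symm {k s c A A' : ℕ} (h : SameLabel k s c A A') : SameLabel k s c A' A :=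
  fun b hb => (h b hb).symm

theorem two_pow_le_numBits {k : ℕ} (hk : 1 ≤ k) : 2 ^ k ≤ numBits k :=
  Nat.le_mul_of_pos_left _ (by positivity)

theorem numBits_lt_numStates (k : ℕ) : numBits k < numStates k := Nat.lt_two_pow_self

/-- The time bounds of the compiler need a base of at least `4`. -/
theorem four_le_numStates {k : ℕ} (hk : 1 ≤ k) : 4 ≤ numStates k := by
  have h1 : 2 ^ 1 ≤ 2 ^ k := Nat.pow_le_pow_right (by omega) hk
  have h2 := two_pow_le_numBits hk
  exact Nat.pow_le_pow_right (n := 2) (i := 2) (by omega) (by omega)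

theorem le_numBits {k : ℕ} (hk : 1 ≤ k) : k ≤ numBits k :=
  Nat.lt_two_pow_self.le.trans (two_pow_le_numBits hk)

/-! ### Conditions about states -/

/-- The bit of the variable `x` with the index in the variable `y` is set. -/
def bitTest (x y : ℕ) : BExpr := .eq (.arr 3 (.add (.arr 4 (.var y)) (.var x))) (.const 1)

/-- The color in the variable `x` has been seen. -/
def seenTest (x : ℕ) : BExpr := .eq (.arr 9 (.var x)) (.const 1)

/-- The position of a bit of a label in the table of bits. -/
def labelBit (s c A b : ℕ) : IExpr :=
  .arr 3 (.add (.add (.add (.arr 5 (.var c)) (.arr 6 (.var A))) (.arr 4 (.var b))) (.var s))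

/-- Two colors have the same label; the bound variable is `d`. -/
def labelTest (d s c A A' : ℕ) : BExpr := .all d 1 (.eq (labelBit s c A d) (labelBit s c A' d))

theorem holds_bitTest {k : ℕ} {σ : State} (h : Tables k σ) {x y : ℕ}
    (hx : σ.ivar x < numStates k) (hy : σ.ivar y < numBits k) :
    (bitTest x y).Holds σ ↔ (σ.ivar x).testBit (σ.ivar y) = true := by
  simp only [bitTest, BExpr.Holds, IExpr.eval, h.bit_offset _ hy, h.bits _ hy _ hx]
  cases (σ.ivar x).testBit (σ.ivar y) <;> simp

/-- The three offsets and the state add up to (index of the bit) times `numStates k` plus the state,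
the address in the table of bits. Thus no multiplication is needed at run time. -/
theorem eval_labelBit {k : ℕ} {σ : State} (h : Tables k σ) {s c A b : ℕ}
    (hs : σ.ivar s < numStates k) (hc : σ.ivar c < k) (hA : σ.ivar A < 2 ^ k)
    (hb : σ.ivar b < k) :
    (labelBit s c A b).eval σ =
      ((σ.ivar s).testBit (σ.ivar c * (2 ^ k * k) + σ.ivar A * k + σ.ivar b)).toNat := by
  simp only [labelBit, IExpr.eval]
  rw [h.primary_offset _ hc, h.color_offset _ hA,
    h.bit_offset _ (hb.trans_le (le_numBits (by omega))), ← h.bits _ (labelIndex_lt hc hA hb) _ hs]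
  congr 1
  ring

theorem holds_labelTest {k : ℕ} {σ : State} (h : Tables k σ) {d s c A A' : ℕ} (hd : 10 ≤ d)
    (hs : σ.ivar s < numStates k) (hc : σ.ivar c < k) (hA : σ.ivar A < 2 ^ k)
    (hA' : σ.ivar A' < 2 ^ k) (ds : s ≠ d) (dc : c ≠ d) (dA : A ≠ d) (dA' : A' ≠ d) :
    (labelTest d s c A A').Holds σ ↔
      SameLabel k (σ.ivar s) (σ.ivar c) (σ.ivar A) (σ.ivar A') := by
  rw [labelTest, BExpr.holds_all, h.ivar_one]
  refine forall₂_congr fun b hb => ?_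
  have e : ∀ x, x ≠ d → (σ.setI d b).ivar x = σ.ivar x := fun x hx => State.setI_ivar_ne _ _ hx
  have eb : (σ.setI d b).ivar d = b := State.setI_ivar_self _ _ _
  rw [BExpr.Holds, eval_labelBit (h.setI hd b) (by rwa [e s ds]) (by rwa [e c dc])
    (by rwa [e A dA]) (by rwa [eb]), eval_labelBit (h.setI hd b) (by rwa [e s ds])
    (by rwa [e c dc]) (by rwa [e A' dA']) (by rwa [eb]), e s ds, e c dc, e A dA, e A' dA', eb]
  generalize Nat.testBit _ _ = p
  generalize Nat.testBit _ _ = q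
  cases p <;> cases q <;> simp

/-- The color in the variable `A` is connected in the primary color `c` to the new vertex. -/
def touchedTest (d c A : ℕ) : BExpr :=
  .ex d 2 (.and (bitTest 22 d) (.and (seenTest d) (.and (bitTest d c)
    (labelTest (d + 1) 21 c d A))))

/-- The test for the transition from the state in variable `21` to the state in variable `23`, with
edges to the colors in variable `22`. -/
def checkTest : BExpr :=
  .and (.imp (seenTest 9) (.all 30 1 (.imp (bitTest 9 30) (.or (touchedTest 31 30 9)
      (.ex 31 2 (.and (.not (.eq (.var 31) (.var 9))) (.and (seenTest 31)
        (.and (bitTest 31 30) (labelTest 32 21 30 31 9)))))))))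
    (.all 30 1 (.all 31 2 (.imp (bitTest 31 30) (.imp (.or (seenTest 31) (.eq (.var 31) (.var 9)))
      (.all 32 2 (.imp (bitTest 32 30) (.imp (.or (seenTest 32) (.eq (.var 32) (.var 9)))
        (.imp (labelTest 33 23 30 31 32)
          (.or (.and (bitTest 9 30) (.and (.or (.eq (.var 31) (.var 9)) (touchedTest 33 30 31))
              (.or (.eq (.var 32) (.var 9)) (touchedTest 33 30 32))))
            (.and (.not (.eq (.var 31) (.var 9))) (.and (.not (.eq (.var 32) (.var 9)))
              (labelTest 33 21 30 31 32))))))))))))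

theorem lt_numStates_of_lt {k A : ℕ} (hk : 1 ≤ k) (hA : A < 2 ^ k) : A < numStates k :=
  (hA.trans_le (two_pow_le_numBits hk)).trans (numBits_lt_numStates k)

theorem holds_touchedTest {k : ℕ} (hk : 1 ≤ k) {σ : State} (h : Tables k σ) {d c A : ℕ}
    (hd : 30 ≤ d) (h21 : σ.ivar 21 < numStates k) (h22 : σ.ivar 22 < numStates k)
    (hc : σ.ivar c < k) (hA : σ.ivar A < 2 ^ k) (hcd : c < d) (hAd : A < d) :
    (touchedTest d c A).Holds σ ↔ Touched (2 ^ k) (fun A => σ.iarr 9 A = 1)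
      (fun A => (σ.ivar 22).testBit A = true) (SameLabel k (σ.ivar 21)) (σ.ivar c)
      (σ.ivar A) := by
  rw [touchedTest, BExpr.Holds, h.ivar_two]
  refine exists_congr fun v => and_congr_right fun hv => ?_
  have h' := h.setI (x := d) (by omega) v
  have e : ∀ x, x < d → (σ.setI d v).ivar x = σ.ivar x :=
    fun x hx => State.setI_ivar_ne _ _ (by omega)
  have ed : (σ.setI d v).ivar d = v := State.setI_ivar_self _ _ _
  have hv1 := hv.trans_le (two_pow_le_numBits hk)
  have hc1 := hc.trans_le (le_numBits hk)
  simp only [BExpr.Holds]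
  rw [holds_bitTest h' (by rwa [e 22 (by omega)]) (by rwa [ed]), holds_bitTest h'
    (by rw [ed]; exact lt_numStates_of_lt hk hv) (by rwa [e c hcd]), holds_labelTest h' (by omega)
    (by rwa [e 21 (by omega)]) (by rwa [e c hcd]) (by rwa [ed]) (by rwa [e A hAd]) (by omega)
    (by omega) (by omega) (by omega), e 22 (by omega), e 21 (by omega), e c hcd, e A hAd, ed]
  simp only [seenTest, BExpr.Holds, IExpr.eval, ed, State.setI_iarr]

/-- The condition copies `Check` quantifier by quantifier, with variable `30` for the primary color
and `31`, `32` for the full colors. The proof mainly checks that all table accesses are in range. -/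
theorem holds_checkTest {k : ℕ} (hk : 1 ≤ k) {σ : State} (h : Tables k σ)
    (h9 : σ.ivar 9 < 2 ^ k) (h21 : σ.ivar 21 < numStates k) (h22 : σ.ivar 22 < numStates k)
    (h23 : σ.ivar 23 < numStates k) :
    checkTest.Holds σ ↔ Check k (2 ^ k) (fun A => σ.iarr 9 A = 1) (σ.ivar 9)
      (fun A => (σ.ivar 22).testBit A = true) (SameLabel k (σ.ivar 21))
      (SameLabel k (σ.ivar 23)) := by
  have h9' := lt_numStates_of_lt hk h9
  rw [checkTest, BExpr.Holds, Check]
  refine and_congr ?_ ?_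
  · rw [BExpr.holds_imp, BExpr.holds_all, h.ivar_one]
    refine imp_congr Iff.rfl (forall₂_congr fun c hc => ?_)
    have hc' := hc.trans_le (le_numBits hk)
    have hs := h.setI (x := 30) (by omega) c
    rw [BExpr.holds_imp, BExpr.holds_or, holds_bitTest hs (by simpa) (by simpa),
      holds_touchedTest hk hs (by omega) (by simpa) (by simpa) (by simpa) (by simpa) (by omega)
        (by omega), BExpr.Holds]
    simp only [State.setI_iarr, State.setI_ivar, if_true, Nat.reduceEqDiff, if_false,
      h.ivar_two]
    refine imp_congr Iff.rfl (or_congr Iff.rfl (exists_congr fun A => and_congr_right fun hA => ?_))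
    have hs' := hs.setI (x := 31) (by omega) A
    have hA' := lt_numStates_of_lt hk hA
    simp only [BExpr.Holds]
    rw [holds_bitTest hs' (by simpa) (by simpa), holds_labelTest hs' (by omega) (by simpa)
      (by simpa) (by simpa) (by simpa) (by omega) (by omega) (by omega) (by omega)]
    simp [seenTest, BExpr.Holds, IExpr.eval]
  · rw [BExpr.holds_all, h.ivar_one]
    refine forall₂_congr fun c hc => ?_
    have hc' := hc.trans_le (le_numBits hk)
    have hs := h.setI (x := 30) (by omega) c
    rw [BExpr.holds_all, hs.ivar_two]
    refine forall₂_congr fun A hA => ?_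
    have hs := hs.setI (x := 31) (by omega) A
    have hAN := lt_numStates_of_lt hk hA
    rw [BExpr.holds_imp, BExpr.holds_imp, BExpr.holds_or, BExpr.holds_all, hs.ivar_two,
      holds_bitTest hs (by simpa) (by simpa)]
    refine imp_congr (by simp) (imp_congr (by simp [seenTest, BExpr.Holds, IExpr.eval])
      (forall₂_congr fun A' hA' => ?_))
    have hs := hs.setI (x := 32) (by omega) A'
    have hAN' := lt_numStates_of_lt hk hA'
    simp only [BExpr.holds_imp, BExpr.holds_or, BExpr.Holds]
    rw [holds_bitTest hs (by simpa) (by simpa), holds_bitTest hs (by simpa) (by simpa),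
      holds_labelTest hs (by omega) (by simpa) (by simpa) (by simpa) (by simpa) (by omega)
        (by omega) (by omega) (by omega),
      holds_labelTest hs (by omega) (by simpa) (by simpa) (by simpa) (by simpa) (by omega)
        (by omega) (by omega) (by omega),
      holds_touchedTest hk hs (by omega) (by simpa) (by simpa) (by simpa) (by simpa) (by omega)
        (by omega),
      holds_touchedTest hk hs (by omega) (by simpa) (by simpa) (by simpa) (by simpa) (by omega)
        (by omega)]
    simp [seenTest, BExpr.Holds, IExpr.eval]

/-- The final test for the state in variable `21`: all colors are connected. -/
def finalTest : BExpr :=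
  .all 30 1 (.all 31 2 (.imp (seenTest 31) (.imp (bitTest 31 30)
    (.all 32 2 (.imp (seenTest 32) (.imp (bitTest 32 30) (labelTest 33 21 30 31 32)))))))

theorem holds_finalTest {k : ℕ} (hk : 1 ≤ k) {σ : State} (h : Tables k σ)
    (h21 : σ.ivar 21 < numStates k) :
    finalTest.Holds σ ↔ ∀ c < k, ∀ A < 2 ^ k, σ.iarr 9 A = 1 → A.testBit c = true →
      ∀ A' < 2 ^ k, σ.iarr 9 A' = 1 → A'.testBit c = true →
        SameLabel k (σ.ivar 21) c A A' := by
  rw [finalTest, BExpr.holds_all, h.ivar_one]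
  refine forall₂_congr fun c hc => ?_
  have hc' := hc.trans_le (le_numBits hk)
  have hs := h.setI (x := 30) (by omega) c
  rw [BExpr.holds_all, hs.ivar_two]
  refine forall₂_congr fun A hA => ?_
  have hs := hs.setI (x := 31) (by omega) A
  have hAN := lt_numStates_of_lt hk hA
  rw [BExpr.holds_imp, BExpr.holds_imp, BExpr.holds_all, hs.ivar_two,
    holds_bitTest hs (by simpa) (by simpa)]
  refine imp_congr (by simp [seenTest, BExpr.Holds, IExpr.eval]) (imp_congr (by simp)
    (forall₂_congr fun A' hA' => ?_))
  have hs := hs.setI (x := 32) (by omega) A'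
  have hAN' := lt_numStates_of_lt hk hA'
  simp only [BExpr.holds_imp]
  rw [holds_bitTest hs (by simpa) (by simpa),
    holds_labelTest hs (by omega) (by simpa) (by simpa) (by simpa) (by simpa) (by omega)
      (by omega) (by omega) (by omega)]
  simp [seenTest, BExpr.Holds, IExpr.eval]

/-! ### One step of the dynamic program -/

/-- The state `τ` differs from `σ` only in the variables and arrays for the new costs. -/
structure Same (σ τ : State) : Prop where
  ivar : ∀ x ∈ [1, 2, 5, 9], τ.ivar x = σ.ivar x
  iarr : ∀ a ∈ [3, 4, 5, 6, 7, 9], τ.iarr a = σ.iarr a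
  rarr : ∀ a ∈ [4, 6], τ.rarr a = σ.rarr a

theorem Same.refl (σ : State) : Same σ σ := ⟨fun _ _ => rfl, fun _ _ => rfl, fun _ _ => rfl⟩

/-- The command changes only the variables and arrays for the new costs. -/
def keepsSame (c : Cmd) : Bool :=
  [1, 2, 5, 9].all (fun x => c.keepsI x) && [3, 4, 5, 6, 7, 9].all (fun a => c.keepsIArr a) &&
    [4, 6].all (fun a => c.keepsRArr a)

theorem Same.run {σ τ : State} (h : Same σ τ) {c : Cmd} (hc : keepsSame c = true) :
    Same σ (c.run τ) := by
  simp only [keepsSame, Bool.and_eq_true, List.all_eq_true] at hc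
  exact ⟨fun x hx => (run_ivar c τ (hc.1.1 x hx)).trans (h.ivar x hx),
    fun a ha => (run_iarr c τ (hc.1.2 a ha)).trans (h.iarr a ha),
    fun a ha => (run_rarr c τ (hc.2 a ha)).trans (h.rarr a ha)⟩

theorem Same.setI {σ τ : State} (h : Same σ τ) {x : ℕ} (hx : 10 ≤ x) (v : ℕ) :
    Same σ (τ.setI x v) := by
  refine ⟨fun y hy => ?_, h.iarr, h.rarr⟩
  rw [State.setI_ivar_ne, h.ivar y hy]
  simp only [List.mem_cons, List.not_mem_nil, or_false] at hy
  omega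

theorem Same.tables {k : ℕ} {σ τ : State} (h : Same σ τ) (hσ : Tables k σ) : Tables k τ :=
  hσ.of_eq (h.ivar 1 (by simp)) (h.ivar 2 (by simp)) (h.ivar 5 (by simp)) (h.iarr 3 (by simp))
    (h.iarr 4 (by simp)) (h.iarr 5 (by simp)) (h.iarr 6 (by simp))

/-! ### Relaxation of the transitions -/

/-- The cost of the edges to the colors in `q`. -/
noncomputable def weight (k : ℕ) (σ : State) (q : ℕ) : ℝ :=
  ∑ A ∈ Finset.range (2 ^ k), if q.testBit A = true ∧ σ.iarr 9 A = 1 then σ.rarr 6 A else 0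

/-- Put the cost of the edges to the colors in variable `22` into the real variable `5`. -/
def computeWeight : Cmd :=
  block [real (.rconst 5 0), .for 24 2 (.ite (.and (bitTest 22 24) (seenTest 24))
    (block [rload 6 6 (.var 24), real (.radd 5 5 6)]) skip)]

theorem run_computeWeight {k : ℕ} (hk : 1 ≤ k) {σ : State} (h : Tables k σ)
    (h22 : σ.ivar 22 < numStates k) :
    (computeWeight.run σ).rvar 5 = weight k σ (σ.ivar 22) := by
  have := run_for (x := 24) (y := 2) (s := σ.setR 5 0)
    (c := .ite (.and (bitTest 22 24) (seenTest 24))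
    (block [rload 6 6 (.var 24), real (.radd 5 5 6)]) skip)
    (fun j t => Same σ t ∧ t.ivar 22 = σ.ivar 22 ∧ t.rvar 5 = ∑ A ∈ Finset.range j,
      if (σ.ivar 22).testBit A = true ∧ σ.iarr 9 A = 1 then σ.rarr 6 A else 0) ?_ ?_ ?_
  · have h2 := this.2.2
    rw [State.setR_ivar, h.ivar_two] at h2
    simpa [computeWeight, block, Cmd.run, Instr.run, weight] using h2
  · rintro j t ⟨h1, h2, h3⟩
    exact ⟨h1.setI (by omega) _, by simpa using h2, by simpa using h3⟩
  · exact ⟨⟨fun _ _ => rfl, fun _ _ => rfl, fun _ _ => rfl⟩, rfl, by simp⟩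
  · rintro j hj t ⟨h1, h2, h3⟩
    rw [State.setR_ivar, h.ivar_two] at hj
    have h1' := h1.setI (x := 24) (by omega) j
    have hb : BExpr.Holds (.and (bitTest 22 24) (seenTest 24)) (t.setI 24 j) ↔
        ((σ.ivar 22).testBit j = true ∧ σ.iarr 9 j = 1) := by
      rw [BExpr.Holds, holds_bitTest (h1'.tables h) (by simpa [h2])
        (by simpa using hj.trans_le (two_pow_le_numBits hk))]
      simp [h2, seenTest, BExpr.Holds, IExpr.eval, h1.iarr 9]
    refine ⟨h1'.run rfl, (run_ivar _ _ rfl).trans (by simpa using h2), ?_⟩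
    rw [Finset.sum_range_succ, ← h3]
    by_cases c : (σ.ivar 22).testBit j = true ∧ σ.iarr 9 j = 1
    · rw [Cmd.run, if_pos (hb.2 c), if_pos c]
      simp [block, Cmd.run, Instr.run, IExpr.eval, h1.rarr 6]
    · rw [Cmd.run, if_neg (fun h => c (hb.1 h)), if_neg c]
      simp [Cmd.run]

/-- The costs in the real array `5` are those of the transitions in `P`. -/
structure Relaxed (N : ℕ) (K : ℕ → ℕ → ℕ → Prop) (cost : ℕ → ℕ → ℝ) (P : ℕ → ℕ → ℕ → Prop)
    (τ : State) : Prop where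
  attained : ∀ t < N, τ.iarr 8 t = 1 → ∃ q < N, ∃ s < N, K q s t ∧ τ.rarr 5 t = cost q s
  le_cost : ∀ q < N, ∀ s < N, ∀ t < N, P q s t → K q s t →
    τ.iarr 8 t = 1 ∧ τ.rarr 5 t ≤ cost q s

theorem Relaxed.congr {N : ℕ} {K P P' : ℕ → ℕ → ℕ → Prop} {cost : ℕ → ℕ → ℝ} {τ τ' : State}
    (h : Relaxed N K cost P τ) (h8 : τ'.iarr 8 = τ.iarr 8) (h5 : τ'.rarr 5 = τ.rarr 5)
    (hP : ∀ q < N, ∀ s < N, ∀ t < N, P' q s t → P q s t) : Relaxed N K cost P' τ' := by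
  obtain ⟨h1, h2⟩ := h
  rw [← h8, ← h5] at h1 h2
  exact ⟨h1, fun q hq s hs t ht h => h2 q hq s hs t ht (hP q hq s hs t ht h)⟩

/-- Compare the cost of a transition with the cost that has been found so far. -/
def relax : Cmd :=
  .ite (.and (.eq (.arr 7 (.var 21)) (.const 1)) checkTest)
    (block [rload 6 4 (.var 21), real (.radd 6 6 5), rload 7 5 (.var 23),
      .ite (.or (.not (.eq (.arr 8 (.var 23)) (.const 1))) (.rlt 6 7))
        (block [rstore 5 (.var 23) 6, store 8 (.var 23) (.const 1)]) skip]) skip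

/-- The usual relaxation step: an entry is only replaced by the cost of an admissible transition,
and only if it is unset or larger. Hence it stays attained and becomes a lower bound for one more
triple. -/
theorem run_relax {N : ℕ} {K P : ℕ → ℕ → ℕ → Prop} {cost : ℕ → ℕ → ℝ} {τ : State} {q s t : ℕ}
    (h : Relaxed N K cost P τ) (hq : q < N) (hs : s < N) (ht : t < N) (h21 : τ.ivar 21 = s)
    (h23 : τ.ivar 23 = t) (hcost : τ.rarr 4 s + τ.rvar 5 = cost q s)
    (hK : BExpr.Holds (.and (.eq (.arr 7 (.var 21)) (.const 1)) checkTest) τ ↔ K q s t) :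
    Relaxed N K cost (fun q' s' t' => P q' s' t' ∨ (q' = q ∧ s' = s ∧ t' = t)) (relax.run τ) := by
  by_cases c : K q s t
  · rw [relax, Cmd.run, if_pos (hK.2 c)]
    -- The flag is tested as well as the cost because the real entry of an unreached state has no
    -- meaning.
    by_cases d : τ.iarr 8 t ≠ 1 ∨ cost q s < τ.rarr 5 t
    · have e : (block [rload 6 4 (.var 21), real (.radd 6 6 5), rload 7 5 (.var 23),
          .ite (.or (.not (.eq (.arr 8 (.var 23)) (.const 1))) (.rlt 6 7))
            (block [rstore 5 (.var 23) 6, store 8 (.var 23) (.const 1)]) skip]).run τ =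
          ((((τ.setR 6 (τ.rarr 4 s)).setR 6 (cost q s)).setR 7 (τ.rarr 5 t)).setRArr 5 t
            (cost q s)).setIArr 8 t 1 := by
        simp only [block, Cmd.run, Instr.run, IExpr.eval, BExpr.holds_or, BExpr.Holds, h21, h23,
          State.setR_rvar, State.setR_ivar, State.setR_iarr, State.setR_rarr, if_true, hcost,
          Nat.reduceEqDiff, if_false]
        rw [if_pos d]
        simp [h23]
      rw [e]
      constructor
      · intro t' ht' h8
        by_cases et : t' = t
        · subst et
          exact ⟨q, hq, s, hs, c, by simp⟩
        · simp only [State.setIArr_iarr, et, if_false, if_true, State.setRArr_iarr,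
            State.setR_iarr] at h8
          simpa [et] using h.attained t' ht' h8
      · intro q' hq' s' hs' t' ht' hP hK'
        by_cases et : t' = t
        · subst et
          refine ⟨by simp, ?_⟩
          simp only [State.setIArr_rarr, State.setRArr_rarr, if_true]
          rcases hP with hP | ⟨rfl, rfl, -⟩
          · have := h.le_cost q' hq' s' hs' t' ht' hP hK'
            rcases d with d | d
            · exact absurd this.1 d
            · exact d.le.trans this.2
          · exact le_rfl
        · have := h.le_cost q' hq' s' hs' t' ht' (hP.resolve_right fun h => et h.2.2) hK'
          simpa [et] using this
    · have e : (block [rload 6 4 (.var 21), real (.radd 6 6 5), rload 7 5 (.var 23),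
          .ite (.or (.not (.eq (.arr 8 (.var 23)) (.const 1))) (.rlt 6 7))
            (block [rstore 5 (.var 23) 6, store 8 (.var 23) (.const 1)]) skip]).run τ =
          (((τ.setR 6 (τ.rarr 4 s)).setR 6 (cost q s)).setR 7 (τ.rarr 5 t)) := by
        simp only [block, Cmd.run, Instr.run, IExpr.eval, BExpr.holds_or, BExpr.Holds, h21, h23,
          State.setR_rvar, State.setR_ivar, State.setR_iarr, State.setR_rarr, if_true, hcost,
          Nat.reduceEqDiff, if_false]
        rw [if_neg d]
      rw [e]
      push Not at d
      constructor
      · exact h.attained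
      · intro q' hq' s' hs' t' ht' hP hK'
        rcases hP with hP | ⟨rfl, rfl, rfl⟩
        · exact h.le_cost q' hq' s' hs' t' ht' hP hK'
        · exact d
  · rw [relax, Cmd.run, if_neg fun h => c (hK.1 h)]
    refine ⟨h.attained, fun q' hq' s' hs' t' ht' hP hK' => ?_⟩
    rcases hP with hP | ⟨rfl, rfl, rfl⟩
    · exact h.le_cost q' hq' s' hs' t' ht' hP hK'
    · exact absurd hK' c

/-- All transitions with edges to the colors in variable `22`. -/
def relaxFor : Cmd := .seq computeWeight (.for 21 5 (.for 23 5 relax))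

/-- The transitions that are possible. -/
def Transition (k : ℕ) (σ : State) (q s t : ℕ) : Prop :=
  σ.iarr 7 s = 1 ∧ Check k (2 ^ k) (fun A => σ.iarr 9 A = 1) (σ.ivar 9)
    (fun A => q.testBit A = true) (SameLabel k s) (SameLabel k t)

theorem holds_transition {k : ℕ} (hk : 1 ≤ k) {σ τ : State} (hσ : Tables k σ)
    (h9 : σ.ivar 9 < 2 ^ k) (h : Same σ τ) {q s t : ℕ} (hq : q < numStates k)
    (hs : s < numStates k) (ht : t < numStates k) (h22 : τ.ivar 22 = q) (h21 : τ.ivar 21 = s)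
    (h23 : τ.ivar 23 = t) :
    BExpr.Holds (.and (.eq (.arr 7 (.var 21)) (.const 1)) checkTest) τ ↔ Transition k σ q s t := by
  subst h22 h21 h23
  have e := h.ivar 9 (by simp)
  rw [BExpr.Holds, holds_checkTest hk (h.tables hσ) (by rwa [e]) hs hq ht, e,
    h.iarr 9 (by simp), Transition]
  simp [BExpr.Holds, IExpr.eval, h.iarr 7]

/-- The triples relaxed so far form an initial segment of the lexicographic order on `(q, s, t)`,
and the two inner loops extend it. The weight of `q` is computed once, before them. -/
theorem run_relaxFor {k : ℕ} (hk : 1 ≤ k) {σ τ : State} (hσ : Tables k σ)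
    (h9 : σ.ivar 9 < 2 ^ k) (h : Same σ τ) {q : ℕ} (hq : q < numStates k) (h22 : τ.ivar 22 = q)
    (hR : Relaxed (numStates k) (Transition k σ) (fun q s => σ.rarr 4 s + weight k σ q)
      (fun q' _ _ => q' < q) τ) :
    Relaxed (numStates k) (Transition k σ) (fun q s => σ.rarr 4 s + weight k σ q)
      (fun q' _ _ => q' < q + 1) (relaxFor.run τ) := by
  have hw := run_computeWeight hk (h.tables hσ) (h22 ▸ hq)
  rw [h22, show weight k τ q = weight k σ q by
    simp only [weight, h.iarr 9 (by simp), h.rarr 6 (by simp)]] at hw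
  have h1 : Same σ (computeWeight.run τ) := h.run rfl
  have h22' : (computeWeight.run τ).ivar 22 = q := (run_ivar _ _ rfl).trans h22
  have hR' := hR.congr (P' := fun q' _ _ => q' < q) (run_iarr computeWeight τ rfl)
    (run_rarr computeWeight τ rfl) (fun _ _ _ _ _ _ h => h)
  rw [relaxFor, Cmd.run]
  generalize computeWeight.run τ = τ at *
  have e5 : τ.ivar 5 = numStates k := (h1.tables hσ).ivar_five
  have main := run_for (x := 21) (y := 5) (s := τ) (c := .for 23 5 relax)
    (fun j t => Same σ t ∧ t.ivar 22 = q ∧ t.rvar 5 = weight k σ q ∧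
      Relaxed (numStates k) (Transition k σ) (fun q s => σ.rarr 4 s + weight k σ q)
        (fun q' s' _ => q' < q ∨ (q' = q ∧ s' < j)) t) ?_ ?_ ?_
  · rw [e5] at main
    refine main.2.2.2.congr rfl rfl fun q' hq' s' hs' t' ht' h => ?_
    omega
  · rintro j t ⟨a1, a2, a3, a4⟩
    exact ⟨a1.setI (by omega) _, by simpa using a2, a3, a4.congr rfl rfl fun _ _ _ _ _ _ h => h⟩
  · exact ⟨h1, h22', hw, hR'.congr rfl rfl fun _ _ _ _ _ _ h => by omega⟩
  · rintro s hs t ⟨a1, a2, a3, a4⟩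
    rw [e5] at hs
    have e5' : (t.setI 21 s).ivar 5 = numStates k :=
      ((a1.setI (x := 21) (by omega) s).tables hσ).ivar_five
    have inner := run_for (x := 23) (y := 5) (s := t.setI 21 s) (c := relax)
      (fun j t => Same σ t ∧ t.ivar 22 = q ∧ t.rvar 5 = weight k σ q ∧ t.ivar 21 = s ∧
        Relaxed (numStates k) (Transition k σ) (fun q s => σ.rarr 4 s + weight k σ q)
          (fun q' s' t' => q' < q ∨ (q' = q ∧ (s' < s ∨ (s' = s ∧ t' < j)))) t) ?_ ?_ ?_
    · rw [e5'] at inner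
      obtain ⟨b1, b2, b3, -, b5⟩ := inner
      refine ⟨b1, b2, b3, b5.congr rfl rfl fun q' hq' s' hs' t' ht' h => ?_⟩
      omega
    · rintro j t ⟨b1, b2, b3, b4, b5⟩
      exact ⟨b1.setI (by omega) _, by simpa using b2, b3, by simpa using b4,
        b5.congr rfl rfl fun _ _ _ _ _ _ h => h⟩
    · refine ⟨a1.setI (by omega) _, by simpa using a2, a3, by simp,
        a4.congr rfl rfl fun _ _ _ _ _ _ h => by omega⟩
    · rintro j hj t ⟨b1, b2, b3, b4, b5⟩
      rw [e5'] at hj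
      have b1' := b1.setI (x := 23) (by omega) j
      refine ⟨b1'.run rfl, (run_ivar _ _ rfl).trans (by simpa using b2),
        (run_rvar _ _ rfl).trans b3, (run_ivar _ _ rfl).trans (by simpa using b4), ?_⟩
      have := run_relax (τ := t.setI 23 j) (b5.congr rfl rfl fun _ _ _ _ _ _ h => h) hq hs hj
        (by simpa using b4) (by simp) ?_ (holds_transition hk hσ h9 b1' hq hs hj
          (by simpa using b2) (by simpa using b4) (by simp))
      · refine this.congr rfl rfl fun q' hq' s' hs' t' ht' h => ?_
        omega
      · simp only [State.setI_rarr, State.setI_rvar, b3, b1.rarr 4 (by simp)]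

/-! ### Reading a point and its distances -/

/-- Put the color of the next point into the variable `9`. -/
def readColor : Cmd :=
  block [assign 9 (.const 0), assign 10 (.const 1),
    .for 25 1 (.seq (.ite (.eq (.arr 0 (.add (.var 8) (.var 25))) (.const 1))
      (assign 9 (.add (.var 9) (.var 10))) skip) (assign 10 (.add (.var 10) (.var 10)))),
    assign 8 (.add (.var 8) (.var 1))]

/-- Variable `10` runs through the powers of two. Variable `8` moves ahead by one row of the input
table, which avoids the product `k * i`. -/
theorem run_readColor (σ : State) :
    (readColor.run σ).ivar 9 =
      bitSum (fun c => decide (σ.iarr 0 (σ.ivar 8 + c) = 1)) (σ.ivar 1) ∧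
    (readColor.run σ).ivar 8 = σ.ivar 8 + σ.ivar 1 := by
  have := run_for (x := 25) (y := 1) (s := (σ.setI 9 0).setI 10 1)
    (c := .seq (.ite (.eq (.arr 0 (.add (.var 8) (.var 25))) (.const 1))
      (assign 9 (.add (.var 9) (.var 10))) skip) (assign 10 (.add (.var 10) (.var 10))))
    (fun j t => t.ivar 9 = bitSum (fun c => decide (σ.iarr 0 (σ.ivar 8 + c) = 1)) j ∧
      t.ivar 10 = 2 ^ j ∧ t.ivar 8 = σ.ivar 8 ∧ t.ivar 1 = σ.ivar 1 ∧ t.iarr 0 = σ.iarr 0)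
    ?_ ?_ ?_
  · obtain ⟨h1, -, h2, h3, -⟩ := this
    refine ⟨?_, ?_⟩
    · simpa [readColor, block, Cmd.run, IExpr.eval] using h1
    · simp only [readColor, block, Cmd.run, IExpr.eval] at h2 h3 ⊢
      rw [State.setI_ivar_self, ← h2, ← h3]
  · rintro j t ⟨h1, h2, h3, h4, h5⟩
    exact ⟨by simpa using h1, by simpa using h2, by simpa using h3, by simpa using h4, h5⟩
  · simp [bitSum]
  · rintro j - t ⟨h1, h2, h3, h4, h5⟩
    refine ⟨?_, ?_, (run_ivar _ _ rfl).trans (by simpa using h3),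
      (run_ivar _ _ rfl).trans (by simpa using h4), (run_iarr _ _ rfl).trans h5⟩
    · by_cases c : σ.iarr 0 (σ.ivar 8 + j) = 1
      · simp [Cmd.run, IExpr.eval, BExpr.Holds, h3, h5, c, bitSum, h1, h2]
        exact add_comm _ _
      · simp [Cmd.run, IExpr.eval, BExpr.Holds, h3, h5, c, bitSum, h1]
    · by_cases c : σ.iarr 0 (σ.ivar 8 + j) = 1
      · simp [Cmd.run, IExpr.eval, BExpr.Holds, h3, h5, c, h2, pow_succ, mul_two]
      · simp [Cmd.run, IExpr.eval, BExpr.Holds, h3, h5, c, h2, pow_succ, mul_two]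

/-- The distance of the point in the real variables `1` and `2` from the last point of color `A`. -/
noncomputable def lastDist (σ : State) (x y : ℝ) (A : ℕ) : ℝ :=
  √((x - σ.rarr 2 A) * (x - σ.rarr 2 A) + (y - σ.rarr 3 A) * (y - σ.rarr 3 A))

/-- Put the distance of the current point from the last point of the color in variable `24` into
the table of distances. -/
def computeDist : Cmd :=
  block [rload 3 2 (.var 24), rload 4 3 (.var 24), real (.rsub 3 1 3), real (.rsub 4 2 4),
    real (.rmul 3 3 3), real (.rmul 4 4 4), real (.radd 3 3 4), real (.rsqrt 3 3),
    rstore 6 (.var 24) 3]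

/-- Load the current point and compute its distances from the last points of the colors. -/
def distances : Cmd :=
  block [rload 1 0 (.var 20), rload 2 1 (.var 20), .for 24 2 computeDist]

theorem run_distances (σ : State) :
    (distances.run σ).rvar 1 = σ.rarr 0 (σ.ivar 20) ∧
    (distances.run σ).rvar 2 = σ.rarr 1 (σ.ivar 20) ∧
    ∀ A < σ.ivar 2, (distances.run σ).rarr 6 A =
      lastDist σ (σ.rarr 0 (σ.ivar 20)) (σ.rarr 1 (σ.ivar 20)) A := by
  have := run_for (x := 24) (y := 2)
    (s := (σ.setR 1 (σ.rarr 0 (σ.ivar 20))).setR 2 (σ.rarr 1 (σ.ivar 20))) (c := computeDist)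
    (fun j t => t.rvar 1 = σ.rarr 0 (σ.ivar 20) ∧ t.rvar 2 = σ.rarr 1 (σ.ivar 20) ∧
      (∀ A < j, t.rarr 6 A = lastDist σ (σ.rarr 0 (σ.ivar 20)) (σ.rarr 1 (σ.ivar 20)) A) ∧
      t.rarr 2 = σ.rarr 2 ∧ t.rarr 3 = σ.rarr 3) ?_ ?_ ?_
  · obtain ⟨h1, h2, h3, -⟩ := this
    exact ⟨h1, h2, h3⟩
  · rintro j t h
    exact h
  · simp
  · rintro j - t ⟨h1, h2, h3, h4, h5⟩
    refine ⟨(run_rvar _ _ rfl).trans h1, (run_rvar _ _ rfl).trans h2, ?_,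
      (run_rarr _ _ rfl).trans h4, (run_rarr _ _ rfl).trans h5⟩
    intro A hA
    by_cases e : A = j
    · subst e
      simp [computeDist, block, Cmd.run, IExpr.eval, Instr.run, h1, h2, h4, h5, lastDist]
    · simpa [computeDist, block, Cmd.run, IExpr.eval, Instr.run, e] using h3 A (by omega)

/-- Compute the new costs. -/
def relaxAll : Cmd :=
  .seq (.for 23 5 (store 8 (.var 23) (.const 0))) (.for 22 5 relaxFor)

/-- Clearing the flags suffices: costs left over from the previous point are never used before they
are overwritten. -/
theorem run_relaxAll {k : ℕ} (hk : 1 ≤ k) {σ : State} (hσ : Tables k σ) (h9 : σ.ivar 9 < 2 ^ k) :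
    Relaxed (numStates k) (Transition k σ) (fun q s => σ.rarr 4 s + weight k σ q)
      (fun _ _ _ => True) (relaxAll.run σ) := by
  have hclear := run_for (x := 23) (y := 5) (s := σ) (c := store 8 (.var 23) (.const 0))
    (fun j t => ∀ x < j, t.iarr 8 x = 0) (fun _ _ h => h) (fun _ h => absurd h (by omega)) (by
      rintro j - t h x hx
      by_cases e : x = j
      · subst e
        simp [Cmd.run, IExpr.eval]
      · simpa [Cmd.run, IExpr.eval, e] using h x (by omega))
  rw [hσ.ivar_five] at hclear
  have h1 : Same σ ((Cmd.for 23 5 (store 8 (.var 23) (.const 0))).run σ) := (Same.refl σ).run rfl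
  rw [relaxAll, Cmd.run]
  generalize (Cmd.for 23 5 (store 8 (.var 23) (.const 0))).run σ = τ at *
  have e5 := (h1.tables hσ).ivar_five
  have main := run_for (x := 22) (y := 5) (s := τ) (c := relaxFor)
    (fun j t => Same σ t ∧ Relaxed (numStates k) (Transition k σ)
      (fun q s => σ.rarr 4 s + weight k σ q) (fun q' _ _ => q' < j) t) ?_ ?_ ?_
  · rw [e5] at main
    exact main.2.congr rfl rfl fun q hq _ _ _ _ _ => hq
  · rintro j t ⟨a1, a2⟩
    exact ⟨a1.setI (by omega) _, a2.congr rfl rfl fun _ _ _ _ _ _ h => h⟩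
  · refine ⟨h1, ?_, ?_⟩
    · intro t ht h
      rw [hclear t ht] at h
      omega
    · intro q _ s _ t _ h
      omega
  · rintro j hj t ⟨a1, a2⟩
    rw [e5] at hj
    have a1' := a1.setI (x := 22) (by omega) j
    exact ⟨a1'.run rfl, run_relaxFor hk hσ h9 a1' hj (by simp)
      (a2.congr rfl rfl fun _ _ _ _ _ _ h => h)⟩

/-! ### Processing one point -/

/-- Replace the old costs by the new ones. -/
def commit : Cmd :=
  .for 23 5 (block [store 7 (.var 23) (.arr 8 (.var 23)), rload 6 5 (.var 23),
    rstore 4 (.var 23) 6])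

theorem run_commit (σ : State) : ∀ t < σ.ivar 5,
    (commit.run σ).iarr 7 t = σ.iarr 8 t ∧ (commit.run σ).rarr 4 t = σ.rarr 5 t := by
  refine (run_for (x := 23) (y := 5) (s := σ) (fun j t => (∀ x < j, t.iarr 7 x = σ.iarr 8 x ∧
    t.rarr 4 x = σ.rarr 5 x) ∧ t.iarr 8 = σ.iarr 8 ∧ t.rarr 5 = σ.rarr 5) ?_ ?_ ?_).1
  · exact fun _ _ h => h
  · exact ⟨fun _ h => absurd h (by omega), rfl, rfl⟩
  · rintro j - t ⟨h1, h2, h3⟩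
    refine ⟨fun x hx => ?_, (run_iarr _ _ rfl).trans h2, (run_rarr _ _ rfl).trans h3⟩
    by_cases e : x = j
    · subst e
      simp [block, Cmd.run, IExpr.eval, h2, h3]
    · simpa [block, Cmd.run, IExpr.eval, e] using h1 x (by omega)

/-- Make the current point the last one of its color. -/
def record : Cmd :=
  block [store 9 (.var 9) (.const 1), rstore 2 (.var 9) 1, rstore 3 (.var 9) 2]

/-- Process one point. -/
def processPoint : Cmd := block [readColor, distances, relaxAll, commit, record]

/-- The effect of processing a point with coordinates `x`, `y` and color `B`. -/
structure StepSpec (k : ℕ) (σ σ' : State) (x y : ℝ) (B : ℕ) : Prop where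
  tables : Tables k σ'
  ivar_zero : σ'.ivar 0 = σ.ivar 0
  ivar_eight : σ'.ivar 8 = σ.ivar 8 + k
  iarr_zero : σ'.iarr 0 = σ.iarr 0
  rarr_zero : σ'.rarr 0 = σ.rarr 0
  rarr_one : σ'.rarr 1 = σ.rarr 1
  seen : ∀ A, σ'.iarr 9 A = if A = B then 1 else σ.iarr 9 A
  rarr_two : ∀ A, σ'.rarr 2 A = if A = B then x else σ.rarr 2 A
  rarr_three : ∀ A, σ'.rarr 3 A = if A = B then y else σ.rarr 3 A
  attained : ∀ t < numStates k, σ'.iarr 7 t = 1 → ∃ q < numStates k, ∃ s < numStates k,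
    σ.iarr 7 s = 1 ∧ Check k (2 ^ k) (fun A => σ.iarr 9 A = 1) B (fun A => q.testBit A = true)
      (SameLabel k s) (SameLabel k t) ∧
    σ'.rarr 4 t = σ.rarr 4 s + ∑ A ∈ Finset.range (2 ^ k),
      if q.testBit A = true ∧ σ.iarr 9 A = 1 then lastDist σ x y A else 0
  le_cost : ∀ q < numStates k, ∀ s < numStates k, ∀ t < numStates k, σ.iarr 7 s = 1 →
    Check k (2 ^ k) (fun A => σ.iarr 9 A = 1) B (fun A => q.testBit A = true)
      (SameLabel k s) (SameLabel k t) →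
    σ'.iarr 7 t = 1 ∧ σ'.rarr 4 t ≤ σ.rarr 4 s + ∑ A ∈ Finset.range (2 ^ k),
      if q.testBit A = true ∧ σ.iarr 9 A = 1 then lastDist σ x y A else 0

/-- The specifications of the five phases are joined by the frame rules, with the intermediate
states named so that each phase is unfolded only once. -/
theorem run_processPoint {k : ℕ} (hk : 1 ≤ k) {σ : State} (hσ : Tables k σ) :
    StepSpec k σ (processPoint.run σ) (σ.rarr 0 (σ.ivar 20)) (σ.rarr 1 (σ.ivar 20))
      (bitSum (fun c => decide (σ.iarr 0 (σ.ivar 8 + c) = 1)) k) := by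
  obtain ⟨B, hB⟩ : ∃ B, B = bitSum (fun c => decide (σ.iarr 0 (σ.ivar 8 + c) = 1)) k := ⟨_, rfl⟩
  rw [← hB]
  have hBk : B < 2 ^ k := hB ▸ bitSum_lt _ _
  obtain ⟨σ1, e1⟩ : ∃ t, t = readColor.run σ := ⟨_, rfl⟩
  obtain ⟨σ2, e2⟩ : ∃ t, t = distances.run σ1 := ⟨_, rfl⟩
  obtain ⟨σ3, e3⟩ : ∃ t, t = relaxAll.run σ2 := ⟨_, rfl⟩
  obtain ⟨σ4, e4⟩ : ∃ t, t = commit.run σ3 := ⟨_, rfl⟩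
  obtain ⟨σ5, e5⟩ : ∃ t, t = record.run σ4 := ⟨_, rfl⟩
  have e : processPoint.run σ = σ5 := by
    rw [e5, e4, e3, e2, e1]
    rfl
  rw [e]
  have t1 : Tables k σ1 := by
    rw [e1]
    exact hσ.of_eq (run_ivar _ _ rfl) (run_ivar _ _ rfl) (run_ivar _ _ rfl) (run_iarr _ _ rfl)
      (run_iarr _ _ rfl) (run_iarr _ _ rfl) (run_iarr _ _ rfl)
  have t2 : Tables k σ2 := by
    rw [e2]
    exact t1.of_eq (run_ivar _ _ rfl) (run_ivar _ _ rfl) (run_ivar _ _ rfl) (run_iarr _ _ rfl)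
      (run_iarr _ _ rfl) (run_iarr _ _ rfl) (run_iarr _ _ rfl)
  have t3 : Tables k σ3 := by
    rw [e3]
    exact t2.of_eq (run_ivar _ _ rfl) (run_ivar _ _ rfl) (run_ivar _ _ rfl) (run_iarr _ _ rfl)
      (run_iarr _ _ rfl) (run_iarr _ _ rfl) (run_iarr _ _ rfl)
  have t4 : Tables k σ4 := by
    rw [e4]
    exact t3.of_eq (run_ivar _ _ rfl) (run_ivar _ _ rfl) (run_ivar _ _ rfl) (run_iarr _ _ rfl)
      (run_iarr _ _ rfl) (run_iarr _ _ rfl) (run_iarr _ _ rfl)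
  have t5 : Tables k σ5 := by
    rw [e5]
    exact t4.of_eq (run_ivar _ _ rfl) (run_ivar _ _ rfl) (run_ivar _ _ rfl) (run_iarr _ _ rfl)
      (run_iarr _ _ rfl) (run_iarr _ _ rfl) (run_iarr _ _ rfl)
  obtain ⟨b9, b8⟩ := run_readColor σ
  rw [← e1, hσ.ivar_one] at b9 b8
  rw [← hB] at b9
  have iarr1 : σ1.iarr = σ.iarr := by
    funext a; rw [e1]; exact run_iarr _ _ rfl
  have rarr1 : σ1.rarr = σ.rarr := by
    funext a; rw [e1]; exact run_rarr _ _ rfl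
  have v20 : σ1.ivar 20 = σ.ivar 20 := by rw [e1]; exact run_ivar _ _ rfl
  obtain ⟨dx, dy, dd⟩ := run_distances σ1
  rw [← e2, v20, rarr1] at dx dy
  rw [← e2, v20, rarr1, t1.ivar_two] at dd
  obtain ⟨x, hx⟩ : ∃ x, x = σ.rarr 0 (σ.ivar 20) := ⟨_, rfl⟩
  obtain ⟨y, hy⟩ : ∃ y, y = σ.rarr 1 (σ.ivar 20) := ⟨_, rfl⟩
  rw [← hx] at dx
  rw [← hy] at dy
  rw [← hx, ← hy] at dd ⊢
  have iarr2 : σ2.iarr = σ.iarr := by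
    rw [← iarr1]; funext a; rw [e2]; exact run_iarr _ _ rfl
  have rarr24 : σ2.rarr 4 = σ.rarr 4 := by
    rw [e2, run_rarr _ _ rfl, rarr1]
  have v29 : σ2.ivar 9 = B := by rw [e2, run_ivar _ _ rfl, b9]
  have hw : ∀ q, weight k σ2 q = ∑ A ∈ Finset.range (2 ^ k),
      if q.testBit A = true ∧ σ.iarr 9 A = 1 then lastDist σ x y A else 0 := by
    intro q
    refine Finset.sum_congr rfl fun A hA => ?_
    rw [iarr2, dd A (Finset.mem_range.1 hA)]
    simp only [lastDist, rarr1]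
  obtain ⟨r1, r2⟩ := run_relaxAll hk t2 (by rwa [v29])
  rw [← e3] at r1 r2
  simp only [Transition, iarr2, v29, rarr24, hw] at r1 r2
  have hc := run_commit σ3
  rw [t3.ivar_five, ← e4] at hc
  have f7 : σ5.iarr 7 = σ4.iarr 7 := by rw [e5]; exact run_iarr _ _ rfl
  have f4 : σ5.rarr 4 = σ4.rarr 4 := by rw [e5]; exact run_rarr _ _ rfl
  have v49 : σ4.ivar 9 = B := by rw [e4, run_ivar _ _ rfl, e3, run_ivar _ _ rfl, v29]
  have v41 : σ4.rvar 1 = x := by rw [e4, run_rvar _ _ rfl, e3, run_rvar _ _ rfl, dx]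
  have v42 : σ4.rvar 2 = y := by rw [e4, run_rvar _ _ rfl, e3, run_rvar _ _ rfl, dy]
  -- The point is recorded only after the costs are committed, so the transitions refer to the
  -- colors seen before it.
  have g9 : σ4.iarr 9 = σ.iarr 9 := by
    rw [e4, run_iarr _ _ rfl, e3, run_iarr _ _ rfl, iarr2]
  have g : ∀ a ∈ [0, 1, 2, 3], σ4.rarr a = σ.rarr a := by
    intro a ha
    rw [← rarr1, e4, run_rarr, e3, run_rarr, e2, run_rarr] <;> fin_cases ha <;> rfl
  have e5' : σ5 = ((σ4.setIArr 9 B 1).setRArr 2 B x).setRArr 3 B y := by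
    rw [e5]
    simp [record, block, Cmd.run, IExpr.eval, v49, v41, v42]
  refine ⟨t5, ?_, ?_, ?_, ?_, ?_, ?_, ?_, ?_, ?_, ?_⟩
  · rw [← e]; exact run_ivar _ _ rfl
  · rw [e5, run_ivar _ _ rfl, e4, run_ivar _ _ rfl, e3, run_ivar _ _ rfl, e2, run_ivar _ _ rfl, b8]
  · rw [← e]; exact run_iarr _ _ rfl
  · rw [← e]; exact run_rarr _ _ rfl
  · rw [← e]; exact run_rarr _ _ rfl
  · intro A
    rw [e5']
    simp [g9]
  · intro A
    rw [e5']
    simp [g 2]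
  · intro A
    rw [e5']
    simp [g 3]
  · intro t ht h
    rw [f7, (hc t ht).1] at h
    rw [f4, (hc t ht).2]
    obtain ⟨q, hq, s, hs, ⟨h1, h2⟩, h3⟩ := r1 t ht h
    exact ⟨q, hq, s, hs, h1, h2, h3⟩
  · intro q hq s hs t ht h1 h2
    rw [f7, f4, (hc t ht).1, (hc t ht).2]
    exact r2 q hq s hs t ht trivial ⟨h1, h2⟩

/-! ### The invariant of the dynamic program -/

variable {k n : ℕ}

open Classical in
/-- The color of a point as a number. -/
noncomputable def Input.color (I : Input k n) (u : Fin n) : ℕ :=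
  bitSum (fun c => decide (∃ h : c < k, (⟨c, h⟩ : Fin k) ∈ I.α u)) k

theorem Input.color_lt (I : Input k n) (u : Fin n) : I.color u < 2 ^ k := bitSum_lt _ _

theorem Input.testBit_color (I : Input k n) (u : Fin n) (c : Fin k) :
    (I.color u).testBit c = true ↔ c ∈ I.α u := by
  rw [Input.color, testBit_bitSum _ c.2]
  simp

/-- The distance of two points. -/
noncomputable def Input.pointDist (I : Input k n) (u v : Fin n) : ℝ := dist (I.p u) (I.p v)

theorem bitSum_congr {f g : ℕ → Bool} {m : ℕ} (h : ∀ j < m, f j = g j) :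
    bitSum f m = bitSum g m := by
  induction m with
  | zero => rfl
  | succ m ih => rw [bitSum, bitSum, h m (by omega), ih fun j hj => h j (by omega)]

/-- The table entry is defined by an existential over rows and columns; division by `k` shows that
position `k * u + c` belongs to row `u` and column `c` only. -/
theorem Input.color_eq (I : Input k n) (u : Fin n) :
    bitSum (fun c => decide (I.initialState.iarr 0 (k * u + c) = 1)) k = I.color u := by
  classical
  refine bitSum_congr fun c hc => ?_
  refine decide_eq_decide.2 ?_
  simp only [Input.initialState, true_and]
  constructor
  · intro h
    by_cases h' : ∃ (i : Fin n) (c' : Fin k), k * u + c = k * i + c' ∧ c' ∈ I.α i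
    · obtain ⟨i, c', h1, h2⟩ := h'
      have hk : 0 < k := by omega
      have e1 : (u : ℕ) = i := by
        have := congrArg (· / k) h1
        simpa [Nat.mul_add_div hk, Nat.div_eq_of_lt hc, Nat.div_eq_of_lt c'.2] using this
      have e2 : c = c' := by
        rw [e1] at h1
        omega
      refine ⟨hc, ?_⟩
      rw [Fin.ext e1]
      convert h2
    · rw [if_neg h'] at h
      omega
  · rintro ⟨h1, h2⟩
    rw [if_pos ⟨u, ⟨c, h1⟩, rfl, h2⟩]

/-- The memory after the first `i` points have been processed. -/
structure Invariant (I : Input k n) (i : ℕ) (σ : State) (last : ℕ → Fin n) : Prop where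
  tables : Tables k σ
  ivar_zero : σ.ivar 0 = n
  ivar_eight : σ.ivar 8 = k * i
  iarr_zero : σ.iarr 0 = I.initialState.iarr 0
  rarr_zero : σ.rarr 0 = I.initialState.rarr 0
  rarr_one : σ.rarr 1 = I.initialState.rarr 1
  stage : Stage I.color i (fun A => σ.iarr 9 A = 1) last
  rarr_two : ∀ A, σ.iarr 9 A = 1 → σ.rarr 2 A = I.p (last A) 0
  rarr_three : ∀ A, σ.iarr 9 A = 1 → σ.rarr 3 A = I.p (last A) 1
  realized : ∀ s < numStates k, σ.iarr 7 s = 1 → Realized k I.color I.pointDist i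
    (fun A => σ.iarr 9 A = 1) last (SameLabel k s) (σ.rarr 4 s)
  tracked : ∀ G, Spanning k I.color G → LeftNormal I.color G → ∃ s < numStates k,
    σ.iarr 7 s = 1 ∧ Tracks k I.color G i (fun A => σ.iarr 9 A = 1) last (SameLabel k s) ∧
      σ.rarr 4 s ≤ totalCost I.pointDist (below G i)

/-- `Check` consults the edge set only for colors below `M`, so a number with `M` prescribed bits
can replace an arbitrary predicate. -/
theorem Check.congr {k M B : ℕ} {seen Q Q' : ℕ → Prop} {E E' : ℕ → ℕ → ℕ → Prop}
    (hQ : ∀ A < M, Q A ↔ Q' A) (h : Check k M seen B Q E E') : Check k M seen B Q' E E' := by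
  have e : ∀ c A, Touched M seen Q E c A ↔ Touched M seen Q' E c A := fun c A =>
    exists_congr fun A' => and_congr_right fun hA' => by rw [hQ A' hA']
  simpa only [Check, e] using h

theorem sq_dist_last (I : Input k n) {σ : State} {last : ℕ → Fin n} {A : ℕ}
    (h2 : σ.rarr 2 A = I.p (last A) 0) (h3 : σ.rarr 3 A = I.p (last A) 1) (v : Fin n) :
    lastDist σ (I.p v 0) (I.p v 1) A = I.pointDist (last A) v := by
  rw [Input.pointDist, dist_comm, EuclideanSpace.dist_eq, Fin.sum_univ_two, lastDist, h2, h3,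
    Real.dist_eq, Real.dist_eq, sq_abs, sq_abs, sq, sq]

/-- Attained costs combine with `Realized.succ` to give soundness. The bounds for all admissible
transitions, applied to the one that `Tracks.succ` provides, give completeness. -/
theorem Invariant.succ (hk : 1 ≤ k) {I : Input k n} {i : ℕ} (hi : i < n) {σ : State}
    {last : ℕ → Fin n} (h : Invariant I i σ last) :
    Invariant I (i + 1) (processPoint.run (σ.setI 20 i))
      (Function.update last (I.color ⟨i, hi⟩) ⟨i, hi⟩) := by
  obtain ⟨v, hv⟩ : ∃ v : Fin n, v = ⟨i, hi⟩ := ⟨_, rfl⟩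
  rw [← hv]
  have hvi : v.val = i := by rw [hv]
  have spec := run_processPoint hk (h.tables.setI (x := 20) (by omega) i)
  have ex : (σ.setI 20 i).rarr 0 ((σ.setI 20 i).ivar 20) = I.p v 0 := by
    simp [h.rarr_zero, Input.initialState, hi, hv]
  have ey : (σ.setI 20 i).rarr 1 ((σ.setI 20 i).ivar 20) = I.p v 1 := by
    simp [h.rarr_one, Input.initialState, hi, hv]
  have eB : bitSum (fun c => decide ((σ.setI 20 i).iarr 0 ((σ.setI 20 i).ivar 8 + c) = 1)) k =
      I.color v := by
    rw [← I.color_eq v, hvi]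
    simp [h.iarr_zero, h.ivar_eight]
  rw [ex, ey, eB] at spec
  generalize processPoint.run (σ.setI 20 i) = σ' at spec
  have hseen : (fun A => σ'.iarr 9 A = 1) = fun A => σ.iarr 9 A = 1 ∨ A = I.color v := by
    funext A
    rw [spec.seen A]
    by_cases e : A = I.color v <;> simp [e]
  -- For a color not yet seen the stored coordinates mean nothing, but both sums skip it.
  have hw : ∀ q : ℕ, (∑ A ∈ Finset.range (2 ^ k), if q.testBit A = true ∧ (σ.setI 20 i).iarr 9 A = 1
      then lastDist (σ.setI 20 i) (I.p v 0) (I.p v 1) A else 0) =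
      ∑ A ∈ Finset.range (2 ^ k), if q.testBit A = true ∧ σ.iarr 9 A = 1
        then I.pointDist (last A) v else 0 := by
    intro q
    refine Finset.sum_congr rfl fun A _ => ?_
    by_cases c : q.testBit A = true ∧ σ.iarr 9 A = 1
    · rw [if_pos c]
      exact (if_pos c).trans (sq_dist_last I (h.rarr_two A c.2) (h.rarr_three A c.2) v)
    · rw [if_neg c]
      exact if_neg c
  have attained := spec.attained
  have le_cost := spec.le_cost
  simp only [hw] at attained le_cost
  simp only [State.setI_iarr, State.setI_rarr] at attained le_cost
  refine ⟨spec.tables, ?_, ?_, ?_, ?_, ?_, ?_, ?_, ?_, ?_, ?_⟩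
  · rw [spec.ivar_zero]; simpa using h.ivar_zero
  · rw [spec.ivar_eight]; simp [h.ivar_eight]; ring
  · rw [spec.iarr_zero]; exact h.iarr_zero
  · rw [spec.rarr_zero]; exact h.rarr_zero
  · rw [spec.rarr_one]; exact h.rarr_one
  · rw [hseen]
    exact h.stage.succ hvi
  · intro A hA
    rw [spec.rarr_two]
    by_cases e : A = I.color v
    · simp [e]
    · rw [Function.update_of_ne e, if_neg e]
      rw [spec.seen, if_neg e] at hA
      exact h.rarr_two A hA
  · intro A hA
    rw [spec.rarr_three]
    by_cases e : A = I.color v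
    · simp [e]
    · rw [Function.update_of_ne e, if_neg e]
      rw [spec.seen, if_neg e] at hA
      exact h.rarr_three A hA
  · intro t ht hf
    obtain ⟨q, hq, s, hs, h1, h2, h3⟩ := attained t ht hf
    rw [hseen, h3]
    convert (h.realized s hs h1).succ I.color_lt h.stage hvi (fun _ _ _ h => h.symm) h2
  · intro G hG hG'
    obtain ⟨s, hs, h1, h2, h3⟩ := h.tracked G hG hG'
    classical
    -- The new state encodes reachability between the updated last vertices. For unseen colors
    -- `last` is a dummy value; `Tracks` ignores these.
    let r : ℕ → Setoid ℕ := fun c => (colorGraph I.color (below G (i + 1)) c).reachableSetoid.comap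
      (Function.update last (I.color v) v)
    obtain ⟨t, ht, htr⟩ := exists_state k r
    have hlt : ∀ A, (σ.iarr 9 A = 1 ∨ A = I.color v) → A < 2 ^ k := by
      rintro A (hA | rfl)
      · rw [← h.stage.color_last A hA]
        exact I.color_lt _
      · exact I.color_lt _
    have htracks : Tracks k I.color G (i + 1) (fun A => σ.iarr 9 A = 1 ∨ A = I.color v)
        (Function.update last (I.color v) v) (SameLabel k t) := by
      intro c hc A hA _ A' hA' _
      exact htr c hc A (hlt A hA) A' (hlt A' hA')
    let q := bitSum (fun A => decide (G.Adj (last A) v)) (2 ^ k)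
    have hqA : ∀ A < 2 ^ k, (G.Adj (last A) v ↔ q.testBit A = true) := by
      intro A hA
      simp [q, testBit_bitSum _ hA]
    -- A set of full colors has $2^k$ bits and `2 ^ k ≤ numBits k`, so the loop bound and the bit
    -- table for states also serve for edge sets.
    have hq : q < numStates k := (bitSum_lt _ _).trans_le
      (Nat.pow_le_pow_right (by omega) (two_pow_le_numBits hk))
    have hcheck := (h2.succ I.color_lt hG hG' h.stage hvi htracks).congr hqA
    obtain ⟨h4, h5⟩ := le_cost q hq s hs t ht h1 hcheck
    refine ⟨t, ht, h4, ?_, h5.trans ?_⟩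
    · rwa [hseen]
    · rw [totalCost_below_succ I.color_lt I.pointDist hG' h.stage hvi]
      refine add_le_add h3 (le_of_eq (Finset.sum_congr rfl fun A hA => ?_))
      have := hqA A (Finset.mem_range.1 hA)
      by_cases c : G.Adj (last A) v ∧ σ.iarr 9 A = 1
      · rw [if_pos c, if_pos ⟨this.1 c.1, c.2⟩]
      · rw [if_neg c, if_neg fun h => c ⟨this.2 h.1, h.2⟩]

/-- No color has been seen, so all conditions on connections are vacuous, and the costs are zero in
the initial memory. -/
theorem invariant_setup (I : Input k n) (hn : 0 < n) :
    Invariant I 0 (setupState I.initialState) fun _ => ⟨0, hn⟩ := by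
  obtain ⟨h1, h2⟩ := setupState_spec (k := k) I.initialState rfl rfl rfl rfl rfl
  have h9 : (setupState I.initialState).iarr 9 = I.initialState.iarr 9 := by
    rw [setupState, run_iarr _ _ rfl, run_iarr _ _ rfl, run_iarr _ _ rfl, run_iarr _ _ rfl]
  have hr : (setupState I.initialState).rarr = I.initialState.rarr := by
    funext a
    rw [setupState, run_rarr _ _ rfl, run_rarr _ _ rfl, run_rarr _ _ rfl, run_rarr _ _ rfl]
  have hseen : ∀ A, ¬ (setupState I.initialState).iarr 9 A = 1 := by
    intro A
    rw [h9]
    simp [Input.initialState]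
  have h4 : ∀ s, (setupState I.initialState).rarr 4 s = 0 := by
    intro s
    rw [hr]
    simp [Input.initialState]
  refine ⟨h1, ?_, ?_, ?_, by rw [hr], by rw [hr], ?_, fun A h => absurd h (hseen A),
    fun A h => absurd h (hseen A), ?_, ?_⟩
  · rw [setupState, run_ivar _ _ rfl, run_ivar _ _ rfl, run_ivar _ _ rfl, run_ivar _ _ rfl]
    simp [Input.initialState]
  · rw [setupState, run_ivar _ _ rfl, run_ivar _ _ rfl, run_ivar _ _ rfl, run_ivar _ _ rfl]
    simp [Input.initialState]
  · rw [setupState, run_iarr _ _ rfl, run_iarr _ _ rfl, run_iarr _ _ rfl, run_iarr _ _ rfl]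
  · exact ⟨fun A h => absurd h (hseen A), fun A h => absurd h (hseen A),
      fun u h => absurd h (by omega), fun u h => absurd h (by omega)⟩
  · intro s _ _
    -- This is the empty graph.
    refine ⟨below ⊤ 0, fun u v h => h.2.1, ?_, fun _ _ A h => absurd h (hseen A),
      fun u h => absurd h (by omega)⟩
    rw [totalCost_below_zero, h4]
  · intro G _ _
    refine ⟨0, Nat.two_pow_pos _, by rw [h2]; simp, fun _ _ A h => absurd h (hseen A), ?_⟩
    rw [totalCost_below_zero, h4]

/-! ### The result -/

/-- Put the least cost of a state in which all colors are connected into the real variable `0`. -/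
def finish : Cmd :=
  block [assign 12 (.const 0), .for 21 5 (.ite (.and (.eq (.arr 7 (.var 21)) (.const 1)) finalTest)
    (block [rload 6 4 (.var 21), .ite (.or (.not (.eq (.var 12) (.const 1))) (.rlt 6 0))
      (block [rload 0 4 (.var 21), assign 12 (.const 1)]) skip]) skip)]

/-- All primary colors are connected in the state `s`. -/
def Final (k : ℕ) (σ : State) (s : ℕ) : Prop :=
  σ.iarr 7 s = 1 ∧ ∀ c < k, ∀ A < 2 ^ k, σ.iarr 9 A = 1 → A.testBit c = true →
    ∀ A' < 2 ^ k, σ.iarr 9 A' = 1 → A'.testBit c = true → SameLabel k s c A A'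

/-- A running minimum over the final states, with variable `12` telling whether one has been met.
This flag is needed because real variable `0` has no meaningful starting value. -/
theorem run_finish (hk : 1 ≤ k) {σ : State} (hσ : Tables k σ)
    (hex : ∃ s < numStates k, Final k σ s) :
    ∃ s < numStates k, Final k σ s ∧ (finish.run σ).rvar 0 = σ.rarr 4 s ∧
      ∀ s' < numStates k, Final k σ s' → σ.rarr 4 s ≤ σ.rarr 4 s' := by
  have main := run_for (x := 21) (y := 5) (s := σ.setI 12 0)
    (c := .ite (.and (.eq (.arr 7 (.var 21)) (.const 1)) finalTest)
      (block [rload 6 4 (.var 21), .ite (.or (.not (.eq (.var 12) (.const 1))) (.rlt 6 0))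
        (block [rload 0 4 (.var 21), assign 12 (.const 1)]) skip]) skip)
    (fun j t => Same σ t ∧
      (t.ivar 12 = 1 → ∃ s < numStates k, Final k σ s ∧ t.rvar 0 = σ.rarr 4 s) ∧
      ∀ s < j, Final k σ s → t.ivar 12 = 1 ∧ t.rvar 0 ≤ σ.rarr 4 s) ?_ ?_ ?_
  · have e5 : (σ.setI 12 0).ivar 5 = numStates k := by simpa using hσ.ivar_five
    rw [e5] at main
    obtain ⟨-, h1, h2⟩ := main
    obtain ⟨s, hs, hf⟩ := hex
    obtain ⟨s', hs', hf', he⟩ := h1 (h2 s hs hf).1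
    exact ⟨s', hs', hf', he, fun s'' hs'' hf'' => by
      rw [← he]
      exact (h2 s'' hs'' hf'').2⟩
  · rintro j t ⟨h1, h2, h3⟩
    exact ⟨h1.setI (by omega) _, by simpa using h2, by simpa using h3⟩
  · exact ⟨(Same.refl σ).setI (by omega) _, by simp, fun _ h => absurd h (by omega)⟩
  · rintro j hj t ⟨h1, h2, h3⟩
    have hj : j < numStates k := by simpa [hσ.ivar_five] using hj
    have h1' := h1.setI (x := 21) (by omega) j
    have hf : BExpr.Holds (.and (.eq (.arr 7 (.var 21)) (.const 1)) finalTest) (t.setI 21 j) ↔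
        Final k σ j := by
      rw [BExpr.Holds, holds_finalTest hk (h1'.tables hσ) (by simpa), h1'.iarr 9 (by simp)]
      simp [BExpr.Holds, IExpr.eval, h1.iarr 7, Final]
    refine ⟨h1'.run rfl, ?_⟩
    by_cases c : Final k σ j
    · rw [Cmd.run, if_pos (hf.2 c)]
      by_cases d : ¬ t.ivar 12 = 1 ∨ σ.rarr 4 j < t.rvar 0
      · have e : (block [rload 6 4 (.var 21),
            .ite (.or (.not (.eq (.var 12) (.const 1))) (.rlt 6 0))
              (block [rload 0 4 (.var 21), assign 12 (.const 1)]) skip]).run (t.setI 21 j) =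
            (((t.setI 21 j).setR 6 (σ.rarr 4 j)).setR 0 (σ.rarr 4 j)).setI 12 1 := by
          simp only [block, Cmd.run, IExpr.eval, BExpr.holds_or, BExpr.Holds, State.setR_rvar,
            State.setR_ivar, State.setI_ivar, State.setI_rvar, State.setI_rarr, State.setR_rarr,
            if_true, if_false, h1.rarr 4 (by simp), Nat.reduceEqDiff, OfNat.zero_ne_ofNat]
          rw [if_pos d]
        rw [e]
        refine ⟨fun _ => ⟨j, hj, c, by simp⟩, fun s hs hfs => ⟨by simp, ?_⟩⟩
        simp only [State.setI_rvar, State.setR_rvar, if_true]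
        by_cases es : s = j
        · rw [es]
        · have h4 := h3 s (by omega) hfs
          rcases d with d | d
          · exact absurd h4.1 d
          · exact d.le.trans h4.2
      · have e : (block [rload 6 4 (.var 21),
            .ite (.or (.not (.eq (.var 12) (.const 1))) (.rlt 6 0))
              (block [rload 0 4 (.var 21), assign 12 (.const 1)]) skip]).run (t.setI 21 j) =
            (t.setI 21 j).setR 6 (σ.rarr 4 j) := by
          simp only [block, Cmd.run, IExpr.eval, BExpr.holds_or, BExpr.Holds, State.setR_rvar,
            State.setR_ivar, State.setI_ivar, State.setI_rvar, State.setI_rarr, State.setR_rarr,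
            if_true, if_false, h1.rarr 4 (by simp), Nat.reduceEqDiff, OfNat.zero_ne_ofNat]
          rw [if_neg d]
        rw [e]
        push Not at d
        refine ⟨by simpa using h2, fun s hs hfs => ?_⟩
        by_cases es : s = j
        · simpa [es] using d
        · simpa using h3 s (by omega) hfs
    · rw [Cmd.run, if_neg fun h => c (hf.1 h)]
      refine ⟨by simpa [Cmd.run] using h2, fun s hs hfs => ?_⟩
      have es : s ≠ j := by
        rintro rfl
        exact c hfs
      simpa [Cmd.run] using h3 s (by omega) hfs

/-! ### Optimality of the output -/

theorem exists_spanning_leftNormal (I : Input k n) (hI : I.SortedCollinear)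
    {G : SimpleGraph (Fin n)} (hG : I.IsCSG G) :
    ∃ H, Spanning k I.color H ∧ LeftNormal I.color H ∧ totalCost I.pointDist H ≤ I.cost G := by
  rw [← totalCost_eq_cost]
  exact exists_leftNormal (fun _ _ => dist_nonneg)
    (fun u w v h1 h2 => (hI.sorted u w v h1 h2).dist_add_dist)
    ((isCSG_iff I I.testBit_color G).1 hG)

/-- The output is at most the cost of each colored spanning graph, because its left normal form is
tracked. It is at least the cost of some such graph, because the selected state is realized.
Together these give equality. -/
theorem Invariant.isMinCost (hk : 1 ≤ k) {I : Input k n} (hI : I.SortedCollinear) {σ : State}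
    {last : ℕ → Fin n} (h : Invariant I n σ last) : I.IsMinCost ((finish.run σ).rvar 0) := by
  have complete : ∀ G, I.IsCSG G → ∃ s < numStates k, Final k σ s ∧ σ.rarr 4 s ≤ I.cost G := by
    intro G hG
    obtain ⟨H, h1, h2, h3⟩ := exists_spanning_leftNormal I hI hG
    obtain ⟨s, hs, h4, h5, h6⟩ := h.tracked H h1 h2
    rw [below_self] at h6
    refine ⟨s, hs, ⟨h4, ?_⟩, h6.trans h3⟩
    intro c hc A _ hA hAc A' _ hA' hA'c
    rw [h5 c hc A hA hAc A' hA' hA'c, below_self]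
    refine h1 c hc _ _ ?_ ?_
    · rwa [h.stage.color_last A hA]
    · rwa [h.stage.color_last A' hA']
  -- The complete graph is a solution, so at least one final state exists.
  have htop : I.IsCSG ⊤ := by
    intro c u v
    by_cases e : u = v
    · rw [e]
    · exact SimpleGraph.Adj.reachable fun h => e (Subtype.ext h)
  obtain ⟨s, hs, hf, he, hle⟩ := run_finish hk h.tables (by
    obtain ⟨s, hs, hf, -⟩ := complete ⊤ htop
    exact ⟨s, hs, hf⟩)
  have hlower : ∀ G, I.IsCSG G → σ.rarr 4 s ≤ I.cost G := by
    intro G hG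
    obtain ⟨s', hs', hf', h1⟩ := complete G hG
    exact (hle s' hs' hf').trans h1
  have hlt : ∀ A, σ.iarr 9 A = 1 → A < 2 ^ k := by
    intro A hA
    rw [← h.stage.color_last A hA]
    exact I.color_lt _
  obtain ⟨G, hG, hw⟩ := (h.realized s hs hf.1).exists_spanning
    fun c hc A hA hAc A' hA' hA'c => hf.2 c hc A (hlt A hA) hA hAc A' (hlt A' hA') hA' hA'c
  have hG' : I.IsCSG G := (isCSG_iff I I.testBit_color G).2 hG
  rw [he]
  refine ⟨⟨G, hG', le_antisymm ?_ (hlower G hG')⟩, ?_⟩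
  · rw [← totalCost_eq_cost]
    exact hw
  · rintro _ ⟨G, hG, rfl⟩
    exact hlower G hG

/-! ### The whole program and its running time -/

/-- The program. -/
def minCostProgram : Program :=
  .seq (powTwo 2 1).comp (.seq setupSizes.comp (.seq (powTwo 5 4).comp (.seq setupTables.comp
    (.seq (Cmd.for 20 0 processPoint).comp finish.comp))))

/-- The exponent in the bound for the running time. -/
def minCostDeg : ℕ :=
  max (powTwo 2 1).deg (max setupSizes.deg (max (powTwo 5 4).deg (max setupTables.deg
    (max processPoint.deg finish.deg))))

/-- The number `n` bounds only the outermost loop. All other bounds are `k`, `2 ^ k`, `numBits k` or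
`numStates k`, hence at most `numStates k`, which is taken as the base `V` of the compiler bounds.
-/
theorem simulates_minCostProgram (hk : 1 ≤ k) (hn : 1 ≤ n) (I : Input k n) :
    ∃ σ last, Invariant I n σ last ∧ Simulates minCostProgram I.initialState (finish.run σ)
      (numStates k ^ (minCostDeg + 2) * n) := by
  have hV := four_le_numStates hk
  have hkN : k ≤ numStates k := (le_numBits hk).trans (numBits_lt_numStates k).le
  have hMN : 2 ^ k ≤ numStates k := (two_pow_le_numBits hk).trans (numBits_lt_numStates k).le
  obtain ⟨s1, e1⟩ : ∃ t, t = (powTwo 2 1).run I.initialState := ⟨_, rfl⟩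
  obtain ⟨s2, e2⟩ : ∃ t, t = setupSizes.run s1 := ⟨_, rfl⟩
  obtain ⟨s3, e3⟩ : ∃ t, t = (powTwo 5 4).run s2 := ⟨_, rfl⟩
  obtain ⟨s4, e4⟩ : ∃ t, t = setupTables.run s3 := ⟨_, rfl⟩
  have v11 : s1.ivar 1 = k := by rw [e1]; exact run_ivar _ _ rfl
  have v12 : s1.ivar 2 = 2 ^ k := by
    rw [e1]; exact run_powTwo (x := 2) (b := 1) I.initialState (by decide) (by decide)
  have v24 : s2.ivar 4 = numBits k := by rw [e2, e1]; exact setup_sizes _ rfl rfl rfl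
  have v35 : s3.ivar 5 = numStates k := by
    rw [e3, run_powTwo _ (by decide) (by decide), v24]; rfl
  have v31 : s3.ivar 1 = k := by rw [e3, run_ivar _ _ rfl, e2, run_ivar _ _ rfl, v11]
  have v32 : s3.ivar 2 = 2 ^ k := by rw [e3, run_ivar _ _ rfl, e2, run_ivar _ _ rfl, v12]
  have v34 : s3.ivar 4 = numBits k := by rw [e3, run_ivar _ _ rfl, v24]
  have hinit : Invariant I 0 s4 fun _ => ⟨0, hn⟩ := by
    rw [e4, e3, e2, e1]; exact invariant_setup I hn
  have sim1 : Simulates (powTwo 2 1).comp I.initialState s1 (numStates k ^ (powTwo 2 1).deg) := by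
    rw [e1]
    refine simulates hV _ _ rfl rfl fun z hz => ?_
    have : z = 1 := by simpa [powTwo, block, bounds] using hz
    rw [this]
    exact hkN
  have sim2 : Simulates setupSizes.comp s1 s2 (numStates k ^ setupSizes.deg) := by
    rw [e2]
    refine simulates hV _ _ rfl rfl fun z hz => ?_
    have : z = 1 ∨ z = 2 := by simpa [setupSizes, addTimes, block, bounds] using hz
    rcases this with rfl | rfl
    · rwa [v11]
    · rwa [v12]
  have sim3 : Simulates (powTwo 5 4).comp s2 s3 (numStates k ^ (powTwo 5 4).deg) := by
    rw [e3]
    refine simulates hV _ _ rfl rfl fun z hz => ?_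
    have : z = 4 := by simpa [powTwo, block, bounds] using hz
    rw [this, v24]
    exact (numBits_lt_numStates k).le
  have sim4 : Simulates setupTables.comp s3 s4 (numStates k ^ setupTables.deg) := by
    rw [e4]
    refine simulates hV _ _ rfl rfl fun z hz => ?_
    have hz' : z ∈ [1, 2, 4, 5] := by
      revert z
      decide
    simp only [List.mem_cons, List.not_mem_nil, or_false] at hz'
    rcases hz' with rfl | rfl | rfl | rfl
    · rwa [v31]
    · rwa [v32]
    · rw [v34]
      exact (numBits_lt_numStates k).le
    · rw [v35]
  have tables_bounds : ∀ σ, Tables k σ → ∀ z ∈ [1, 2, 5], σ.ivar z ≤ numStates k := by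
    intro σ hσ z hz
    simp only [List.mem_cons, List.not_mem_nil, or_false] at hz
    rcases hz with rfl | rfl | rfl
    · rwa [hσ.ivar_one]
    · rwa [hσ.ivar_two]
    · rw [hσ.ivar_five]
  have hinv : ∀ j ≤ n, ∃ last, Invariant I j
      (repeatUpto (fun j t => processPoint.run (t.setI 20 j)) j s4) last := by
    intro j hj
    refine repeatUpto_induction (fun j t => ∃ last, Invariant I j t last) ⟨_, hinit⟩ ?_
    rintro i hi t ⟨last, h⟩
    exact ⟨_, h.succ hk (by omega)⟩
  obtain ⟨s5, e5⟩ : ∃ t, t = (Cmd.for 20 0 processPoint).run s4 := ⟨_, rfl⟩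
  -- The general bound does not apply here, as `n` may exceed `numStates k`. The loop rule with a
  -- free number of iterations yields the factor `n`.
  have sim5 : Simulates (Cmd.for 20 0 processPoint).comp s4 s5
      (n * (numStates k ^ processPoint.deg + 3) + 2) := by
    have := simulates_for (x := 20) (y := 0) (c := processPoint) (by decide) (by decide)
      (by decide) rfl rfl s4 (T := numStates k ^ processPoint.deg) ?_
    · rwa [← e5, hinit.ivar_zero] at this
    · rintro j hj t rfl
      obtain ⟨last, h⟩ := hinv j (by rw [hinit.ivar_zero] at hj; omega)
      refine simulates hV _ _ rfl rfl fun z hz => ?_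
      refine tables_bounds _ (h.tables.setI (by omega) _) z ?_
      revert z
      decide
  have hinv5 : ∃ last, Invariant I n s5 last := by
    obtain ⟨last, h⟩ := hinv n le_rfl
    refine ⟨last, ?_⟩
    rw [e5, Cmd.run, hinit.ivar_zero]
    generalize repeatUpto (fun j t => processPoint.run (t.setI 20 j)) n s4 = s at h
    obtain ⟨a1, a2, a3, a4, a5, a6, a7, a8, a9, a10, a11⟩ := h
    exact ⟨a1.setI (by omega) _, by simpa using a2, by simpa using a3, a4, a5, a6, a7, a8, a9,
      a10, a11⟩
  obtain ⟨last, hlast⟩ := hinv5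
  have sim6 : Simulates finish.comp s5 (finish.run s5) (numStates k ^ finish.deg) := by
    refine simulates hV _ _ rfl rfl fun z hz => ?_
    refine tables_bounds _ hlast.tables z ?_
    revert z
    decide
  refine ⟨s5, last, hlast, fun τ hτ => ?_⟩
  obtain ⟨τ', t, h1, h2, h3⟩ :=
    (sim1.seq (sim2.seq (sim3.seq (sim4.seq (sim5.seq sim6))))) τ hτ
  refine ⟨τ', t, h1, h2.trans ?_, h3⟩
  have mono : ∀ d ≤ minCostDeg, numStates k ^ d ≤ numStates k ^ minCostDeg :=
    fun d hd => Nat.pow_le_pow_right (by omega) hd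
  have m1 := mono (powTwo 2 1).deg (by simp [minCostDeg])
  have m2 := mono setupSizes.deg (by simp [minCostDeg])
  have m3 := mono (powTwo 5 4).deg (by simp [minCostDeg])
  have m4 := mono setupTables.deg (by simp [minCostDeg])
  have m5 := mono processPoint.deg (by simp [minCostDeg])
  have m6 := mono finish.deg (by simp [minCostDeg])
  rw [pow_add]
  -- The setup, the loop and the final phase together take at most `16 * X * n` steps, where `X`
  -- stands for `numStates k ^ minCostDeg`; this accounts for the extra `2` in the exponent.
  have h16 : 16 ≤ numStates k ^ 2 := by nlinarith
  have hpos : 1 ≤ numStates k ^ minCostDeg := Nat.one_le_pow _ _ (by omega)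
  generalize numStates k ^ minCostDeg = X at *
  have h5 : n * (numStates k ^ processPoint.deg + 3) ≤ n * (X + 3) :=
    Nat.mul_le_mul_left _ (by omega)
  have h6 : X * 16 * n ≤ X * numStates k ^ 2 * n :=
    Nat.mul_le_mul_right _ (Nat.mul_le_mul_left _ h16)
  have h7 : X ≤ X * n := Nat.le_mul_of_pos_right _ hn
  have h8 : n ≤ X * n := Nat.le_mul_of_pos_left _ hpos
  have h9 : n * (X + 3) = X * n + 3 * n := by ring
  have h10 : X * 16 * n = 16 * (X * n) := by ring
  omega

theorem solvesCollinear_minCostProgram (hk : 1 ≤ k) :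
    SolvesCollinear minCostProgram k fun n => numStates k ^ (minCostDeg + 2) * n := by
  intro n hn I hI
  obtain ⟨σ, last, h1, h2⟩ := simulates_minCostProgram hk hn I
  obtain ⟨s, t, h3, h4, h5⟩ := h2 I.initialState (Agree.refl _ _)
  refine ⟨s, t, h3, h4, ?_⟩
  rw [h5.rvar]
  exact h1.isMinCost hk hI

end MinCSG

theorem mainTheorem5 :
    ∃ P : RealRAM.Program,
      (∀ k : ℕ, 1 ≤ k → ∃ C : ℕ, MinCSG.SolvesCollinear P k (fun n => C * n)) ∧
      (∃ C : ℕ, ∀ k : ℕ, 1 ≤ k →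
        MinCSG.SolvesCollinear P k (fun n => 2 ^ (C * (k ^ 2 * 2 ^ k)) * n)) := by
  -- The exponent `minCostDeg` is computed from the program text, which does not mention `k`, so one
  -- constant works for all `k`.
  refine ⟨MinCSG.minCostProgram, fun k hk => ⟨_, MinCSG.solvesCollinear_minCostProgram hk⟩,
    MinCSG.minCostDeg + 2, fun k hk => ?_⟩
  have h := MinCSG.solvesCollinear_minCostProgram hk
  rwa [MinCSG.numStates, MinCSG.numBits, ← pow_mul, mul_comm (k ^ 2 * 2 ^ k)] at h
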